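/- Let $n\ge 2$, let $\omega\subset\mathbb R^{n-1}$ be a bounded domain (open, connected, non-empty) with Lipschitz boundary, and let $H_\pm:\overline\omega\to\mathbb R$ be Lipschitz functions. For $h>0$ let $$\Omega^h=\{(y,z)\in\mathbb R^{n-1}\times\mathbb R:\ \eta=h^{-1}y\in\omega,\ -1-hH_-(\eta)<z<1+hH_+(\eta)\}$$ be the thin cylinder with the curved ends $\Gamma^h_\pm=\{(y,z):\eta\in\omega,\ \pm z=1+hH_\pm(\eta)\}$ and the lateral side $\Sigma^h=\partial\Omega^h\setminus\overline{\Gamma^h_+\cup\Gamma^h_-}$. Let $$\Pi_\pm=\{(\eta,\zeta)\in\mathbb R^{n-1}\times\mathbb R:\ \eta\in\omega,\ \zeta>-H_\pm(\eta)\}$$ be the semi-infinite cylinders with the curved ends $\Gamma_\pm=\{(\eta,\zeta):\eta\in\omega,\ \zeta=-H_\pm(\eta)\}$ and the lateral sides $\Sigma_\pm=\partial\Pi_\pm\setminus\overline{\Gamma_\pm}$. For an open set $G$ and $S\subset\partial G$ let $\mathring H^1(G;S)$ be the closure in $H^1(G)$ of the restrictions to $G$ of smooth compactly supported functions on the whole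 space that vanish in a neighbourhood of $\overline S$. An eigenvalue of the problem in $(G,S)$ is a number $\Lambda\in\mathbb R$ for which there is $U\in\mathring H^1(G;S)$, $U\ne0$, with $(\nabla U,\nabla V)_G=\Lambda\,(U,V)_G$ for all $V\in\mathring H^1(G;S)$; its multiplicity is the dimension of the space of such $U$ together with $0$. Let $\mu_1$ be the smallest eigenvalue of the problem in $(\omega,\partial\omega)$, that is, of the Dirichlet problem on the cross-section. Let $\delta_1>0$, and let $\Lambda^\pm_1,\dots,\Lambda^\pm_{N^\pm}$ be all the eigenvalues of the problem in $(\Pi_\pm,\Sigma_\pm)$ that lie in $(0,\mu_1-\delta_1]$, listed with multiplicities. Put $N=N^++N^-$ and arrange the numbers of both lists together in increasing order, $$0<\Lambda^{(1)}\le\Lambda^{(2)}\le\dots\le\Lambda^{(N)}\le\mu_1-\delta_1 .$$ Then for every $p=1,\dots,N$ there are positive numbers $c_p,\tau_p,h_p$ such that, for all $h\in(0,h_p]$, the eigenvalues of the problem in $(\Omega^h,\Sigma^h)$ form a sequence $\lambda^h_1\le\lambda^h_2\le\dots\to+\infty$ (repeated according to multiplicity), and $$\bigl|\lambda^h_p-h^{-2}\Lambda^{(p)}\bigr|\le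 c_p\exp(-\tau_p/h).$$ -/

import Mathlib

open MeasureTheory Set Filter Topology
open scoped RealInnerProductSpace NNReal

noncomputable section

namespace ThinCylinder

section Sobolev

variable {F : Type} [NormedAddCommGroup F] [InnerProductSpace ℝ F] [FiniteDimensional ℝ F]
  [MeasurableSpace F] [BorelSpace F]

/-- Pairs (function, vector field) in `L²(Ω) × L²(Ω; F)` with the Hilbert norm
`‖(u, g)‖² = ‖u‖² + ‖g‖²`; the norm of `(u, ∇u)` is the norm of `u` in `H¹(Ω)`. -/
abbrev L2Pair (Ω : Set F) : Type :=
  WithLp 2 (Lp ℝ 2 (volume.restrict Ω) × Lp F 2 (volume.restrict Ω))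

/-- The pairs `(φ, ∇φ)` restricted to `Ω`, where `φ` is a smooth compactly supported function on
the whole space that vanishes in a neighbourhood of the closure of `S`. -/
def testPairs (Ω S : Set F) : Submodule ℝ (L2Pair Ω) where
  carrier := {U | ∃ φ : F → ℝ, ContDiff ℝ (⊤ : ℕ∞) φ ∧ HasCompactSupport φ ∧
    Disjoint (tsupport φ) (closure S) ∧
    U.fst =ᵐ[volume.restrict Ω] φ ∧ U.snd =ᵐ[volume.restrict Ω] gradient φ}
  zero_mem' := by
    refine ⟨fun _ => 0, contDiff_const, HasCompactSupport.zero, ?_, ?_, ?_⟩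
    · have h : tsupport (fun _ : F => (0 : ℝ)) = ∅ := tsupport_eq_empty_iff.2 rfl
      rw [h]
      exact disjoint_bot_left
    · exact Lp.coeFn_zero _ _ _
    · rw [gradient_fun_const']
      exact Lp.coeFn_zero _ _ _
  add_mem' := by
    rintro U V ⟨φ, hφ, hφc, hφS, hU, hU'⟩ ⟨ψ, hψ, hψc, hψS, hV, hV'⟩
    refine ⟨φ + ψ, hφ.add hψ, hφc.add hψc, ?_, ?_, ?_⟩
    · exact (hφS.union_left hψS).mono_left (tsupport_add φ ψ)
    · exact (Lp.coeFn_add U.fst V.fst).trans (hU.add hV)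
    · refine (Lp.coeFn_add U.snd V.snd).trans ((hU'.add hV').trans (ae_of_all _ fun x => ?_))
      have h1 : DifferentiableAt ℝ φ x := hφ.differentiable (by simp) x
      have h2 : DifferentiableAt ℝ ψ x := hψ.differentiable (by simp) x
      simp [gradient, fderiv_add h1 h2]
  smul_mem' := by
    rintro c U ⟨φ, hφ, hφc, hφS, hU, hU'⟩
    refine ⟨c • φ, contDiff_const.smul hφ, hφc.smul_left (f := fun _ => c), ?_, ?_, ?_⟩
    · exact hφS.mono_left (closure_mono (Function.support_const_smul_subset c φ))
    · exact (Lp.coeFn_smul c U.fst).trans (hU.const_smul c)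
    · refine (Lp.coeFn_smul c U.snd).trans ((hU'.const_smul c).trans (ae_of_all _ fun x => ?_))
      have h1 : DifferentiableAt ℝ φ x := hφ.differentiable (by simp) x
      simp [gradient, fderiv_const_smul h1]

/-- The Sobolev space `H̊¹(Ω; S)` of functions in `H¹(Ω)` that vanish on the part `S` of the
boundary: the closure in the `H¹(Ω)` norm of the smooth functions that vanish near `S`.
Its elements are the pairs `(u, ∇u)`, with `∇u` the weak gradient. -/
def sobolev (Ω S : Set F) : Submodule ℝ (L2Pair Ω) :=
  (testPairs Ω S).topologicalClosure

/-- The solutions `U ∈ H̊¹(Ω; S)` of the variational problem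
`(∇U, ∇V) = t (U, V)` for all `V ∈ H̊¹(Ω; S)`, that is, of `-ΔU = t U` in `Ω` with the Dirichlet
condition on `S` and the Neumann condition on the rest of the boundary. -/
def eigenspace (Ω S : Set F) (t : ℝ) : Submodule ℝ (L2Pair Ω) where
  carrier := {U | U ∈ sobolev Ω S ∧
    ∀ V ∈ sobolev Ω S, ⟪U.snd, V.snd⟫ = t * ⟪U.fst, V.fst⟫}
  zero_mem' := ⟨zero_mem _, fun V _ => by simp⟩
  add_mem' := by
    rintro U W ⟨hU, hU'⟩ ⟨hW, hW'⟩
    refine ⟨add_mem hU hW, fun V hV => ?_⟩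
    simp only [WithLp.add_fst, WithLp.add_snd, inner_add_left, hU' V hV, hW' V hV, mul_add]
  smul_mem' := by
    rintro c U ⟨hU, hU'⟩
    refine ⟨Submodule.smul_mem _ c hU, fun V hV => ?_⟩
    simp only [WithLp.smul_fst, WithLp.smul_snd, real_inner_smul_left, hU' V hV]
    ring

/-- `t` is an eigenvalue of the variational problem in `H̊¹(Ω; S)`. -/
def IsEigenvalue (Ω S : Set F) (t : ℝ) : Prop := eigenspace Ω S t ≠ ⊥

/-- The family `L` lists, with multiplicities, precisely the eigenvalues that lie in `I`. -/
def ListsEigenvalues (Ω S : Set F) (I : Set ℝ) {ι : Type} (L : ι → ℝ) : Prop :=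
  (∀ i, L i ∈ I) ∧
    ∀ t ∈ I, Cardinal.mk {i // L i = t} = Module.rank ℝ (eigenspace Ω S t)

/-- `lam 0 ≤ lam 1 ≤ … → +∞` is the sequence of all eigenvalues, each repeated according to its
multiplicity. -/
def IsEigenvalueSequence (Ω S : Set F) (lam : ℕ → ℝ) : Prop :=
  Monotone lam ∧ Tendsto lam atTop atTop ∧ ListsEigenvalues Ω S univ lam

/-- A Lipschitz boundary: near each boundary point, in a suitable direction `e`, the set `G` is
the region above the graph of a Lipschitz function of the component orthogonal to `e`. -/
def HasLipschitzBoundary (G : Set F) : Prop :=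
  ∀ x₀ ∈ frontier G, ∃ e : F, ‖e‖ = 1 ∧ ∃ (K : ℝ≥0) (γ : F → ℝ), LipschitzWith K γ ∧
    ∃ r > 0, ∀ x ∈ Metric.ball x₀ r, x ∈ G ↔ γ (x - ⟪e, x⟫ • e) < ⟪e, x⟫

end Sobolev

section Geometry

variable {E : Type} [NormedAddCommGroup E] [InnerProductSpace ℝ E]

/-- The thin finite cylinder with distorted ends: the points `x = (y, z)` such that
`η = y / h ∈ ω` and `-1 - h H₋(η) < z < 1 + h H₊(η)`. -/
def thin (ω : Set E) (Hp Hm : E → ℝ) (h : ℝ) : Set (WithLp 2 (E × ℝ)) :=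
  {x | h⁻¹ • x.fst ∈ ω ∧ x.snd < 1 + h * Hp (h⁻¹ • x.fst) ∧ -x.snd < 1 + h * Hm (h⁻¹ • x.fst)}

/-- The two curved ends `z = 1 + h H₊(η)` and `-z = 1 + h H₋(η)` of the thin cylinder. -/
def thinEnds (ω : Set E) (Hp Hm : E → ℝ) (h : ℝ) : Set (WithLp 2 (E × ℝ)) :=
  {x | h⁻¹ • x.fst ∈ ω ∧ x.snd = 1 + h * Hp (h⁻¹ • x.fst)} ∪
    {x | h⁻¹ • x.fst ∈ ω ∧ -x.snd = 1 + h * Hm (h⁻¹ • x.fst)}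

/-- The lateral side of the thin cylinder. -/
def thinSide (ω : Set E) (Hp Hm : E → ℝ) (h : ℝ) : Set (WithLp 2 (E × ℝ)) :=
  frontier (thin ω Hp Hm h) \ closure (thinEnds ω Hp Hm h)

/-- The semi-infinite cylinder `η ∈ ω`, `ζ > -H(η)`. -/
def semi (ω : Set E) (H : E → ℝ) : Set (WithLp 2 (E × ℝ)) :=
  {ξ | ξ.fst ∈ ω ∧ -H ξ.fst < ξ.snd}

/-- The curved end of the semi-infinite cylinder. -/
def semiEnd (ω : Set E) (H : E → ℝ) : Set (WithLp 2 (E × ℝ)) :=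
  {ξ | ξ.fst ∈ ω ∧ ξ.snd = -H ξ.fst}

/-- The lateral side of the semi-infinite cylinder. -/
def semiSide (ω : Set E) (H : E → ℝ) : Set (WithLp 2 (E × ℝ)) :=
  frontier (semi ω H) \ closure (semiEnd ω H)

end Geometry

end ThinCylinder

end

/-!
Write `semi ω H` for a semi-infinite cylinder `Π` and `thin ω Hp Hm h` for the thin cylinder `Ωʰ`.
Below the first Dirichlet eigenvalue `μ₁` of the cross-section no energy can propagate along a
cylinder: a function that vanishes on the lateral side satisfies Poincaré's inequality
`μ₁ ‖u‖² ≤ ‖∇u‖²` on every cross-section. An eigenvector with eigenvalue at most `μ₁ - δ` therefore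
loses a fixed proportion of its mass on each unit of length (`mass_le_mass_of_cutoff`), so it decays
exponentially away from the curved end, in `Π` (`exists_decay_semi`) as well as in `Ωʰ`, whose
length in units of its width is of order `1 / h` (`exists_decay_thin`). The two ends of `Ωʰ`, enlarged
`1 / h` times, look like the ends of `Π₊` and `Π₋`, and eigenvectors can be cut off in the middle and
carried from one problem to the other at the price of an exponentially small error
(`exists_semi_to_thin`, `exists_thin_to_semi`).

By the localization formula `inner_localized`, the energy form of cut-off eigenvectors involves no
derivatives of the eigenvectors, so only their masses in the cut-off region enter the error. The
transported eigenvectors are orthonormal, with diagonal energy form, up to such errors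
(`exists_trial_functions`, `exists_halves`). The min-max principle for `Ωʰ` then bounds `h² λₚ` from
above by `Λ⁽ᵖ⁾` (`eigenvalue_le_of_trial`). Conversely, the first `p` eigenvectors of `Ωʰ`, cut into
two halves, are trial functions for the union of the two limit problems, which bounds `h² λₚ` from
below (`le_of_halves`); that these eigenvectors lie below the threshold, and so are small in the
middle, is known from the upper bound. The factor `h⁻²` is absorbed by halving the exponent.

The list of the `Λ` omits a possible eigenvalue `0` of the limit problems, so the lower bound needs
that there is none; this is Poincaré's inequality for a translation that moves `Π` off itself without
crossing the curved end (`exists_poincare_semi`).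

The spectral theory is built on the notion `CoerciveModFinite`: the form dominates `t ‖u‖²` up to
finitely many continuous functionals, that is, the essential spectrum lies in `[t, ∞)`. It yields the
variational principle below `t` (`CoerciveModFinite.le_of_orthogonal`) and, if it holds for all `t`,
the sequence of all eigenvalues (`exists_isEigenvalueSequence`). It is checked by cutting the domain
into a cylindrical part, where Poincaré's inequality holds, and bounded parts whose free boundary is
a Lipschitz graph. In the latter, a function is compared with its means over small balls that are
shifted into the domain along a cone of admissible directions (`exists_functionals`).
-/

set_option linter.unusedSectionVars false

namespace ThinCylinder

open scoped ENNReal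

/-! ### Maximizing a quadratic form relative to a finite-rank perturbation -/

section Abstract

variable {H A : Type*} [NormedAddCommGroup H] [InnerProductSpace ℝ H]
  [NormedAddCommGroup A] [InnerProductSpace ℝ A]

/-- If the quadratic form `‖i u‖²` is at most `β₁ ‖u‖²` up to finitely many functionals, and exceeds
`β₀ ‖u‖²` somewhere with `β₁ < β₀`, then the supremum of `‖i u‖² / ‖u‖²` is attained, and a
maximizer is an eigenvector. -/
lemma exists_eigenvector_of_lt [CompleteSpace H] (i : H →L[ℝ] A) {ι : Type*} [Fintype ι]
    (ℓ : ι → H →L[ℝ] ℝ) {β₀ β₁ : ℝ} (hβ : β₁ < β₀)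
    (hco : ∀ u, ‖i u‖ ^ 2 ≤ β₁ * ‖u‖ ^ 2 + ∑ j, ℓ j u ^ 2)
    {u₀ : H} (hu₀ : β₀ * ‖u₀‖ ^ 2 < ‖i u₀‖ ^ 2) :
    ∃ β, β₀ < β ∧ ∃ u : H, u ≠ 0 ∧ ∀ v, ⟪i u, i v⟫ = β * ⟪u, v⟫ := by
  have hu₀0 : u₀ ≠ 0 := by
    rintro rfl
    simp at hu₀
  set S : Set ℝ := (fun u : H => ‖i u‖ ^ 2) '' Metric.sphere 0 1 with hS
  have hscale : ∀ u : H, u ≠ 0 → ‖i u‖ ^ 2 / ‖u‖ ^ 2 ∈ S := by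
    intro u hu
    have hu' : ‖u‖ ≠ 0 := norm_ne_zero_iff.2 hu
    refine ⟨‖u‖⁻¹ • u, ?_, ?_⟩
    · simp [norm_smul, hu']
    · simp only [map_smul, norm_smul, norm_inv, norm_norm]
      field_simp
  have hbdd : BddAbove S := by
    refine ⟨‖i‖ ^ 2, ?_⟩
    rintro _ ⟨u, hu, rfl⟩
    have h1 := i.le_opNorm u
    rw [mem_sphere_zero_iff_norm.1 hu, mul_one] at h1
    exact pow_le_pow_left₀ (norm_nonneg _) h1 2
  have hne : S.Nonempty := ⟨_, hscale u₀ hu₀0⟩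
  set κ := sSup S with hκ
  have hκβ : β₀ < κ := by
    refine lt_of_lt_of_le ?_ (le_csSup hbdd (hscale u₀ hu₀0))
    have : 0 < ‖u₀‖ ^ 2 := by positivity
    rwa [lt_div_iff₀ this]
  have hq : ∀ u : H, ‖i u‖ ^ 2 ≤ κ * ‖u‖ ^ 2 := by
    intro u
    rcases eq_or_ne u 0 with rfl | hu
    · simp
    · have h1 := le_csSup hbdd (hscale u hu)
      have : 0 < ‖u‖ ^ 2 := by positivity
      rwa [div_le_iff₀ this] at h1
  -- a maximizing sequence
  obtain ⟨s, -, hs, hsS⟩ := exists_seq_tendsto_sSup hne hbdd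
  choose w hw1 hw2 using hsS
  have hw1' : ∀ n, ‖w n‖ = 1 := fun n => mem_sphere_zero_iff_norm.1 (hw1 n)
  -- along a subsequence the functionals converge
  have hb : ∃ᶠ n in atTop, (fun j => ℓ j (w n)) ∈ Set.pi univ fun j => Icc (-‖ℓ j‖) ‖ℓ j‖ := by
    refine Eventually.frequently (Eventually.of_forall fun n => ?_)
    intro j _
    have h1 := (ℓ j).le_opNorm (w n)
    rw [hw1', mul_one, Real.norm_eq_abs] at h1
    exact abs_le.1 h1
  obtain ⟨a, -, φ, hφ, ha⟩ := (isCompact_univ_pi fun j =>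
    isCompact_Icc (a := -‖ℓ j‖) (b := ‖ℓ j‖)).tendsto_subseq' hb
  have hsφ : Tendsto (fun n => ‖i (w (φ n))‖ ^ 2) atTop (𝓝 κ) := by
    have := hs.comp hφ.tendsto_atTop
    refine this.congr fun n => ?_
    exact (hw2 (φ n)).symm
  -- `κ ‖·‖² - ‖i ·‖²` is nonnegative, and it tends to zero along the sequence; by the parallelogram
  -- law it is small on differences, where coercivity makes it dominate `(κ - β₁) ‖·‖²`
  have hcau : CauchySeq fun n => w (φ n) := by
    rw [Metric.cauchySeq_iff]
    intro ε hε
    have hη : 0 < (κ - β₁) * ε ^ 2 := by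
      have : 0 < κ - β₁ := by linarith
      positivity
    have hsum : CauchySeq fun n => fun j => ℓ j (w (φ n)) := ha.cauchySeq
    have h1 : ∀ᶠ n in atTop, κ - ‖i (w (φ n))‖ ^ 2 < (κ - β₁) * ε ^ 2 / 8 := by
      have := (tendsto_const_nhds (x := κ)).sub hsφ
      rw [sub_self] at this
      exact this.eventually_lt_const (by positivity)
    have h2 : ∀ᶠ p : ℕ × ℕ in atTop ×ˢ atTop,
        ∑ j, (ℓ j (w (φ p.1)) - ℓ j (w (φ p.2))) ^ 2 < (κ - β₁) * ε ^ 2 / 2 := by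
      have h3 : Tendsto (fun p : ℕ × ℕ => ∑ j, (ℓ j (w (φ p.1)) - ℓ j (w (φ p.2))) ^ 2)
          (atTop ×ˢ atTop) (𝓝 (∑ j, (a j - a j) ^ 2)) := by
        refine tendsto_finsetSum _ fun j _ => ?_
        have haj := (tendsto_pi_nhds.1 ha) j
        exact ((haj.comp tendsto_fst).sub (haj.comp tendsto_snd)).pow 2
      simp only [sub_self, ne_eq, OfNat.ofNat_ne_zero, not_false_eq_true, zero_pow,
        Finset.sum_const_zero] at h3
      exact h3.eventually_lt_const (by positivity)
    rw [prod_atTop_atTop_eq] at h2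
    obtain ⟨N₁, hN₁⟩ := eventually_atTop.1 h1
    obtain ⟨N₂, hN₂⟩ := eventually_atTop.1 h2
    refine ⟨max N₁ (max N₂.1 N₂.2), fun m hm n hn => ?_⟩
    have hm1 := hN₁ m ((le_max_left _ _).trans hm)
    have hn1 := hN₁ n ((le_max_left _ _).trans hn)
    have hmn := hN₂ (m, n) ⟨(le_max_left _ _).trans ((le_max_right _ _).trans hm),
      (le_max_right _ _).trans ((le_max_right _ _).trans hn)⟩
    set x := w (φ m)
    set y := w (φ n)
    have hx : ‖x‖ = 1 := hw1' _
    have hy : ‖y‖ = 1 := hw1' _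
    have hd := hco (x - y)
    simp only [map_sub] at hd hmn
    have hs' := hq (x + y)
    rw [map_add] at hs'
    have p1 := parallelogram_law_with_norm ℝ x y
    have p2 := parallelogram_law_with_norm ℝ (i x) (i y)
    rw [hx, hy] at p1
    rw [dist_eq_norm]
    have key : (κ - β₁) * ‖x - y‖ ^ 2 < (κ - β₁) * ε ^ 2 := by nlinarith
    have : ‖x - y‖ ^ 2 < ε ^ 2 := lt_of_mul_lt_mul_left key (by linarith)
    exact lt_of_pow_lt_pow_left₀ 2 hε.le this
  obtain ⟨u, hu⟩ := cauchySeq_tendsto_of_complete hcau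
  have hu1 : ‖u‖ = 1 := by
    have h1 := hu.norm
    simp only [hw1'] at h1
    exact tendsto_nhds_unique h1 tendsto_const_nhds
  have huκ : ‖i u‖ ^ 2 = κ := by
    have h1 : Tendsto (fun n => ‖i (w (φ n))‖ ^ 2) atTop (𝓝 (‖i u‖ ^ 2)) :=
      (((i.continuous.tendsto u).comp hu).norm).pow 2
    exact tendsto_nhds_unique h1 hsφ
  refine ⟨κ, hκβ, u, by rintro rfl; simp at hu1, fun v => ?_⟩
  -- first variation at the maximizer
  have hvar : ∀ s : ℝ, 0 ≤ (κ * ‖v‖ ^ 2 - ‖i v‖ ^ 2) * (s * s)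
      + (2 * (κ * ⟪u, v⟫ - ⟪i u, i v⟫)) * s + 0 := by
    intro s
    have h1 := hq (u + s • v)
    rw [map_add, map_smul, norm_add_sq_real, norm_add_sq_real, inner_smul_right, inner_smul_right,
      norm_smul, norm_smul, huκ, hu1, mul_pow, mul_pow, Real.norm_eq_abs, sq_abs] at h1
    nlinarith
  have hd := discrim_le_zero hvar
  rw [discrim] at hd
  nlinarith [sq_nonneg (κ * ⟪u, v⟫ - ⟪i u, i v⟫),
    pow_eq_zero_iff (two_ne_zero) |>.1
      (le_antisymm (a := (κ * ⟪u, v⟫ - ⟪i u, i v⟫) ^ 2) (by nlinarith) (sq_nonneg _))]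

/-- The variational principle: orthogonally to all eigenvectors with eigenvalue above `β₀`, the form
`‖i u‖²` is at most `β₀ ‖u‖²`. -/
lemma norm_sq_le_of_orthogonal [CompleteSpace H] (i : H →L[ℝ] A) {ι : Type*} [Fintype ι]
    (ℓ : ι → H →L[ℝ] ℝ) {β₀ β₁ : ℝ} (hβ : β₁ < β₀)
    (hco : ∀ u, ‖i u‖ ^ 2 ≤ β₁ * ‖u‖ ^ 2 + ∑ j, ℓ j u ^ 2) {u : H}
    (hu : ∀ β, β₀ < β → ∀ v : H, (∀ w, ⟪i v, i w⟫ = β * ⟪v, w⟫) → ⟪v, u⟫ = 0) :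
    ‖i u‖ ^ 2 ≤ β₀ * ‖u‖ ^ 2 := by
  by_contra! hlt
  set E : Submodule ℝ H :=
    Submodule.span ℝ {v | ∃ β, β₀ < β ∧ ∀ w, ⟪i v, i w⟫ = β * ⟪v, w⟫} with hE
  have huE : u ∈ Eᗮ := by
    rw [Submodule.mem_orthogonal]
    intro v hv
    induction hv using Submodule.span_induction with
    | mem v hv => obtain ⟨β, hβ, hv⟩ := hv; exact hu β hβ v hv
    | zero => simp
    | add x y _ _ hx hy => rw [inner_add_left, hx, hy, add_zero]
    | smul c x _ hx => rw [inner_smul_left, hx, mul_zero]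
  -- the form restricted to the orthogonal complement of the eigenvectors still has one there
  obtain ⟨β, hβ₀, v, hv0, hv⟩ := exists_eigenvector_of_lt (H := Eᗮ) (i.comp Eᗮ.subtypeL)
    (fun j => (ℓ j).comp Eᗮ.subtypeL) hβ (fun w => hco w) (u₀ := ⟨u, huE⟩) hlt
  -- it is an eigenvector of the whole form, because the complement is invariant
  have hall : ∀ w : H, ⟪i v, i w⟫ = β * ⟪(v : H), w⟫ := by
    intro w
    obtain ⟨a, ha, b, hb, rfl⟩ := Submodule.mem_sup.1
      ((Submodule.sup_orthogonal_of_hasOrthogonalProjection (K := Eᗮ)).symm ▸ Submodule.mem_top :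
        w ∈ Eᗮ ⊔ Eᗮᗮ)
    rw [map_add, inner_add_right, inner_add_right, mul_add]
    congr 1
    · exact hv ⟨a, ha⟩
    · rw [(Submodule.mem_orthogonal _ _).1 hb v v.2, mul_zero]
      rw [Submodule.orthogonal_orthogonal_eq_closure] at hb
      have hcl : IsClosed {b : H | ⟪i v, i b⟫ = 0} :=
        isClosed_eq (by fun_prop) continuous_const
      refine closure_minimal (fun x hx => ?_) hcl hb
      change ⟪i v, i x⟫ = 0
      induction hx using Submodule.span_induction with
      | mem x hx =>
        obtain ⟨γ, hγ, hx'⟩ := hx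
        rw [real_inner_comm, hx' v,
          (Submodule.mem_orthogonal _ _).1 v.2 x (Submodule.subset_span ⟨γ, hγ, hx'⟩), mul_zero]
      | zero => simp
      | add x y _ _ hx hy => rw [map_add, inner_add_right, hx, hy, add_zero]
      | smul c x _ hx => rw [map_smul, inner_smul_right, hx, mul_zero]
  have hvE : (v : H) ∈ E := Submodule.subset_span ⟨β, hβ₀, hall⟩
  have := (Submodule.mem_orthogonal _ _).1 v.2 v hvE
  exact hv0 (by simpa using this)

end Abstract

/-! ### Spectral theory for forms that are coercive modulo finitely many functionals -/

section Spectral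

/-- A system of fewer homogeneous linear equations than unknowns has a nonzero solution. -/
lemma exists_ne_zero_sum_mul_eq_zero {κ κ' : Type*} [Fintype κ] [Fintype κ']
    (hcard : Fintype.card κ' < Fintype.card κ) (G : κ → κ' → ℝ) :
    ∃ c : κ → ℝ, c ≠ 0 ∧ ∀ j, ∑ i, c i * G i j = 0 := by
  let f : (κ → ℝ) →ₗ[ℝ] (κ' → ℝ) := (Matrix.of G).vecMulLinear
  have hker : LinearMap.ker f ≠ ⊥ :=
    LinearMap.ker_ne_bot_of_finrank_lt (by simpa using hcard)
  obtain ⟨c, hc, hc0⟩ := (Submodule.ne_bot_iff _).1 hker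
  refine ⟨c, hc0, fun j => ?_⟩
  have := congrFun (LinearMap.mem_ker.1 hc) j
  simpa [f, Matrix.vecMul, dotProduct] using this

variable {F : Type} [NormedAddCommGroup F] [InnerProductSpace ℝ F] [FiniteDimensional ℝ F]
  [MeasurableSpace F] [BorelSpace F] {Ω S : Set F}

/-- Up to finitely many continuous functionals, `‖∇U‖² ≥ t ‖U‖²` on `H̊¹(Ω; S)`; equivalently, the
essential spectrum of the problem in `(Ω, S)` lies in `[t, ∞)`. -/
def CoerciveModFinite (Ω S : Set F) (t : ℝ) : Prop :=
  ∃ (k : ℕ) (ℓ : Fin k → L2Pair Ω →L[ℝ] ℝ), ∀ U ∈ sobolev Ω S,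
    t * ‖U.fst‖ ^ 2 ≤ ‖U.snd‖ ^ 2 + ∑ j, ℓ j U ^ 2

instance : CompleteSpace (sobolev Ω S) :=
  (Submodule.isClosed_topologicalClosure _).completeSpace_coe

lemma norm_sq_pair (U : L2Pair Ω) : ‖U‖ ^ 2 = ‖U.fst‖ ^ 2 + ‖U.snd‖ ^ 2 :=
  WithLp.prod_norm_sq_eq_of_L2 U

lemma inner_pair (U V : L2Pair Ω) : ⟪U, V⟫ = ⟪U.fst, V.fst⟫ + ⟪U.snd, V.snd⟫ :=
  WithLp.prod_inner_apply U V

lemma inner_of_mem_eigenspace {t : ℝ} {U V : L2Pair Ω} (hU : U ∈ eigenspace Ω S t)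
    (hV : V ∈ sobolev Ω S) : ⟪U, V⟫ = (1 + t) * ⟪U.fst, V.fst⟫ := by
  rw [inner_pair, hU.2 V hV]
  ring

lemma norm_sq_snd_of_mem_eigenspace {t : ℝ} {U : L2Pair Ω} (hU : U ∈ eigenspace Ω S t) :
    ‖U.snd‖ ^ 2 = t * ‖U.fst‖ ^ 2 := by
  rw [← real_inner_self_eq_norm_sq, ← real_inner_self_eq_norm_sq, hU.2 U hU.1]

lemma norm_fst_pos_of_mem_eigenspace {t : ℝ} {U : L2Pair Ω} (hU : U ∈ eigenspace Ω S t)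
    (hU0 : U ≠ 0) : 0 < ‖U.fst‖ := by
  refine lt_of_le_of_ne (norm_nonneg _) fun h => hU0 ?_
  have h1 := norm_sq_snd_of_mem_eigenspace hU
  have h2 := norm_sq_pair U
  rw [h1, ← h] at h2
  simpa using h2

lemma nonneg_of_mem_eigenspace {t : ℝ} {U : L2Pair Ω} (hU : U ∈ eigenspace Ω S t)
    (hU0 : U ≠ 0) : 0 ≤ t := by
  have h1 := norm_sq_snd_of_mem_eigenspace hU
  have h2 := norm_fst_pos_of_mem_eigenspace hU hU0
  by_contra! h
  have : 0 ≤ ‖U.snd‖ ^ 2 := by positivity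
  nlinarith [mul_neg_of_neg_of_pos h (pow_pos h2 2)]

lemma inner_fst_eq_zero_of_ne {s t : ℝ} (hst : s ≠ t) {U V : L2Pair Ω}
    (hU : U ∈ eigenspace Ω S s) (hV : V ∈ eigenspace Ω S t) : ⟪U.fst, V.fst⟫ = 0 := by
  have h1 := hU.2 V hV.1
  have h2 := hV.2 U hU.1
  rw [real_inner_comm, real_inner_comm U.fst] at h2
  have : (s - t) * ⟪U.fst, V.fst⟫ = 0 := by linarith
  exact (mul_eq_zero.1 this).resolve_left (sub_ne_zero.2 hst)

/-- The projection of `H̊¹(Ω; S)` to `L²(Ω)`. -/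
noncomputable def sobolevFst (Ω S : Set F) :
    sobolev Ω S →L[ℝ] Lp ℝ 2 (volume.restrict Ω) :=
  (WithLp.fstL 2 ℝ _ _).comp (sobolev Ω S).subtypeL

lemma sobolevFst_apply (U : sobolev Ω S) : sobolevFst Ω S U = (U : L2Pair Ω).fst := rfl

/-- The variational principle below the essential spectrum: an element of `H̊¹(Ω; S)` that is
`L²`-orthogonal to the eigenvectors with eigenvalues below `t₀` has Rayleigh quotient at least
`t₀`. -/
lemma CoerciveModFinite.le_of_orthogonal {t₀ t₁ : ℝ} (hco : CoerciveModFinite Ω S t₁)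
    (h0 : 0 ≤ t₀) (h01 : t₀ < t₁) {U : L2Pair Ω} (hU : U ∈ sobolev Ω S)
    (horth : ∀ t < t₀, ∀ V ∈ eigenspace Ω S t, ⟪V.fst, U.fst⟫ = 0) :
    t₀ * ‖U.fst‖ ^ 2 ≤ ‖U.snd‖ ^ 2 := by
  obtain ⟨k, ℓ, hℓ⟩ := hco
  -- for the norm of `H¹` the eigenvalue `t` turns into the eigenvalue `(1 + t)⁻¹` of the projection
  -- to `L²`, and the order is reversed
  have ht1 : 0 < 1 + t₁ := by linarith
  have ht0 : 0 < 1 + t₀ := by linarith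
  have hβ : (1 + t₁)⁻¹ < (1 + t₀)⁻¹ := inv_strictAnti₀ ht0 (by linarith)
  have key := norm_sq_le_of_orthogonal (sobolevFst Ω S)
    (fun j => (√(1 + t₁))⁻¹ • (ℓ j).comp (sobolev Ω S).subtypeL) hβ (fun V => ?_)
    (u := ⟨U, hU⟩) (fun β hβ₀ V hV => ?_)
  · rw [sobolevFst_apply, Submodule.coe_norm, norm_sq_pair, ← div_eq_inv_mul,
      le_div_iff₀ ht0] at key
    simp only at key
    linarith
  · have h1 := hℓ V V.2
    have h2 : ∑ j, ((√(1 + t₁))⁻¹ • (ℓ j).comp (sobolev Ω S).subtypeL) V ^ 2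
        = (1 + t₁)⁻¹ * ∑ j, ℓ j V ^ 2 := by
      rw [Finset.mul_sum]
      refine Finset.sum_congr rfl fun j _ => ?_
      simp [mul_pow, inv_pow, Real.sq_sqrt ht1.le]
    rw [h2, sobolevFst_apply, Submodule.coe_norm, norm_sq_pair, ← mul_add, ← div_eq_inv_mul,
      le_div_iff₀ ht1]
    linarith
  · have hβpos : 0 < β := (inv_pos.2 ht0).trans hβ₀
    have ht : β⁻¹ - 1 < t₀ := by
      have := inv_strictAnti₀ (inv_pos.2 ht0) hβ₀
      rw [inv_inv] at this
      linarith
    have hV' : (V : L2Pair Ω) ∈ eigenspace Ω S (β⁻¹ - 1) := by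
      refine ⟨V.2, fun W hW => ?_⟩
      have := hV ⟨W, hW⟩
      rw [Submodule.coe_inner, inner_pair] at this
      change ⟪(V : L2Pair Ω).fst, W.fst⟫ = _ at this
      field_simp
      linarith
    rw [Submodule.coe_inner, inner_of_mem_eigenspace hV' hU, horth _ ht _ hV', mul_zero]

lemma CoerciveModFinite.finiteDimensional {t t₁ : ℝ} (hco : CoerciveModFinite Ω S t₁)
    (h : t < t₁) : FiniteDimensional ℝ (eigenspace Ω S t) := by
  obtain ⟨k, ℓ, hℓ⟩ := hco
  let f : eigenspace Ω S t →ₗ[ℝ] (Fin k → ℝ) :=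
    LinearMap.pi fun j => (ℓ j).toLinearMap.comp (eigenspace Ω S t).subtype
  refine FiniteDimensional.of_injective f ((injective_iff_map_eq_zero f).2 fun U hU => ?_)
  have h1 := hℓ U U.2.1
  have h2 : ∀ j, ℓ j U = 0 := fun j => congrFun hU j
  simp only [h2, ne_eq, OfNat.ofNat_ne_zero, not_false_eq_true, zero_pow, Finset.sum_const_zero,
    add_zero, norm_sq_snd_of_mem_eigenspace U.2] at h1
  by_contra hne
  have h3 := norm_fst_pos_of_mem_eigenspace U.2 (fun h => hne (Subtype.ext h))
  nlinarith [pow_pos h3 2]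

/-- An `L²`-orthonormal family of eigenvectors for the eigenvalues `L i`. -/
structure IsEigenbasis (Ω S : Set F) {ι : Type*} [DecidableEq ι] (L : ι → ℝ) (u : ι → L2Pair Ω) :
    Prop where
  mem : ∀ i, u i ∈ eigenspace Ω S (L i)
  orth : ∀ i j, ⟪(u i).fst, (u j).fst⟫ = if i = j then 1 else 0

/-- An eigenbasis for a family of eigenvalues, where `f` distributes the indices with a common
eigenvalue injectively over an orthonormal basis of the eigenspace. That basis is orthonormal in
`H¹`; its elements have to be rescaled for `L²`. -/
lemma exists_isEigenbasis {ι : Type*} [DecidableEq ι] (L : ι → ℝ)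
    (hfd : ∀ i, FiniteDimensional ℝ (eigenspace Ω S (L i)))
    (f : ∀ i, Fin (Module.finrank ℝ (eigenspace Ω S (L i))))
    (hf : ∀ i j, L i = L j → (f i : ℕ) = f j → i = j) :
    ∃ u : ι → L2Pair Ω, IsEigenbasis Ω S L u ∧
      ∀ i, ∃ c : ℝ, u i = c • ((stdOrthonormalBasis ℝ (eigenspace Ω S (L i)) (f i) :
        eigenspace Ω S (L i)) : L2Pair Ω) ∧ c ≠ 0 := by
  let v : ι → L2Pair Ω := fun i => (stdOrthonormalBasis ℝ (eigenspace Ω S (L i)) (f i) :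
        eigenspace Ω S (L i))
  have hv : ∀ i, v i ∈ eigenspace Ω S (L i) := fun i => Subtype.mem _
  have hv1 : ∀ i, ‖v i‖ = 1 := fun i =>
    (stdOrthonormalBasis ℝ (eigenspace Ω S (L i))).orthonormal.1 (f i)
  have hv0 : ∀ i, v i ≠ 0 := fun i h => by simpa [h] using hv1 i
  have hpos : ∀ i, 0 < ‖(v i).fst‖ := fun i => norm_fst_pos_of_mem_eigenspace (hv i) (hv0 i)
  refine ⟨fun i => ‖(v i).fst‖⁻¹ • v i, ⟨fun i => Submodule.smul_mem _ _ (hv i), fun i j => ?_⟩,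
    fun i => ⟨_, rfl, (inv_pos.2 (hpos i)).ne'⟩⟩
  simp only [WithLp.smul_fst, real_inner_smul_left, real_inner_smul_right]
  split_ifs with hij
  · subst hij
    rw [real_inner_self_eq_norm_sq]
    have := (hpos i).ne'
    field_simp
  · suffices h : ⟪(v i).fst, (v j).fst⟫ = 0 by rw [h]; simp
    by_cases hL : L i = L j
    · have h1 := inner_of_mem_eigenspace (hv i) (hv j).1
      have h2 : ⟪v i, v j⟫ = 0 := by
        have hor : ∀ (s : ℝ) (_ : s = L j) (a : Fin (Module.finrank ℝ (eigenspace Ω S s)))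
            [FiniteDimensional ℝ (eigenspace Ω S s)], (a : ℕ) ≠ f j →
            ⟪((stdOrthonormalBasis ℝ (eigenspace Ω S s) a : eigenspace Ω S s) : L2Pair Ω),
              v j⟫ = 0 := by
          rintro s rfl a _ ha
          exact (stdOrthonormalBasis ℝ (eigenspace Ω S (L j))).orthonormal.2
            (fun h => ha (congrArg _ h))
        exact hor (L i) hL (f i) fun h => hij (hf i j hL h)
      have h3 : (0 : ℝ) < 1 + L i := by linarith [nonneg_of_mem_eigenspace (hv i) (hv0 i)]
      rw [h2] at h1
      exact (mul_eq_zero.1 h1.symm).resolve_left h3.ne'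
    · exact inner_fst_eq_zero_of_ne hL (hv i) (hv j)

lemma mem_of_forall_stdOrthonormalBasis_mem {t : ℝ} [FiniteDimensional ℝ (eigenspace Ω S t)]
    {P : Submodule ℝ (L2Pair Ω)}
    (h : ∀ k, ((stdOrthonormalBasis ℝ (eigenspace Ω S t) k : eigenspace Ω S t) : L2Pair Ω) ∈ P) :
    ∀ V ∈ eigenspace Ω S t, V ∈ P := by
  intro V hV
  have h1 : (⟨V, hV⟩ : eigenspace Ω S t) ∈ P.comap (eigenspace Ω S t).subtype := by
    rw [← (stdOrthonormalBasis ℝ (eigenspace Ω S t)).sum_repr ⟨V, hV⟩]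
    exact Submodule.sum_mem _ fun k _ => Submodule.smul_mem _ _ (h k)
  exact h1

lemma inner_fst_eq_zero_of_mem_span {s : Set (L2Pair Ω)} {W : L2Pair Ω}
    (h : ∀ V ∈ s, ⟪V.fst, W.fst⟫ = 0) {V : L2Pair Ω} (hV : V ∈ Submodule.span ℝ s) :
    ⟪V.fst, W.fst⟫ = 0 := by
  induction hV using Submodule.span_induction with
  | mem x hx => exact h x hx
  | zero => simp
  | add x y _ _ hx hy => rw [WithLp.add_fst, inner_add_left, hx, hy, add_zero]
  | smul c x _ hx => rw [WithLp.smul_fst, real_inner_smul_left, hx, mul_zero]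

/-- A monotone enumeration of a countably infinite linear order all of whose initial segments are
finite. -/
lemma exists_orderIso_nat {ι : Type*} [LinearOrder ι] [Infinite ι]
    (h : ∀ i : ι, (Iic i).Finite) : Nonempty (ℕ ≃o ι) := by
  let : LocallyFiniteOrder ι :=
    LocallyFiniteOrder.ofFiniteIcc fun a b => (h b).subset Icc_subset_Iic_self
  let := LinearLocallyFiniteOrder.succOrder ι
  let := LinearLocallyFiniteOrder.predOrder ι
  have hbot : ∃ b : ι, ∀ i, b ≤ i := by
    obtain ⟨a⟩ := (inferInstance : Nonempty ι)
    obtain ⟨b, hb, hb'⟩ := Set.exists_min_image (Iic a) id (h a) ⟨a, le_refl a⟩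
    exact ⟨b, fun i => (le_total i a).elim (hb' i) (hb.trans ·)⟩
  let : OrderBot ι := { bot := hbot.choose, bot_le := hbot.choose_spec }
  have : NoMaxOrder ι := ⟨fun a => by
    by_contra! hmax
    exact Set.infinite_univ ((h a).subset fun i _ => hmax i)⟩
  exact ⟨orderIsoNatOfLinearSuccPredArch.symm⟩

/-- Eigenvectors can be chosen along a complete list of the eigenvalues, so that they span all the
eigenspaces in question. -/
lemma ListsEigenvalues.exists_isEigenbasis {I : Set ℝ} {ι : Type} [DecidableEq ι] {L : ι → ℝ}
    (hL : ListsEigenvalues Ω S I L) (hfin : ∀ t, Finite {i // L i = t}) :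
    ∃ u : ι → L2Pair Ω, IsEigenbasis Ω S L u ∧
      ∀ t ∈ I, ∀ V ∈ eigenspace Ω S t, V ∈ Submodule.span ℝ (u '' {i | L i = t}) := by
  have hfd : ∀ t ∈ I, FiniteDimensional ℝ (eigenspace Ω S t) := fun t ht => by
    have h1 := hL.2 t ht
    have h2 : Cardinal.mk {i // L i = t} < Cardinal.aleph0 := Cardinal.lt_aleph0_iff_finite.2 (hfin t)
    rw [h1] at h2
    exact Module.rank_lt_aleph0_iff.1 h2
  have hequiv : ∀ t ∈ I, Nonempty ({i // L i = t} ≃ Fin (Module.finrank ℝ (eigenspace Ω S t))) :=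
    fun t ht => by
      have := hfd t ht
      refine Cardinal.eq.1 ?_
      rw [hL.2 t ht, Cardinal.mk_fin, Module.finrank_eq_rank]
  let g : ∀ t ∈ I, {i // L i = t} ≃ Fin (Module.finrank ℝ (eigenspace Ω S t)) :=
    fun t ht => (hequiv t ht).some
  have hginj : ∀ s (hs : s ∈ I) t (ht : t ∈ I), s = t → ∀ i (hi : L i = s) j (hj : L j = t),
      (g s hs ⟨i, hi⟩ : ℕ) = g t ht ⟨j, hj⟩ → i = j := by
    rintro s hs _ ht rfl i hi j hj h
    exact congrArg Subtype.val ((g s hs).injective (Fin.ext h))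
  have hfdL : ∀ i, FiniteDimensional ℝ (eigenspace Ω S (L i)) := fun i => hfd _ (hL.1 i)
  obtain ⟨u, hu, hub⟩ := ThinCylinder.exists_isEigenbasis L hfdL
    (fun i => g (L i) (hL.1 i) ⟨i, rfl⟩)
    (fun i j hij h => hginj _ (hL.1 i) _ (hL.1 j) hij i rfl j rfl h)
  refine ⟨u, hu, fun t ht V hV => ?_⟩
  have := hfd t ht
  have hmem : ∀ k, ((stdOrthonormalBasis ℝ (eigenspace Ω S t) k : eigenspace Ω S t) : L2Pair Ω) ∈
      Submodule.span ℝ (u '' {i | L i = t}) := by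
    intro k
    obtain ⟨⟨i, rfl⟩, rfl⟩ := (g t ht).surjective k
    obtain ⟨c, hc, hc0⟩ := hub i
    have h1 : u i ∈ Submodule.span ℝ (u '' {j | L j = L i}) :=
      Submodule.subset_span ⟨i, rfl, rfl⟩
    rw [hc] at h1
    exact (Submodule.smul_mem_iff _ hc0).1 h1
  exact mem_of_forall_stdOrthonormalBasis_mem hmem V hV

lemma IsEigenbasis.inner_snd {ι : Type*} [DecidableEq ι] {L : ι → ℝ} {u : ι → L2Pair Ω}
    (hu : IsEigenbasis Ω S L u) (i j : ι) :
    ⟪(u i).snd, (u j).snd⟫ = if i = j then L i else 0 := by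
  rw [(hu.mem i).2 _ (hu.mem j).1, hu.orth]
  simp

lemma fst_sum_smul {ι : Type*} (s : Finset ι) (c : ι → ℝ) (u : ι → L2Pair Ω) :
    (∑ i ∈ s, c i • u i).fst = ∑ i ∈ s, c i • (u i).fst :=
  (map_sum (WithLp.fstL 2 ℝ (Lp ℝ 2 (volume.restrict Ω)) (Lp F 2 (volume.restrict Ω)))
    (fun i => c i • u i) s)

lemma norm_sq_fst_sum {ι : Type*} [Fintype ι] (c : ι → ℝ) (u : ι → L2Pair Ω) :
    ‖(∑ i, c i • u i).fst‖ ^ 2 = ∑ i, ∑ j, c i * c j * ⟪(u i).fst, (u j).fst⟫ := by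
  rw [fst_sum_smul, ← real_inner_self_eq_norm_sq, sum_inner]
  refine Finset.sum_congr rfl fun i _ => ?_
  rw [inner_sum]
  refine Finset.sum_congr rfl fun j _ => ?_
  rw [real_inner_smul_left, real_inner_smul_right, mul_assoc]

lemma snd_sum_smul {ι : Type*} (s : Finset ι) (c : ι → ℝ) (u : ι → L2Pair Ω) :
    (∑ i ∈ s, c i • u i).snd = ∑ i ∈ s, c i • (u i).snd :=
  (map_sum (WithLp.sndL 2 ℝ (Lp ℝ 2 (volume.restrict Ω)) (Lp F 2 (volume.restrict Ω)))
    (fun i => c i • u i) s)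

lemma norm_sq_snd_sum {ι : Type*} [Fintype ι] (c : ι → ℝ) (u : ι → L2Pair Ω) :
    ‖(∑ i, c i • u i).snd‖ ^ 2 = ∑ i, ∑ j, c i * c j * ⟪(u i).snd, (u j).snd⟫ := by
  rw [snd_sum_smul, ← real_inner_self_eq_norm_sq, sum_inner]
  refine Finset.sum_congr rfl fun i _ => ?_
  rw [inner_sum]
  refine Finset.sum_congr rfl fun j _ => ?_
  rw [real_inner_smul_left, real_inner_smul_right, mul_assoc]

/-- The number of eigenvalues below the essential spectrum is bounded: a combination of too many
eigenvectors would be annihilated by all the functionals. -/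
lemma CoerciveModFinite.exists_card_le {t₁ : ℝ} (hco : CoerciveModFinite Ω S t₁) :
    ∃ k : ℕ, ∀ {ι : Type} [Fintype ι] [DecidableEq ι] (L : ι → ℝ) (u : ι → L2Pair Ω),
      IsEigenbasis Ω S L u → (∀ i, L i < t₁) → Fintype.card ι ≤ k := by
  obtain ⟨k, ℓ, hℓ⟩ := hco
  refine ⟨k, fun {ι} _ _ L u hu hL => ?_⟩
  by_contra! hlt
  obtain ⟨c, hc0, hc⟩ := exists_ne_zero_sum_mul_eq_zero (κ := ι) (κ' := Fin k)
    (by simpa using hlt) (fun i j => ℓ j (u i))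
  have hmem : ∑ i, c i • u i ∈ sobolev Ω S :=
    Submodule.sum_mem _ fun i _ => Submodule.smul_mem _ _ (hu.mem i).1
  have h1 := hℓ _ hmem
  have h2 : ∀ j, ℓ j (∑ i, c i • u i) = 0 := fun j => by
    simpa [map_sum, map_smul] using hc j
  rw [norm_sq_fst_sum, norm_sq_snd_sum] at h1
  simp only [h2, hu.orth, hu.inner_snd, mul_ite, mul_one, mul_zero, Finset.sum_ite_eq,
    Finset.mem_univ, if_true, ne_eq, OfNat.ofNat_ne_zero, not_false_eq_true, zero_pow,
    Finset.sum_const_zero, add_zero, Finset.mul_sum] at h1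
  obtain ⟨i, hi⟩ : ∃ i, c i ≠ 0 := by
    by_contra! h
    exact hc0 (funext h)
  refine h1.not_gt (Finset.sum_lt_sum (fun i _ => ?_) ⟨i, Finset.mem_univ i, ?_⟩)
  · nlinarith [mul_self_nonneg (c i), hL i]
  · nlinarith [mul_self_pos.2 hi, hL i]

/-- If the essential spectrum is empty and `H̊¹(Ω; S)` has infinite dimension in `L²(Ω)`, then the
eigenvalues form a sequence that tends to infinity. -/
lemma exists_isEigenvalueSequence (hco : ∀ t, CoerciveModFinite Ω S t) (φ : ℕ → L2Pair Ω)
    (hφ : ∀ k, φ k ∈ sobolev Ω S)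
    (hφo : ∀ j k, ⟪(φ j).fst, (φ k).fst⟫ = if j = k then 1 else 0) :
    ∃ lam : ℕ → ℝ, IsEigenvalueSequence Ω S lam := by
  have hfd : ∀ t, FiniteDimensional ℝ (eigenspace Ω S t) := fun t =>
    (hco (t + 1)).finiteDimensional (lt_add_one t)
  -- the eigenvalues with their multiplicities, as the pairs of an eigenvalue and the number of a
  -- basis vector of its eigenspace, in lexicographic order
  let d : ℝ → ℕ := fun t => Module.finrank ℝ (eigenspace Ω S t)
  let ι : Type := {p : ℝ ×ₗ ℕ // (ofLex p).2 < d (ofLex p).1}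
  let T : ι → ℝ := fun p => (ofLex p.1).1
  classical
  obtain ⟨u, hu, hub⟩ := ThinCylinder.exists_isEigenbasis (Ω := Ω) (S := S) T (fun i => hfd _)
    (fun i => ⟨(ofLex i.1).2, i.2⟩) (fun i j h1 h2 => Subtype.ext (by
      apply ofLex.injective
      exact Prod.ext h1 h2))
  have hsub : ∀ t, {i : ι | T i ≤ t}.Finite := by
    intro t
    by_contra hinf
    obtain ⟨k, hk⟩ := (hco (t + 1)).exists_card_le
    obtain ⟨s, hs, hcard⟩ := Set.Infinite.exists_subset_card_eq hinf (k + 1)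
    have := hk (fun i : s => T i) (fun i : s => u i)
      ⟨fun i => hu.mem i, fun i j => by rw [hu.orth]; exact if_congr Subtype.ext_iff.symm rfl rfl⟩
      (fun i => lt_of_le_of_lt (hs i.2) (lt_add_one t))
    simp only [Fintype.card_coe, hcard] at this
    omega
  have hspan : ∀ t, ∀ V ∈ eigenspace Ω S t, V ∈ Submodule.span ℝ (u '' {i | T i = t}) := by
    intro t V hV
    refine mem_of_forall_stdOrthonormalBasis_mem (fun k => ?_) V hV
    obtain ⟨c, hc, hc0⟩ := hub ⟨toLex (t, k), k.2⟩
    refine (Submodule.smul_mem_iff _ hc0).1 ?_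
    have h4 : u ⟨toLex (t, (k : ℕ)), k.2⟩ ∈ Submodule.span ℝ (u '' {i | T i = t}) :=
      Submodule.subset_span ⟨_, rfl, rfl⟩
    rw [hc] at h4
    exact h4
  have hinf : Infinite ι := by
    by_contra hfin
    rw [not_infinite_iff_finite] at hfin
    have := Fintype.ofFinite ι
    -- a nonzero trial element that is orthogonal to all the eigenvectors
    obtain ⟨c, hc0, hc⟩ := exists_ne_zero_sum_mul_eq_zero (κ := Fin (Fintype.card ι + 1)) (κ' := ι)
      (by simp) (fun k i => ⟪(φ k).fst, (u i).fst⟫)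
    set W := ∑ k, c k • φ k with hW
    have hWm : W ∈ sobolev Ω S :=
      Submodule.sum_mem _ fun i _ => Submodule.smul_mem _ _ (hφ _)
    have hWpos : 0 < ‖W.fst‖ ^ 2 := by
      rw [hW, norm_sq_fst_sum (ι := Fin (Fintype.card ι + 1)) c (fun k => φ k)]
      simp only [hφo, Fin.val_inj, mul_ite, mul_one, mul_zero, Finset.sum_ite_eq,
        Finset.mem_univ, if_true]
      obtain ⟨i, hi⟩ : ∃ i, c i ≠ 0 := by
        by_contra! h
        exact hc0 (funext h)
      exact Finset.sum_pos' (fun i _ => mul_self_nonneg _)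
        ⟨i, Finset.mem_univ i, mul_self_pos.2 hi⟩
    have hWu : ∀ i, ⟪W.fst, (u i).fst⟫ = 0 := by
      intro i
      rw [hW, fst_sum_smul, sum_inner]
      simpa only [real_inner_smul_left] using hc i
    have hray : ∀ t : ℝ, 0 ≤ t → t * ‖W.fst‖ ^ 2 ≤ ‖W.snd‖ ^ 2 := fun t ht =>
      (hco (t + 1)).le_of_orthogonal ht (lt_add_one t) hWm fun s _ V hV => by
        refine inner_fst_eq_zero_of_mem_span ?_ (hspan s V hV)
        rintro _ ⟨i, -, rfl⟩
        rw [real_inner_comm]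
        exact hWu i
    have h1 := hray (‖W.snd‖ ^ 2 / ‖W.fst‖ ^ 2 + 1) (by positivity)
    rw [add_mul, div_mul_cancel₀ _ hWpos.ne'] at h1
    linarith
  have hTmono : Monotone T := fun i j hij => by
    have h1 : ofLex i.1 = ofLex j.1 ∨ (ofLex i.1).1 < (ofLex j.1).1 ∨ (ofLex i.1).1 = (ofLex j.1).1 := by
      rcases Prod.Lex.le_iff.1 (show i.1 ≤ j.1 from hij) with h | h
      · exact Or.inr (Or.inl h)
      · exact Or.inr (Or.inr h.1)
    rcases h1 with h | h | h
    · exact (congrArg Prod.fst h).le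
    · exact h.le
    · exact h.le
  obtain ⟨g⟩ := exists_orderIso_nat fun i : ι => (hsub (T i)).subset fun j hj => hTmono hj
  refine ⟨fun k => T (g k), hTmono.comp g.monotone, ?_, fun _ => mem_univ _, fun t _ => ?_⟩
  · refine tendsto_atTop_atTop_of_monotone (hTmono.comp g.monotone) fun t => ?_
    by_contra! h
    have hu : (univ : Set ι) ⊆ {i | T i ≤ t} := fun i _ => by
      have h1 := (h (g.symm i)).le
      rwa [OrderIso.apply_symm_apply] at h1
    exact Set.infinite_univ ((hsub t).subset hu)
  · rw [← Module.finrank_eq_rank, ← Cardinal.mk_fin]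
    refine Cardinal.mk_congr ⟨fun k => ⟨(ofLex (g k.1).1).2, ?_⟩,
      fun k => ⟨g.symm ⟨toLex (t, k), k.2⟩, by simp [T]⟩, fun k => ?_, fun k => ?_⟩
    · have h1 := (g k.1).2
      have h2 : (ofLex (g k.1).1).1 = t := k.2
      rwa [h2] at h1
    · apply Subtype.ext
      apply g.injective
      rw [OrderIso.apply_symm_apply]
      apply Subtype.ext
      apply ofLex.injective
      exact Prod.ext k.2.symm rfl
    · simp

end Spectral

/-! ### Weighted composition operators on `L²` -/

section FieldOperators

variable {α α' G G' : Type*} [MeasurableSpace α] [MeasurableSpace α']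
  [NormedAddCommGroup G] [NormedSpace ℝ G] [NormedAddCommGroup G'] [NormedSpace ℝ G']

/-- The weighted composition operator `u ↦ (x ↦ T x (u (Φ x)))` between `L²` spaces, for a
strongly measurable field `T` of operators. The bound `hC` implies that the result depends only on
the class of `u`: no assumption that `Φ` preserves null sets is needed, since `T` may vanish. -/
lemma exists_weightedComposition {μ : Measure α} {ν : Measure α'} {Φ : α' → α} (hΦ : Measurable Φ)
    {T : α' → G →L[ℝ] G'} (hT : StronglyMeasurable T) (C : ℝ≥0)
    (hC : ∀ f : α → ℝ≥0∞, Measurable f →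
      ∫⁻ x, ‖T x‖ₑ ^ 2 * f (Φ x) ∂ν ≤ C ^ 2 * ∫⁻ y, f y ∂μ) :
    ∃ A : Lp G 2 μ →L[ℝ] Lp G' 2 ν, ∀ u, A u =ᵐ[ν] fun x => T x (u (Φ x)) := by
  have hsm : ∀ u : α → G, StronglyMeasurable u → StronglyMeasurable fun x => T x (u (Φ x)) :=
    fun u hu => (isBoundedBilinearMap_apply (𝕜 := ℝ) (E := G) (F := G')).continuous.comp_stronglyMeasurable
      (hT.prodMk (hu.comp_measurable hΦ))
  have hbound : ∀ u : α → G, StronglyMeasurable u →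
      eLpNorm (fun x => T x (u (Φ x))) 2 ν ≤ C * eLpNorm u 2 μ := by
    intro u hu
    have h1 : ∫⁻ x, ‖T x (u (Φ x))‖ₑ ^ 2 ∂ν ≤ C ^ 2 * ∫⁻ y, ‖u y‖ₑ ^ 2 ∂μ := by
      refine le_trans (lintegral_mono fun x => ?_) (hC (fun y => ‖u y‖ₑ ^ 2) (hu.enorm.pow_const 2))
      rw [← mul_pow]
      exact pow_le_pow_left' ((T x).le_opENorm _) 2
    simp only [eLpNorm_eq_lintegral_rpow_enorm_toReal (two_ne_zero) ENNReal.ofNat_ne_top,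
      ENNReal.toReal_ofNat, ENNReal.rpow_ofNat]
    calc _ ≤ (C ^ 2 * ∫⁻ y, ‖u y‖ₑ ^ 2 ∂μ : ℝ≥0∞) ^ (1 / (2 : ℝ)) :=
          ENNReal.rpow_le_rpow h1 (by positivity)
      _ = _ := by
          rw [ENNReal.mul_rpow_of_nonneg _ _ (by positivity), ← ENNReal.rpow_natCast,
            ← ENNReal.rpow_mul]
          norm_num
  have hae : ∀ u v : α → G, StronglyMeasurable u → StronglyMeasurable v → u =ᵐ[μ] v →
      (fun x => T x (u (Φ x))) =ᵐ[ν] fun x => T x (v (Φ x)) := by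
    intro u v hu hv huv
    have h1 := hbound (u - v) (hu.sub hv)
    have h2 : eLpNorm (u - v) 2 μ = 0 :=
      (eLpNorm_eq_zero_iff (hu.sub hv).aestronglyMeasurable two_ne_zero).2
        (huv.mono fun x hx => by simp [hx])
    rw [h2, mul_zero, nonpos_iff_eq_zero, eLpNorm_eq_zero_iff
      (hsm _ (hu.sub hv)).aestronglyMeasurable two_ne_zero] at h1
    filter_upwards [h1] with x hx
    simpa [sub_eq_zero] using hx
  have hmem : ∀ u : Lp G 2 μ, MemLp (fun x => T x (u (Φ x))) 2 ν := fun u =>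
    ⟨(hsm _ (Lp.stronglyMeasurable u)).aestronglyMeasurable,
      (hbound _ (Lp.stronglyMeasurable u)).trans_lt
        (ENNReal.mul_lt_top ENNReal.coe_lt_top (Lp.eLpNorm_lt_top u))⟩
  let A₀ : Lp G 2 μ →ₗ[ℝ] Lp G' 2 ν :=
    { toFun := fun u => (hmem u).toLp _
      map_add' := fun u v => by
        rw [← MemLp.toLp_add, MemLp.toLp_eq_toLp_iff]
        refine (hae _ _ (Lp.stronglyMeasurable _)
          ((Lp.stronglyMeasurable u).add (Lp.stronglyMeasurable v)) (Lp.coeFn_add u v)).trans ?_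
        exact ae_of_all _ fun x => by simp
      map_smul' := fun c u => by
        rw [RingHom.id_apply, ← MemLp.toLp_const_smul, MemLp.toLp_eq_toLp_iff]
        refine (hae _ _ (Lp.stronglyMeasurable _)
          ((Lp.stronglyMeasurable u).const_smul c) (Lp.coeFn_smul c u)).trans ?_
        exact ae_of_all _ fun x => by simp }
  refine ⟨A₀.mkContinuous C fun u => ?_, fun u => (hmem u).coeFn_toLp⟩
  change ‖(hmem u).toLp _‖ ≤ _
  rw [Lp.norm_toLp, Lp.norm_def]
  have := ENNReal.toReal_mono (ENNReal.mul_ne_top ENNReal.coe_ne_top (Lp.eLpNorm_ne_top u))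
    (hbound _ (Lp.stronglyMeasurable u))
  simpa [ENNReal.toReal_mul] using this

end FieldOperators

/-! ### Similarities of a Euclidean space -/

section Similarity

variable {F : Type} [NormedAddCommGroup F] [InnerProductSpace ℝ F]

/-- The similarity `x ↦ p + r • R x`. -/
noncomputable def similarity (p : F) {r : ℝ} (hr : 0 < r) (R : F ≃ₗᵢ[ℝ] F) : F ≃ₜ F :=
  (R.toHomeomorph.trans (Homeomorph.smulOfNeZero r hr.ne')).trans (Homeomorph.addLeft p)

@[simp] lemma similarity_apply (p : F) {r : ℝ} (hr : 0 < r) (R : F ≃ₗᵢ[ℝ] F) (x : F) :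
    similarity p hr R x = p + r • R x := rfl

lemma hasGradientAt_comp_similarity [CompleteSpace F] (p : F) {r : ℝ} (hr : 0 < r)
    (R : F ≃ₗᵢ[ℝ] F) {f : F → ℝ} {x g : F} (hf : HasGradientAt f g (similarity p hr R x)) :
    HasGradientAt (fun x => f (similarity p hr R x)) (r • R.symm g) x := by
  rw [hasGradientAt_iff_hasFDerivAt] at hf ⊢
  have h1 : HasFDerivAt (similarity p hr R) (r • (R.toContinuousLinearEquiv : F →L[ℝ] F)) x := by
    have h2 := (R.toContinuousLinearEquiv : F →L[ℝ] F).hasFDerivAt (x := x)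
    exact (h2.const_smul r).const_add p
  refine (hf.comp x h1).congr_fderiv ?_
  ext v
  have h3 : ⟪R.symm g, v⟫ = ⟪g, R v⟫ := by
    rw [← R.inner_map_map, R.apply_symm_apply]
  simp [h3]

variable [FiniteDimensional ℝ F] [MeasurableSpace F] [BorelSpace F]

lemma map_similarity (p : F) {r : ℝ} (hr : 0 < r) (R : F ≃ₗᵢ[ℝ] F) :
    (volume : Measure F).map (similarity p hr R) =
      ENNReal.ofReal ((r ^ Module.finrank ℝ F)⁻¹) • volume := by
  have h1 : (similarity p hr R : F → F) = (p + ·) ∘ (r • ·) ∘ R := rfl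
  rw [h1, ← Measure.map_map (measurable_const_add p) ((measurable_const_smul r).comp
    R.continuous.measurable), ← Measure.map_map (measurable_const_smul r) R.continuous.measurable,
    R.measurePreserving.map_eq, Measure.map_addHaar_smul _ hr.ne', Measure.map_smul,
    map_add_left_eq_self, abs_of_pos (by positivity)]

lemma lintegral_comp_similarity (p : F) {r : ℝ} (hr : 0 < r) (R : F ≃ₗᵢ[ℝ] F) (f : F → ℝ≥0∞) :
    ∫⁻ x, f (similarity p hr R x) = ENNReal.ofReal ((r ^ Module.finrank ℝ F)⁻¹) * ∫⁻ y, f y := by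
  rw [← (similarity p hr R).measurableEmbedding.lintegral_map f]
  rw [map_similarity, lintegral_smul_measure, smul_eq_mul]

lemma integral_comp_similarity (p : F) {r : ℝ} (hr : 0 < r) (R : F ≃ₗᵢ[ℝ] F) (f : F → ℝ) :
    ∫ x, f (similarity p hr R x) = (r ^ Module.finrank ℝ F)⁻¹ * ∫ y, f y := by
  rw [← (similarity p hr R).measurableEmbedding.integral_map f]
  rw [map_similarity, integral_smul_measure, smul_eq_mul, ENNReal.toReal_ofReal (by positivity)]

end Similarity

/-! ### Multipliers and the transport of test functions -/

section Transport

variable {F : Type} [NormedAddCommGroup F] [InnerProductSpace ℝ F] [FiniteDimensional ℝ F]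

/-- A smooth multiplier: a smooth function that is bounded together with its gradient. -/
structure IsMultiplier (χ : F → ℝ) (C : ℝ) : Prop where
  smooth : ContDiff ℝ (⊤ : ℕ∞) χ
  abs_le : ∀ x, |χ x| ≤ C
  norm_gradient_le : ∀ x, ‖gradient χ x‖ ≤ C

lemma _root_.ContDiff.continuous_gradient {χ : F → ℝ} {n : WithTop ℕ∞} (h : ContDiff ℝ n χ)
    (hn : 1 ≤ n) : Continuous (gradient χ) :=
  (InnerProductSpace.toDual ℝ F).symm.continuous.comp
    (h.continuous_fderiv (ne_of_gt (lt_of_lt_of_le one_pos hn)))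

lemma tsupport_gradient_subset (χ : F → ℝ) : tsupport (gradient χ) ⊆ tsupport χ := by
  refine closure_minimal (fun x hx => ?_) (isClosed_tsupport χ)
  by_contra hx'
  rw [notMem_tsupport_iff_eventuallyEq] at hx'
  refine hx ?_
  rw [hx'.gradient_eq]
  exact gradient_const x 0

lemma gradient_mul {χ φ : F → ℝ} {x : F} (hχ : DifferentiableAt ℝ χ x)
    (hφ : DifferentiableAt ℝ φ x) :
    gradient (fun y => χ y * φ y) x = χ x • gradient φ x + φ x • gradient χ x := by
  simp only [gradient]
  rw [fderiv_fun_mul hχ hφ]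
  simp

variable [MeasurableSpace F] [BorelSpace F]

/-- Multiplication by a multiplier `χ` followed by the composition with a similarity `Φ`, as an
operator on pairs `(u, ∇u)`. The constant factor makes it preserve `L²` norms up to `χ`. -/
lemma exists_transport_clm {Ω Ω' : Set F} (hΩ : MeasurableSet Ω) {χ : F → ℝ} {C : ℝ}
    (hχ : IsMultiplier χ C) (p : F) {r : ℝ} (hr : 0 < r) (R : F ≃ₗᵢ[ℝ] F) :
    ∃ A : L2Pair Ω →L[ℝ] L2Pair Ω', ∀ U : L2Pair Ω,
      ((A U).fst =ᵐ[volume.restrict Ω'] fun x => √(r ^ Module.finrank ℝ F) *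
        Ω.indicator (fun y => χ y * U.fst y) (similarity p hr R x)) ∧
      ((A U).snd =ᵐ[volume.restrict Ω'] fun x => (√(r ^ Module.finrank ℝ F) * r) •
        R.symm (Ω.indicator (fun y => χ y • U.snd y + U.fst y • gradient χ y)
          (similarity p hr R x))) := by
  set κ := √(r ^ Module.finrank ℝ F) with hκ
  set Φ := similarity p hr R with hΦ
  have hC0 : 0 ≤ C := (abs_nonneg _).trans (hχ.abs_le 0)
  have hκ0 : 0 ≤ κ := Real.sqrt_nonneg _
  have hmeas : Measurable Φ := Φ.continuous.measurable
  have hind : Measurable fun x => Ω.indicator (fun _ => (1 : ℝ)) (Φ x) :=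
    (measurable_const.indicator hΩ).comp hmeas
  -- the change of variables, for the fields that occur
  have hbound : ∀ {G G' : Type} [NormedAddCommGroup G] [NormedSpace ℝ G] [NormedAddCommGroup G']
      [NormedSpace ℝ G'] (T : F → G →L[ℝ] G') (D : ℝ≥0)
      (_ : ∀ x, ‖T x‖ ≤ κ * D * Ω.indicator (fun _ => (1 : ℝ)) (Φ x)) (f : F → ℝ≥0∞)
      (_ : Measurable f), ∫⁻ x, ‖T x‖ₑ ^ 2 * f (Φ x) ∂(volume.restrict Ω')
        ≤ D ^ 2 * ∫⁻ y, f y ∂(volume.restrict Ω) := by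
    intro G G' _ _ _ _ T D hT f hf
    calc ∫⁻ x, ‖T x‖ₑ ^ 2 * f (Φ x) ∂(volume.restrict Ω')
        ≤ ∫⁻ x, ‖T x‖ₑ ^ 2 * f (Φ x) := lintegral_mono' Measure.restrict_le_self le_rfl
      _ ≤ ∫⁻ x, ENNReal.ofReal (κ ^ 2) * D ^ 2 * Ω.indicator f (Φ x) := by
          refine lintegral_mono fun x => ?_
          have h1 := hT x
          by_cases hx : Φ x ∈ Ω
          · rw [indicator_of_mem hx] at h1 ⊢
            gcongr
            rw [← ofReal_norm, ← ENNReal.ofReal_pow (norm_nonneg _),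
              ← ENNReal.ofReal_coe_nnreal (p := D), ← ENNReal.ofReal_pow D.coe_nonneg,
              ← ENNReal.ofReal_mul (sq_nonneg _), ← mul_pow]
            exact ENNReal.ofReal_le_ofReal (pow_le_pow_left₀ (norm_nonneg _) (by simpa using h1) 2)
          · rw [indicator_of_notMem hx, mul_zero] at h1
            have h0 : ‖T x‖ₑ = 0 := by
              rw [← ofReal_norm, le_antisymm h1 (norm_nonneg _), ENNReal.ofReal_zero]
            rw [h0, zero_pow two_ne_zero, zero_mul]
            exact zero_le
      _ = ENNReal.ofReal (κ ^ 2) * D ^ 2 * (ENNReal.ofReal ((r ^ Module.finrank ℝ F)⁻¹) *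
            ∫⁻ y, Ω.indicator f y) := by
          rw [lintegral_const_mul (f := fun x => Ω.indicator f (Φ x)) _
            ((hf.indicator hΩ).comp hmeas), lintegral_comp_similarity]
      _ = D ^ 2 * ∫⁻ y, f y ∂(volume.restrict Ω) := by
          rw [lintegral_indicator hΩ, hκ, Real.sq_sqrt (by positivity)]
          have : ENNReal.ofReal (r ^ Module.finrank ℝ F) *
              ENNReal.ofReal ((r ^ Module.finrank ℝ F)⁻¹) = 1 := by
            rw [← ENNReal.ofReal_mul (by positivity), mul_inv_cancel₀ (by positivity),
              ENNReal.ofReal_one]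
          rw [mul_right_comm, ← mul_assoc, this, one_mul, mul_comm]
  have hcχ : Measurable fun x => χ (Φ x) := (hχ.smooth.continuous.comp Φ.continuous).measurable
  have hcg : Measurable fun x => gradient χ (Φ x) :=
    ((hχ.smooth.continuous_gradient (by exact_mod_cast le_top)).comp Φ.continuous).measurable
  have hone : ∀ x, 0 ≤ Ω.indicator (fun _ => (1 : ℝ)) (Φ x) := fun x =>
    indicator_nonneg (fun _ _ => zero_le_one) _
  have hst : StronglyMeasurable fun x => κ * Ω.indicator (fun _ => (1 : ℝ)) (Φ x) * χ (Φ x) :=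
    ((hind.const_mul κ).mul hcχ).stronglyMeasurable
  obtain ⟨A₁, hA₁⟩ := exists_weightedComposition (μ := volume.restrict Ω)
    (ν := volume.restrict Ω') hmeas
    (T := fun x => (κ * Ω.indicator (fun _ => (1 : ℝ)) (Φ x) * χ (Φ x)) • ContinuousLinearMap.id ℝ ℝ)
    (hst.smul_const _) C.toNNReal (hbound _ _ fun x => by
      rw [norm_smul, norm_mul, norm_mul, Real.norm_of_nonneg hκ0, Real.norm_of_nonneg (hone x)]
      have h1 := hχ.abs_le (Φ x)
      have h2 : ‖ContinuousLinearMap.id ℝ ℝ‖ ≤ 1 := ContinuousLinearMap.norm_id_le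
      have h3 := hone x
      calc _ ≤ κ * Ω.indicator (fun _ => (1 : ℝ)) (Φ x) * C * 1 := by gcongr; exact h1
        _ = _ := by rw [Real.coe_toNNReal _ (by positivity)]; ring)
  obtain ⟨A₂, hA₂⟩ := exists_weightedComposition (μ := volume.restrict Ω)
    (ν := volume.restrict Ω') hmeas
    (T := fun x => (r * (κ * Ω.indicator (fun _ => (1 : ℝ)) (Φ x) * χ (Φ x))) •
      (R.symm.toContinuousLinearEquiv : F →L[ℝ] F))
    ((hst.const_mul r).smul_const _) (r * C).toNNReal (hbound _ _ fun x => by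
      rw [norm_smul, norm_mul, norm_mul, norm_mul, Real.norm_of_nonneg hκ0,
        Real.norm_of_nonneg (hone x), Real.norm_of_nonneg hr.le]
      have h1 := hχ.abs_le (Φ x)
      have h2 : ‖(R.symm.toContinuousLinearEquiv : F →L[ℝ] F)‖ ≤ 1 :=
        ContinuousLinearMap.opNorm_le_bound _ zero_le_one fun v => by simp
      have h3 := hone x
      calc _ ≤ r * (κ * Ω.indicator (fun _ => (1 : ℝ)) (Φ x) * C) * 1 := by gcongr; exact h1
        _ = _ := by rw [Real.coe_toNNReal _ (by positivity)]; ring)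
  have hv : StronglyMeasurable fun x => (r * (κ * Ω.indicator (fun _ => (1 : ℝ)) (Φ x))) •
      R.symm (gradient χ (Φ x)) :=
    (((hind.const_mul κ).const_mul r).stronglyMeasurable).smul
      ((R.symm.continuous.measurable.comp hcg).stronglyMeasurable)
  obtain ⟨A₃, hA₃⟩ := exists_weightedComposition (μ := volume.restrict Ω)
    (ν := volume.restrict Ω') hmeas
    (T := fun x => ContinuousLinearMap.toSpanSingleton ℝ
      ((r * (κ * Ω.indicator (fun _ => (1 : ℝ)) (Φ x))) • R.symm (gradient χ (Φ x))))
    ((ContinuousLinearMap.toSpanSingletonCLE (𝕜 := ℝ) (E := F)).continuous.comp_stronglyMeasurable hv)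
    (r * C).toNNReal (hbound _ _ fun x => by
      rw [ContinuousLinearMap.norm_toSpanSingleton, norm_smul, norm_mul, norm_mul,
        Real.norm_of_nonneg hκ0, Real.norm_of_nonneg (hone x), Real.norm_of_nonneg hr.le,
        R.symm.norm_map]
      have h1 := hχ.norm_gradient_le (Φ x)
      have h3 := hone x
      calc _ ≤ r * (κ * Ω.indicator (fun _ => (1 : ℝ)) (Φ x)) * C := by gcongr
        _ = _ := by rw [Real.coe_toNNReal _ (by positivity)]; ring)
  let P₁ := WithLp.fstL 2 ℝ (Lp ℝ 2 (volume.restrict Ω)) (Lp F 2 (volume.restrict Ω))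
  let P₂ := WithLp.sndL 2 ℝ (Lp ℝ 2 (volume.restrict Ω)) (Lp F 2 (volume.restrict Ω))
  let J := (WithLp.prodContinuousLinearEquiv 2 ℝ (Lp ℝ 2 (volume.restrict Ω'))
    (Lp F 2 (volume.restrict Ω'))).symm
  refine ⟨(J : _ →L[ℝ] L2Pair Ω').comp ((A₁.comp P₁).prod (A₂.comp P₂ + A₃.comp P₁)),
    fun U => ⟨?_, ?_⟩⟩
  · refine (hA₁ U.fst).trans (ae_of_all _ fun x => ?_)
    by_cases hx : Φ x ∈ Ω
    · simp [hx, mul_assoc]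
    · simp [hx]
  · refine (Lp.coeFn_add (A₂ U.snd) (A₃ U.fst)).trans ?_
    filter_upwards [hA₂ U.snd, hA₃ U.fst] with x h2 h3
    rw [Pi.add_apply, h2, h3]
    by_cases hx : Φ x ∈ Ω
    · simp only [hx, indicator_of_mem, mul_one, map_add, map_smul, smul_add, smul_smul,
        _root_.smul_apply, ContinuousLinearMap.toSpanSingleton_apply]
      simp only [ContinuousLinearEquiv.coe_coe, LinearIsometryEquiv.coe_toContinuousLinearEquiv]
      congr 2 <;> ring
    · simp [hx]

end Transport

/-! ### Transport and localization in `H̊¹` -/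

section Transport

lemma inner_eq_mul_real (a b : ℝ) : ⟪a, b⟫ = a * b := by
  simp [mul_comm]

variable {F : Type} [NormedAddCommGroup F] [InnerProductSpace ℝ F] [FiniteDimensional ℝ F]
  [MeasurableSpace F] [BorelSpace F]

/-- A continuous operator that maps test pairs to test pairs maps `H̊¹` to `H̊¹`. -/
lemma map_mem_sobolev {Ω S Ω' S' : Set F} (A : L2Pair Ω →L[ℝ] L2Pair Ω')
    (hA : ∀ U ∈ testPairs Ω S, A U ∈ testPairs Ω' S') {U : L2Pair Ω} (hU : U ∈ sobolev Ω S) :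
    A U ∈ sobolev Ω' S' :=
  map_mem_closure A.continuous hU hA

lemma sobolev_induction {Ω S : Set F} {P : L2Pair Ω → Prop} (hP : IsClosed {U | P U})
    (h : ∀ U ∈ testPairs Ω S, P U) {U : L2Pair Ω} (hU : U ∈ sobolev Ω S) : P U :=
  closure_minimal (fun V hV => h V hV) hP hU

/-- The functions `χ U` can be carried from `(Ω, S)` to `(Ω', S')` by a similarity that matches the
two problems on the support of `χ`. The operator is normalized so that the norm in `L²` does not
change, while the energy is multiplied by `r²`, where `r` is the ratio of the similarity. -/
lemma exists_transport {Ω Ω' S S' : Set F} (hΩ : MeasurableSet Ω) (hΩ' : MeasurableSet Ω')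
    {χ : F → ℝ} {C : ℝ} (hχ : IsMultiplier χ C) (p : F) {r : ℝ} (hr : 0 < r) (R : F ≃ₗᵢ[ℝ] F)
    (h1 : ∀ x, similarity p hr R x ∈ tsupport χ → (x ∈ Ω' ↔ similarity p hr R x ∈ Ω))
    (h2 : ∀ x ∈ closure S', similarity p hr R x ∈ tsupport χ →
      similarity p hr R x ∈ closure S) :
    ∃ A : L2Pair Ω →L[ℝ] L2Pair Ω', (∀ U : L2Pair Ω,
      ((A U).fst =ᵐ[volume.restrict Ω'] fun x => √(r ^ Module.finrank ℝ F) *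
        Ω.indicator (fun y => χ y * U.fst y) (similarity p hr R x)) ∧
      ((A U).snd =ᵐ[volume.restrict Ω'] fun x => (√(r ^ Module.finrank ℝ F) * r) •
        R.symm (Ω.indicator (fun y => χ y • U.snd y + U.fst y • gradient χ y)
          (similarity p hr R x)))) ∧
      (∀ U ∈ sobolev Ω S, A U ∈ sobolev Ω' S') ∧
      (∀ U W : L2Pair Ω, ⟪(A U).fst, (A W).fst⟫ = ∫ y in Ω, χ y ^ 2 * (U.fst y * W.fst y)) ∧
      (∀ U W : L2Pair Ω, ⟪(A U).snd, (A W).snd⟫ = r ^ 2 * ∫ y in Ω,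
        ⟪χ y • U.snd y + U.fst y • gradient χ y, χ y • W.snd y + W.fst y • gradient χ y⟫) := by
  obtain ⟨A, hA⟩ := exists_transport_clm (Ω' := Ω') hΩ hχ p hr R
  set κ := √(r ^ Module.finrank ℝ F) with hκ
  set Φ := similarity p hr R with hΦ
  have hκ2 : κ ^ 2 = r ^ Module.finrank ℝ F := Real.sq_sqrt (by positivity)
  have hχd : Differentiable ℝ χ := hχ.smooth.differentiable (by simp)
  have hχ0 : ∀ y, y ∉ tsupport χ → χ y = 0 ∧ gradient χ y = 0 := fun y hy =>
    ⟨image_eq_zero_of_notMem_tsupport hy,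
      image_eq_zero_of_notMem_tsupport fun h => hy (tsupport_gradient_subset χ h)⟩
  have hint : ∀ f : F → ℝ, (∀ y ∉ tsupport χ, f y = 0) →
      ∫ x in Ω', Ω.indicator f (Φ x) = (r ^ Module.finrank ℝ F)⁻¹ * ∫ y in Ω, f y := by
    intro f hf
    rw [setIntegral_eq_integral_of_forall_compl_eq_zero, integral_comp_similarity,
      integral_indicator hΩ]
    intro x hx
    by_cases hx' : Φ x ∈ tsupport χ
    · exact indicator_of_notMem (fun h => hx ((h1 x hx').2 h)) _
    · exact indicator_apply_eq_zero.2 fun _ => hf _ hx'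
  refine ⟨A, hA, fun U hU => map_mem_sobolev A (fun U hU => ?_) hU, fun U W => ?_, fun U W => ?_⟩
  · obtain ⟨φ, hφ, hφc, hφS, hφ1, hφ2⟩ := hU
    have hφd : Differentiable ℝ φ := hφ.differentiable (by simp)
    have hΦs : ContDiff ℝ (⊤ : ℕ∞) Φ :=
      contDiff_const.add ((R.contDiff).const_smul r)
    have hts : tsupport (fun x => κ * (χ (Φ x) * φ (Φ x))) ⊆
        Φ ⁻¹' (tsupport χ ∩ tsupport φ) := by
      refine closure_minimal (fun x hx => ?_)
        (((isClosed_tsupport χ).inter (isClosed_tsupport φ)).preimage Φ.continuous)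
      have h3 : χ (Φ x) ≠ 0 ∧ φ (Φ x) ≠ 0 := by simpa using (right_ne_zero_of_mul hx)
      exact ⟨subset_tsupport _ h3.1, subset_tsupport _ h3.2⟩
    refine ⟨fun x => κ * (χ (Φ x) * φ (Φ x)), ?_, ?_, ?_, ?_, ?_⟩
    · exact contDiff_const.mul ((hχ.smooth.comp hΦs).mul (hφ.comp hΦs))
    · refine IsCompact.of_isClosed_subset ((hφc.comp_homeomorph Φ).isCompact)
        (isClosed_tsupport _) (closure_mono fun x hx => ?_)
      exact right_ne_zero_of_mul (right_ne_zero_of_mul hx)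
    · rw [Set.disjoint_left]
      intro x hx hxS
      exact Set.disjoint_left.1 hφS (hts hx).2 (h2 x hxS (hts hx).1)
    · have hae : ∀ᵐ x ∂(volume.restrict Ω'), Φ x ∈ Ω → U.fst (Φ x) = φ (Φ x) := by
        refine ae_restrict_of_ae ?_
        have h4 := (ae_restrict_iff' hΩ).1 hφ1
        have h5 : Measure.QuasiMeasurePreserving Φ (volume : Measure F) volume := by
          refine ⟨Φ.continuous.measurable, ?_⟩
          rw [map_similarity]
          exact Measure.smul_absolutelyContinuous
        exact h5.ae h4
      filter_upwards [(hA U).1, hae, ae_restrict_mem hΩ'] with x hx1 hx2 hx3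
      rw [hx1]
      congr 1
      by_cases hx : Φ x ∈ tsupport χ
      · have h4 := (h1 x hx).1 hx3
        rw [indicator_of_mem h4, hx2 h4]
      · rw [(hχ0 _ hx).1, zero_mul]
        exact indicator_apply_eq_zero.2 fun _ => by rw [(hχ0 _ hx).1, zero_mul]
    · have hae : ∀ᵐ x ∂(volume.restrict Ω'), Φ x ∈ Ω →
          U.fst (Φ x) = φ (Φ x) ∧ U.snd (Φ x) = gradient φ (Φ x) := by
        refine ae_restrict_of_ae ?_
        have h4 := (ae_restrict_iff' hΩ).1 (hφ1.and hφ2)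
        have h5 : Measure.QuasiMeasurePreserving Φ (volume : Measure F) volume := by
          refine ⟨Φ.continuous.measurable, ?_⟩
          rw [map_similarity]
          exact Measure.smul_absolutelyContinuous
        exact h5.ae h4
      filter_upwards [(hA U).2, hae, ae_restrict_mem hΩ'] with x hx1 hx2 hx3
      rw [hx1]
      have hg : HasGradientAt (fun y => χ y * φ y)
          (χ (Φ x) • gradient φ (Φ x) + φ (Φ x) • gradient χ (Φ x)) (Φ x) := by
        rw [← gradient_mul (hχd _) (hφd _)]
        exact ((hχd _).mul (hφd _)).hasGradientAt
      have hg2 := (hasGradientAt_comp_similarity p hr R hg)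
      have hg3 : gradient (fun x => κ * (χ (Φ x) * φ (Φ x))) x =
          κ • gradient (fun x => χ (Φ x) * φ (Φ x)) x := by
        rw [gradient, fderiv_const_mul hg2.differentiableAt, map_smul]
        rfl
      rw [hg3, hg2.gradient, smul_smul]
      congr 2
      by_cases hx : Φ x ∈ tsupport χ
      · have h4 := (h1 x hx).1 hx3
        rw [indicator_of_mem h4, (hx2 h4).1, (hx2 h4).2]
      · rw [(hχ0 _ hx).1, (hχ0 _ hx).2, zero_smul, smul_zero, zero_add]
        exact indicator_apply_eq_zero.2 fun _ => by
          rw [(hχ0 _ hx).1, (hχ0 _ hx).2, zero_smul, smul_zero, zero_add]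
  · have h3 : ⟪(A U).fst, (A W).fst⟫ = ∫ x in Ω', κ ^ 2 *
        Ω.indicator (fun y => χ y ^ 2 * (U.fst y * W.fst y)) (Φ x) := by
      rw [L2.inner_def]
      refine integral_congr_ae ?_
      filter_upwards [(hA U).1, (hA W).1] with x hx1 hx2
      rw [hx1, hx2]
      by_cases hx : Φ x ∈ Ω
      · simp only [hx, indicator_of_mem, inner_eq_mul_real]
        ring
      · simp [hx]
    rw [h3, integral_const_mul, hint, hκ2, mul_inv_cancel_left₀ (by positivity)]
    intro y hy
    rw [(hχ0 y hy).1]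
    ring
  · have h3 : ⟪(A U).snd, (A W).snd⟫ = ∫ x in Ω', (κ ^ 2 * r ^ 2) *
        Ω.indicator (fun y => ⟪χ y • U.snd y + U.fst y • gradient χ y,
          χ y • W.snd y + W.fst y • gradient χ y⟫) (Φ x) := by
      rw [L2.inner_def]
      refine integral_congr_ae ?_
      filter_upwards [(hA U).2, (hA W).2] with x hx1 hx2
      rw [hx1, hx2, real_inner_smul_left, real_inner_smul_right, R.symm.inner_map_map]
      by_cases hx : Φ x ∈ Ω
      · simp only [hx, indicator_of_mem]
        ring
      · simp [hx]
    rw [h3, integral_const_mul, hint, hκ2, mul_comm (r ^ _), mul_assoc,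
      mul_inv_cancel_left₀ (by positivity)]
    intro y hy
    rw [(hχ0 y hy).1, (hχ0 y hy).2]
    simp

/-- Multiplication by a multiplier on `H̊¹(Ω; S)`. -/
lemma exists_multiplication {Ω : Set F} (S : Set F) (hΩ : MeasurableSet Ω) {χ : F → ℝ} {C : ℝ}
    (hχ : IsMultiplier χ C) :
    ∃ A : L2Pair Ω →L[ℝ] L2Pair Ω, (∀ U : L2Pair Ω,
      ((A U).fst =ᵐ[volume.restrict Ω] fun x => χ x * U.fst x) ∧
      ((A U).snd =ᵐ[volume.restrict Ω] fun x => χ x • U.snd x + U.fst x • gradient χ x)) ∧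
      (∀ U ∈ sobolev Ω S, A U ∈ sobolev Ω S) ∧
      (∀ U W : L2Pair Ω, ⟪(A U).fst, (A W).fst⟫ = ∫ y in Ω, χ y ^ 2 * (U.fst y * W.fst y)) ∧
      (∀ U W : L2Pair Ω, ⟪(A U).snd, (A W).snd⟫ = ∫ y in Ω,
        ⟪χ y • U.snd y + U.fst y • gradient χ y, χ y • W.snd y + W.fst y • gradient χ y⟫) := by
  have hid : ∀ x, similarity (0 : F) one_pos (LinearIsometryEquiv.refl ℝ F) x = x := by simp
  obtain ⟨A, hA1, hA2, hA3, hA4⟩ := exists_transport (Ω := Ω) (Ω' := Ω) (S := S) (S' := S) hΩ hΩ hχ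
    (0 : F) one_pos (LinearIsometryEquiv.refl ℝ F) (fun x _ => by rw [hid])
    (fun x hx _ => by rwa [hid])
  refine ⟨A, fun U => ⟨?_, ?_⟩, hA2, hA3, fun U W => by rw [hA4, one_pow, one_mul]⟩
  · filter_upwards [(hA1 U).1, ae_restrict_mem hΩ] with x hx hxΩ
    rw [hx, hid, indicator_of_mem hxΩ]
    simp
  · filter_upwards [(hA1 U).2, ae_restrict_mem hΩ] with x hx hxΩ
    rw [hx, hid, indicator_of_mem hxΩ, one_pow, Real.sqrt_one, one_mul, one_smul]
    rfl

lemma IsMultiplier.sq {χ : F → ℝ} {C : ℝ} (hχ : IsMultiplier χ C) :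
    IsMultiplier (fun x => χ x ^ 2) (C ^ 2 + 2 * C ^ 2) := by
  have hd : Differentiable ℝ χ := hχ.smooth.differentiable (by simp)
  refine ⟨hχ.smooth.pow 2, fun x => ?_, fun x => ?_⟩
  · rw [abs_pow]
    have := pow_le_pow_left₀ (abs_nonneg _) (hχ.abs_le x) 2
    nlinarith [sq_nonneg C]
  · have h1 : gradient (fun x => χ x ^ 2) x = (2 * χ x) • gradient χ x := by
      simp only [pow_two]
      rw [gradient_mul (hd x) (hd x), ← add_smul, two_mul]
    rw [h1, norm_smul, norm_mul, Real.norm_two, Real.norm_eq_abs]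
    have h2 := mul_le_mul (hχ.abs_le x) (hχ.norm_gradient_le x) (norm_nonneg _)
      ((abs_nonneg _).trans (hχ.abs_le x))
    nlinarith [sq_nonneg C]

lemma integrable_mul_fst {Ω : Set F} (U W : L2Pair Ω) :
    IntegrableOn (fun y => U.fst y * W.fst y) Ω := by
  have := L2.integrable_inner (𝕜 := ℝ) U.fst W.fst
  refine this.congr (ae_of_all _ fun x => ?_)
  simp [mul_comm]

lemma integrable_bdd_mul_fst {Ω : Set F} (U W : L2Pair Ω) {f : F → ℝ} (hf : Continuous f) {D : ℝ}
    (hD : ∀ x, |f x| ≤ D) : IntegrableOn (fun y => f y * (U.fst y * W.fst y)) Ω :=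
  (integrable_mul_fst U W).bdd_mul hf.aestronglyMeasurable (ae_of_all _ hD)

/-- The localization formula for eigenvectors: the energy form of `χ U` and `χ W` contains no
gradients of `U` and `W`. It is the mean of the two weak equations, tested with `χ² W` and `χ² U`. -/
lemma inner_localized {Ω S : Set F} (hΩ : MeasurableSet Ω) {χ : F → ℝ} {C : ℝ}
    (hχ : IsMultiplier χ C) {s t : ℝ} {U W : L2Pair Ω} (hU : U ∈ eigenspace Ω S s)
    (hW : W ∈ eigenspace Ω S t) :
    ∫ y in Ω, ⟪χ y • U.snd y + U.fst y • gradient χ y, χ y • W.snd y + W.fst y • gradient χ y⟫ =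
      (s + t) / 2 * (∫ y in Ω, χ y ^ 2 * (U.fst y * W.fst y)) +
        ∫ y in Ω, ‖gradient χ y‖ ^ 2 * (U.fst y * W.fst y) := by
  obtain ⟨A, hA1, hA2, -, -⟩ := exists_multiplication S hΩ hχ.sq
  have hd : Differentiable ℝ χ := hχ.smooth.differentiable (by simp)
  have hg : ∀ x, gradient (fun x => χ x ^ 2) x = (2 * χ x) • gradient χ x := fun x => by
    simp only [pow_two]
    rw [gradient_mul (hd x) (hd x), ← add_smul, two_mul]
  have key : ∀ {s : ℝ} {U W : L2Pair Ω}, U ∈ eigenspace Ω S s → W ∈ sobolev Ω S →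
      IntegrableOn (fun y => ⟪U.snd y, χ y ^ 2 • W.snd y + W.fst y • (2 * χ y) • gradient χ y⟫) Ω ∧
      ∫ y in Ω, ⟪U.snd y, χ y ^ 2 • W.snd y + W.fst y • (2 * χ y) • gradient χ y⟫ =
        s * ∫ y in Ω, χ y ^ 2 * (U.fst y * W.fst y) := by
    intro s U W hU hW
    have h1 := hU.2 _ (hA2 W hW)
    have h2 : (fun y => ⟪U.snd y, (A W).snd y⟫) =ᵐ[volume.restrict Ω]
        fun y => ⟪U.snd y, χ y ^ 2 • W.snd y + W.fst y • (2 * χ y) • gradient χ y⟫ := by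
      filter_upwards [(hA1 W).2] with y hy
      rw [hy, hg]
    refine ⟨(L2.integrable_inner (𝕜 := ℝ) U.snd (A W).snd).congr h2, ?_⟩
    rw [← integral_congr_ae h2, ← L2.inner_def, h1, L2.inner_def]
    congr 1
    refine integral_congr_ae ?_
    filter_upwards [(hA1 W).1] with y hy
    rw [hy, inner_eq_mul_real]
    ring
  obtain ⟨i1, e1⟩ := key hU hW.1
  obtain ⟨i2, e2⟩ := key hW hU.1
  have i3 : IntegrableOn (fun y => ‖gradient χ y‖ ^ 2 * (U.fst y * W.fst y)) Ω :=
    integrable_bdd_mul_fst U W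
      ((hχ.smooth.continuous_gradient (by exact_mod_cast le_top)).norm.pow 2) (D := C ^ 2) fun x => by
        rw [abs_of_nonneg (sq_nonneg _)]
        exact pow_le_pow_left₀ (norm_nonneg _) (hχ.norm_gradient_le x) 2
  have h3 : ∫ y in Ω, χ y ^ 2 * (W.fst y * U.fst y) = ∫ y in Ω, χ y ^ 2 * (U.fst y * W.fst y) := by
    simp only [mul_comm (WithLp.fst W _)]
  rw [h3] at e2
  have h4 : (s + t) / 2 * (∫ y in Ω, χ y ^ 2 * (U.fst y * W.fst y)) =
      1 / 2 * (∫ y in Ω, ⟪U.snd y, χ y ^ 2 • W.snd y + W.fst y • (2 * χ y) • gradient χ y⟫) +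
      1 / 2 * ∫ y in Ω, ⟪W.snd y, χ y ^ 2 • U.snd y + U.fst y • (2 * χ y) • gradient χ y⟫ := by
    rw [e1, e2]
    ring
  have i4 : IntegrableOn (fun y =>
      1 / 2 * ⟪U.snd y, χ y ^ 2 • W.snd y + W.fst y • (2 * χ y) • gradient χ y⟫ +
      1 / 2 * ⟪W.snd y, χ y ^ 2 • U.snd y + U.fst y • (2 * χ y) • gradient χ y⟫) Ω :=
    (i1.const_mul _).add (i2.const_mul _)
  rw [h4, ← integral_const_mul, ← integral_const_mul,
    ← integral_add (i1.const_mul _) (i2.const_mul _), ← integral_add i4 i3]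
  refine integral_congr_ae (ae_of_all _ fun y => ?_)
  simp only [inner_add_left, inner_add_right, real_inner_smul_left, real_inner_smul_right,
    real_inner_self_eq_norm_sq, real_inner_comm (WithLp.snd U y) (WithLp.snd W y),
    real_inner_comm (gradient χ y) (WithLp.snd W y), real_inner_comm (gradient χ y) (WithLp.snd U y)]
  ring

end Transport

/-! ### Approximation by averages over small cells -/

section FiniteRank

lemma sq_lintegral_le {α : Type*} [MeasurableSpace α] (μ : Measure α) {f : α → ℝ≥0∞}
    (hf : AEMeasurable f μ) : (∫⁻ x, f x ∂μ) ^ 2 ≤ μ univ * ∫⁻ x, f x ^ 2 ∂μ := by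
  have h1 := ENNReal.lintegral_mul_le_Lp_mul_Lq μ Real.HolderConjugate.two_two hf
    (aemeasurable_const (b := (1 : ℝ≥0∞)))
  simp only [Pi.mul_apply, mul_one, ENNReal.rpow_ofNat, one_pow, lintegral_const, one_mul] at h1
  calc _ ≤ ((∫⁻ x, f x ^ 2 ∂μ) ^ (1 / (2 : ℝ)) * (μ univ) ^ (1 / (2 : ℝ))) ^ 2 :=
        pow_le_pow_left' h1 2
    _ = _ := by
        rw [mul_pow, ← ENNReal.rpow_natCast, ← ENNReal.rpow_natCast, ← ENNReal.rpow_mul,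
          ← ENNReal.rpow_mul]
        norm_num [mul_comm]

variable {F : Type} [NormedAddCommGroup F] [InnerProductSpace ℝ F] [FiniteDimensional ℝ F]
  [MeasurableSpace F] [BorelSpace F]

/-- The `L²` norm of a difference quotient is bounded by that of the derivative, on a set that the
translation maps into itself. -/
lemma lintegral_translate_sub_le {D : Set F} (hD : IsOpen D) {f : F → ℝ} (hf : ContDiffOn ℝ 1 f D)
    {y : F} (hy : ∀ x ∈ D, ∀ t : ℝ, 0 ≤ t → t ≤ 1 → x + t • y ∈ D) :
    ∫⁻ x in D, ‖f (x + y) - f x‖ₑ ^ 2 ≤ ‖y‖ₑ ^ 2 * ∫⁻ x in D, ‖fderiv ℝ f x‖ₑ ^ 2 := by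
  have hm : Measurable fun p : F × ℝ => ‖fderiv ℝ f (p.1 + p.2 • y)‖ₑ ^ 2 :=
    (((measurable_fderiv ℝ f).comp (by fun_prop : Measurable fun p : F × ℝ => p.1 + p.2 • y)).enorm).pow_const 2
  have hpt : ∀ x ∈ D, ‖f (x + y) - f x‖ₑ ^ 2 ≤
      ‖y‖ₑ ^ 2 * ∫⁻ t in Ioc (0 : ℝ) 1, ‖fderiv ℝ f (x + t • y)‖ₑ ^ 2 := by
    intro x hx
    have hmem : ∀ t ∈ Icc (0 : ℝ) 1, x + t • y ∈ D := fun t ht => hy x hx t ht.1 ht.2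
    have hder : ∀ t ∈ uIcc (0 : ℝ) 1,
        HasDerivAt (fun t : ℝ => f (x + t • y)) (fderiv ℝ f (x + t • y) y) t := by
      intro t ht
      rw [uIcc_of_le zero_le_one] at ht
      have h1 : DifferentiableAt ℝ f (x + t • y) :=
        (hf.differentiableOn one_ne_zero).differentiableAt (hD.mem_nhds (hmem t ht))
      have h2 : HasDerivAt (fun t : ℝ => x + t • y) y t := by
        simpa using ((hasDerivAt_id t).smul_const y).const_add x
      exact h1.hasFDerivAt.comp_hasDerivAt t h2
    have hcont : ContinuousOn (fun t : ℝ => fderiv ℝ f (x + t • y) y) (uIcc 0 1) := by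
      rw [uIcc_of_le zero_le_one]
      refine ContinuousOn.clm_apply ?_ continuousOn_const
      exact (hf.continuousOn_fderiv_of_isOpen hD le_rfl).comp (by fun_prop) hmem
    have h3 := intervalIntegral.integral_eq_sub_of_hasDerivAt hder hcont.intervalIntegrable
    simp only [one_smul, zero_smul, add_zero] at h3
    rw [← h3, intervalIntegral.integral_of_le zero_le_one]
    calc _ ≤ (∫⁻ t in Ioc (0 : ℝ) 1, ‖fderiv ℝ f (x + t • y)‖ₑ * ‖y‖ₑ) ^ 2 := by
          refine pow_le_pow_left' ((enorm_integral_le_lintegral_enorm _).trans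
            (lintegral_mono fun t => ?_)) 2
          exact (fderiv ℝ f (x + t • y)).le_opENorm y
      _ = ‖y‖ₑ ^ 2 * (∫⁻ t in Ioc (0 : ℝ) 1, ‖fderiv ℝ f (x + t • y)‖ₑ) ^ 2 := by
          rw [lintegral_mul_const' _ _ enorm_ne_top, mul_pow, mul_comm]
      _ ≤ _ := by
          gcongr
          refine (sq_lintegral_le _ ?_).trans ?_
          · exact (((measurable_fderiv ℝ f).comp
              (by fun_prop : Measurable fun t : ℝ => x + t • y)).enorm).aemeasurable
          · simp
  calc ∫⁻ x in D, ‖f (x + y) - f x‖ₑ ^ 2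
      ≤ ∫⁻ x in D, ‖y‖ₑ ^ 2 * ∫⁻ t in Ioc (0 : ℝ) 1, ‖fderiv ℝ f (x + t • y)‖ₑ ^ 2 :=
        setLIntegral_mono' hD.measurableSet hpt
    _ = ‖y‖ₑ ^ 2 * ∫⁻ t in Ioc (0 : ℝ) 1, ∫⁻ x in D, ‖fderiv ℝ f (x + t • y)‖ₑ ^ 2 := by
        rw [lintegral_const_mul' _ _ (ENNReal.pow_ne_top enorm_ne_top),
          lintegral_lintegral_swap hm.aemeasurable]
    _ ≤ ‖y‖ₑ ^ 2 * ∫⁻ t in Ioc (0 : ℝ) 1, ∫⁻ x in D, ‖fderiv ℝ f x‖ₑ ^ 2 := by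
        gcongr ‖y‖ₑ ^ 2 * ?_
        refine setLIntegral_mono' measurableSet_Ioc fun t ht => ?_
        rw [← lintegral_indicator hD.measurableSet,
          ← lintegral_indicator (f := fun x => ‖fderiv ℝ f x‖ₑ ^ 2) hD.measurableSet,
          ← lintegral_add_right_eq_self
            (fun x => D.indicator (fun x => ‖fderiv ℝ f x‖ₑ ^ 2) x) (t • y)]
        refine lintegral_mono fun x => ?_
        by_cases hx : x ∈ D
        · rw [indicator_of_mem hx, indicator_of_mem (hy x hx t ht.1.le ht.2)]
        · rw [indicator_of_notMem hx]
          exact zero_le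
    _ = _ := by simp

/-- On functions with bounded support in a domain with a cone of admissible translations, the `L²`
norm is bounded by a small multiple of the norm of the derivative and finitely many integrals. -/
lemma exists_finite_rank_bound {D : Set F} (hD : IsOpen D) {v : F}
    (hv : ∀ x ∈ D, ∀ w ∈ Metric.ball v 2, ∀ s : ℝ, 0 ≤ s → x + s • w ∈ D)
    {B : Set F} (hB : Bornology.IsBounded B) {ε : ℝ} (hε : 0 < ε) :
    ∃ (k : ℕ) (P : Fin k → Set F) (C : ℝ≥0), (∀ i, MeasurableSet (P i) ∧ volume (P i) ≠ ∞) ∧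
      ∀ f : F → ℝ, Measurable f → ContDiffOn ℝ 1 f D → MemLp f 2 (volume.restrict D) →
        (∀ x ∈ D, x ∉ B → f x = 0) →
        ∫⁻ x in D, ‖f x‖ₑ ^ 2 ≤ ENNReal.ofReal (ε ^ 2 * (2 * 2 ^ Module.finrank ℝ F * (‖v‖ + 2) ^ 2)) *
            (∫⁻ x in D, ‖fderiv ℝ f x‖ₑ ^ 2) + C * ∑ i, ‖∫ x in P i ∩ D, f x‖ₑ ^ 2 := by
  obtain ⟨t, htc⟩ : ∃ t : Finset F, B ⊆ ⋃ x ∈ t, Metric.ball x ε := by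
    obtain ⟨t, ht, hBt⟩ := Metric.totallyBounded_iff.1
      (hB.isCompact_closure.totallyBounded.subset subset_closure) ε hε
    exact ⟨ht.toFinset, by simpa using hBt⟩
  -- disjoint cells `Q i` of size `ε` that cover `B`
  set k := t.card
  let c : Fin k → F := fun i => (t.equivFin.symm i : F)
  let Q : Fin k → Set F := disjointed fun i => Metric.ball (c i) ε
  have hQm : ∀ i, MeasurableSet (Q i) := fun i => by
    simp only [Q, disjointed_apply, Finset.sup_eq_iSup, iSup_eq_iUnion]
    exact Metric.isOpen_ball.measurableSet.diff
      (Finset.measurableSet_biUnion _ fun j _ => Metric.isOpen_ball.measurableSet)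
  have hQs : ∀ i, Q i ⊆ Metric.ball (c i) ε := fun i => disjointed_subset _ i
  have hQd : Pairwise fun i j => Disjoint (Q i ∩ D) (Q j ∩ D) := fun i j hij =>
    ((disjoint_disjointed _) hij).mono inter_subset_left inter_subset_left
  have hBQ : B ⊆ ⋃ i, Q i := by
    rw [show (⋃ i, Q i) = ⋃ i, Metric.ball (c i) ε from iUnion_disjointed]
    intro x hx
    obtain ⟨z, hz, hxz⟩ := mem_iUnion₂.1 (htc hx)
    refine mem_iUnion.2 ⟨t.equivFin ⟨z, hz⟩, ?_⟩
    simpa [c] using hxz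
  -- the cell may stick out of `D`, but a ball that is shifted by `ε v` lies in `D` as soon as the
  -- cell meets `D`
  let P : Fin k → Set F := fun i => Metric.ball (c i + ε • v) ε
  set m : ℝ≥0∞ := volume (Metric.ball (0 : F) ε) with hm
  have hm0 : m ≠ 0 := (Metric.measure_ball_pos _ _ hε).ne'
  have hmt : m ≠ ∞ := measure_ball_lt_top.ne
  have hPm : ∀ i, volume (P i) = m := fun i => Measure.addHaar_ball_center _ _ _
  have hCt : 2 * (m ^ 2)⁻¹ * m ≠ ∞ := by
    refine ENNReal.mul_ne_top (ENNReal.mul_ne_top (by simp) ?_) hmt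
    exact ENNReal.inv_ne_top.2 (pow_ne_zero 2 hm0)
  refine ⟨k, P, (2 * (m ^ 2)⁻¹ * m).toNNReal, fun i => ⟨Metric.isOpen_ball.measurableSet, by
    rw [hPm]; exact hmt⟩, fun f hfm hfD hf2 hfB => ?_⟩
  rw [ENNReal.coe_toNNReal hCt]
  set K : Set F := Metric.ball (ε • v) (2 * ε) with hK
  -- the value at a point of a cell against the mean over the shifted ball
  have hpt : ∀ i, ∀ x ∈ Q i ∩ D, m ^ 2 * ‖f x‖ₑ ^ 2 ≤
      2 * ‖∫ x in P i ∩ D, f x‖ₑ ^ 2 + 2 * m * ∫⁻ y in K, ‖f (x + y) - f x‖ₑ ^ 2 := by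
    rintro i x ⟨hxQ, hxD⟩
    have hPK : ∀ z ∈ P i, z - x ∈ K := by
      intro z hz
      have h1 := hQs i hxQ
      rw [Metric.mem_ball, dist_eq_norm] at h1
      have h2 : ‖z - (c i + ε • v)‖ < ε := by simpa [P, dist_eq_norm] using hz
      rw [hK, Metric.mem_ball, dist_eq_norm]
      calc ‖z - x - ε • v‖ = ‖(z - (c i + ε • v)) - (x - c i)‖ := by congr 1; abel
        _ ≤ _ := norm_sub_le _ _
        _ < 2 * ε := by linarith
    have hKD : ∀ y ∈ K, x + y ∈ D := by
      intro y hy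
      have h1 : ε⁻¹ • y ∈ Metric.ball v 2 := by
        rw [hK, Metric.mem_ball, dist_eq_norm] at hy
        rw [Metric.mem_ball, dist_eq_norm]
        have h2 : ε⁻¹ • y - v = ε⁻¹ • (y - ε • v) := by
          rw [smul_sub, inv_smul_smul₀ hε.ne']
        rw [h2, norm_smul, norm_inv, Real.norm_of_nonneg hε.le, inv_mul_lt_iff₀ hε]
        linarith
      have := hv x hxD _ h1 ε hε.le
      rwa [smul_inv_smul₀ hε.ne'] at this
    have hPD : P i ⊆ D := fun z hz => by
      simpa using hKD _ (hPK z hz)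
    rw [inter_eq_self_of_subset_left hPD]
    have hfin : IsFiniteMeasure (volume.restrict (P i)) := ⟨by
      rw [Measure.restrict_apply_univ, hPm]; exact hmt.lt_top⟩
    have hint : IntegrableOn f (P i) :=
      (hf2.mono_measure (Measure.restrict_mono hPD le_rfl)).integrable one_le_two
    have h1 : m * ‖f x‖ₑ ≤ ‖∫ x in P i, f x‖ₑ + ∫⁻ z in P i, ‖f z - f x‖ₑ := by
      have h2 : (volume (P i)).toReal • f x = (∫ z in P i, f z) - ∫ z in P i, (f z - f x) := by
        rw [integral_sub hint (integrable_const _), setIntegral_const, Measure.real]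
        simp
      have h3 : m * ‖f x‖ₑ = ‖(volume (P i)).toReal • f x‖ₑ := by
        rw [enorm_smul, Real.enorm_of_nonneg ENNReal.toReal_nonneg, ENNReal.ofReal_toReal, hPm]
        rw [hPm]; exact hmt
      rw [h3, h2]
      exact (enorm_sub_le).trans (add_le_add le_rfl (enorm_integral_le_lintegral_enorm _))
    have h4 : (∫⁻ z in P i, ‖f z - f x‖ₑ) ^ 2 ≤ m * ∫⁻ y in K, ‖f (x + y) - f x‖ₑ ^ 2 := by
      refine (sq_lintegral_le _ (hfm.sub_const _).enorm.aemeasurable).trans ?_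
      rw [Measure.restrict_apply_univ, hPm]
      gcongr m * ?_
      rw [← lintegral_indicator Metric.isOpen_ball.measurableSet,
        ← lintegral_indicator Metric.isOpen_ball.measurableSet,
        ← lintegral_add_left_eq_self (fun z => (P i).indicator _ z) x]
      refine lintegral_mono fun y => ?_
      by_cases hy : x + y ∈ P i
      · rw [indicator_of_mem hy, indicator_of_mem (show y ∈ K by simpa using hPK _ hy)]
      · rw [indicator_of_notMem hy]
        exact zero_le
    have hsq : ∀ a b : ℝ≥0∞, (a + b) ^ 2 ≤ 2 * a ^ 2 + 2 * b ^ 2 := fun a b => by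
      have := ENNReal.rpow_add_le_mul_rpow_add_rpow a b (p := 2) one_le_two
      norm_num at this
      rw [← mul_add]
      exact_mod_cast this
    calc m ^ 2 * ‖f x‖ₑ ^ 2 = (m * ‖f x‖ₑ) ^ 2 := by rw [mul_pow]
      _ ≤ _ := pow_le_pow_left' h1 2
      _ ≤ _ := hsq _ _
      _ ≤ _ := by
        rw [mul_assoc 2 m]
        gcongr
  have hmeas2 : Measurable fun p : F × F => ‖f (p.1 + p.2) - f p.1‖ₑ ^ 2 :=
    (((hfm.comp (measurable_fst.add measurable_snd)).sub (hfm.comp measurable_fst)).enorm).pow_const 2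
  have hKmeas : MeasurableSet K := Metric.isOpen_ball.measurableSet
  -- the double integral of the differences
  have hdouble : ∫⁻ x in D, ∫⁻ y in K, ‖f (x + y) - f x‖ₑ ^ 2 ≤
      volume K * (ENNReal.ofReal (ε ^ 2 * (‖v‖ + 2) ^ 2) * ∫⁻ x in D, ‖fderiv ℝ f x‖ₑ ^ 2) := by
    rw [lintegral_lintegral_swap hmeas2.aemeasurable]
    calc _ ≤ ∫⁻ y in K, ENNReal.ofReal (ε ^ 2 * (‖v‖ + 2) ^ 2) * ∫⁻ x in D, ‖fderiv ℝ f x‖ₑ ^ 2 := by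
          refine setLIntegral_mono' hKmeas fun y hy => ?_
          rw [hK, Metric.mem_ball, dist_eq_norm] at hy
          refine (lintegral_translate_sub_le hD hfD fun x hx s hs0 hs1 => ?_).trans ?_
          · have h1 : ε⁻¹ • y ∈ Metric.ball v 2 := by
              rw [Metric.mem_ball, dist_eq_norm]
              have h2 : ε⁻¹ • y - v = ε⁻¹ • (y - ε • v) := by
                rw [smul_sub, inv_smul_smul₀ hε.ne']
              rw [h2, norm_smul, norm_inv, Real.norm_of_nonneg hε.le, inv_mul_lt_iff₀ hε]
              linarith
            have := hv x hx _ h1 (s * ε) (by positivity)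
            rwa [mul_smul, smul_inv_smul₀ hε.ne'] at this
          · gcongr
            rw [← ofReal_norm, ← ENNReal.ofReal_pow (norm_nonneg _), ← mul_pow]
            refine ENNReal.ofReal_le_ofReal (pow_le_pow_left₀ (norm_nonneg _) ?_ 2)
            calc ‖y‖ = ‖ε • v + (y - ε • v)‖ := by congr 1; abel
              _ ≤ ‖ε • v‖ + ‖y - ε • v‖ := norm_add_le _ _
              _ ≤ ε * ‖v‖ + 2 * ε := by
                rw [norm_smul, Real.norm_of_nonneg hε.le]
                linarith
              _ = _ := by ring
      _ = _ := by rw [setLIntegral_const, mul_comm]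
  have hKvol : volume K = ENNReal.ofReal (2 ^ Module.finrank ℝ F) * m := by
    rw [hK, Measure.addHaar_ball_mul_of_pos _ _ two_pos]
  have hsum : m ^ 2 * ∫⁻ x in D, ‖f x‖ₑ ^ 2 ≤ 2 * m * ∑ i, ‖∫ x in P i ∩ D, f x‖ₑ ^ 2 +
      2 * m * ∫⁻ x in D, ∫⁻ y in K, ‖f (x + y) - f x‖ₑ ^ 2 := by
    have hQDm : ∀ i, MeasurableSet (Q i ∩ D) := fun i => (hQm i).inter hD.measurableSet
    have hU : ∀ g : F → ℝ≥0∞, ∫⁻ x in ⋃ i, Q i ∩ D, g x = ∑ i, ∫⁻ x in Q i ∩ D, g x := fun g => by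
      rw [lintegral_iUnion hQDm hQd, tsum_fintype]
    calc m ^ 2 * ∫⁻ x in D, ‖f x‖ₑ ^ 2
        ≤ m ^ 2 * ∫⁻ x in ⋃ i, Q i ∩ D, ‖f x‖ₑ ^ 2 := by
          gcongr m ^ 2 * ?_
          rw [← lintegral_indicator hD.measurableSet,
            ← lintegral_indicator (MeasurableSet.iUnion hQDm)]
          refine lintegral_mono fun x => ?_
          by_cases hx : x ∈ D
          · by_cases hxB : x ∈ B
            · obtain ⟨i, hi⟩ := mem_iUnion.1 (hBQ hxB)
              rw [indicator_of_mem hx, indicator_of_mem (s := ⋃ i, Q i ∩ D) (mem_iUnion.2 ⟨i, hi, hx⟩)]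
            · rw [indicator_of_mem hx, hfB x hx hxB]
              simp
          · rw [indicator_of_notMem hx]
            exact zero_le
      _ = ∑ i, ∫⁻ x in Q i ∩ D, m ^ 2 * ‖f x‖ₑ ^ 2 := by
          rw [hU, Finset.mul_sum]
          simp_rw [lintegral_const_mul' _ _ (ENNReal.pow_ne_top hmt)]
      _ ≤ ∑ i, ∫⁻ x in Q i ∩ D, (2 * ‖∫ x in P i ∩ D, f x‖ₑ ^ 2 +
            2 * m * ∫⁻ y in K, ‖f (x + y) - f x‖ₑ ^ 2) :=
          Finset.sum_le_sum fun i _ => setLIntegral_mono' (hQDm i) (hpt i)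
      _ = ∑ i, (2 * ‖∫ x in P i ∩ D, f x‖ₑ ^ 2 * volume (Q i ∩ D) +
            2 * m * ∫⁻ x in Q i ∩ D, ∫⁻ y in K, ‖f (x + y) - f x‖ₑ ^ 2) := by
          refine Finset.sum_congr rfl fun i _ => ?_
          rw [lintegral_add_left measurable_const, setLIntegral_const,
            lintegral_const_mul' _ _ (ENNReal.mul_ne_top (by simp) hmt)]
      _ ≤ ∑ i, (2 * m * ‖∫ x in P i ∩ D, f x‖ₑ ^ 2 +
            2 * m * ∫⁻ x in Q i ∩ D, ∫⁻ y in K, ‖f (x + y) - f x‖ₑ ^ 2) := by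
          refine Finset.sum_le_sum fun i _ => add_le_add ?_ le_rfl
          rw [mul_right_comm]
          gcongr
          refine (measure_mono (inter_subset_left.trans (hQs i))).trans_eq ?_
          exact Measure.addHaar_ball_center _ _ _
      _ = 2 * m * ∑ i, ‖∫ x in P i ∩ D, f x‖ₑ ^ 2 +
            2 * m * ∫⁻ x in ⋃ i, Q i ∩ D, ∫⁻ y in K, ‖f (x + y) - f x‖ₑ ^ 2 := by
          rw [hU, Finset.sum_add_distrib, Finset.mul_sum, Finset.mul_sum]
      _ ≤ _ := by
          gcongr
          exact iUnion_subset fun i => inter_subset_right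
  have hinv : (m ^ 2)⁻¹ * m ^ 2 = 1 :=
    ENNReal.inv_mul_cancel (pow_ne_zero 2 hm0) (ENNReal.pow_ne_top hmt)
  calc ∫⁻ x in D, ‖f x‖ₑ ^ 2 = (m ^ 2)⁻¹ * (m ^ 2 * ∫⁻ x in D, ‖f x‖ₑ ^ 2) := by
        rw [← mul_assoc, hinv, one_mul]
    _ ≤ (m ^ 2)⁻¹ * (2 * m * ∑ i, ‖∫ x in P i ∩ D, f x‖ₑ ^ 2 + 2 * m *
          (ENNReal.ofReal (2 ^ Module.finrank ℝ F) * m *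
          (ENNReal.ofReal (ε ^ 2 * (‖v‖ + 2) ^ 2) * ∫⁻ x in D, ‖fderiv ℝ f x‖ₑ ^ 2))) := by
        rw [← hKvol]
        gcongr
        exact hsum.trans (add_le_add le_rfl (mul_le_mul_right hdouble _))
    _ = ((m ^ 2)⁻¹ * m ^ 2) * (2 * ENNReal.ofReal (2 ^ Module.finrank ℝ F) *
          ENNReal.ofReal (ε ^ 2 * (‖v‖ + 2) ^ 2)) * (∫⁻ x in D, ‖fderiv ℝ f x‖ₑ ^ 2) +
          2 * (m ^ 2)⁻¹ * m * ∑ i, ‖∫ x in P i ∩ D, f x‖ₑ ^ 2 := by ring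
    _ = _ := by
        rw [hinv, one_mul]
        congr 2
        rw [← ENNReal.ofReal_ofNat 2, ← ENNReal.ofReal_mul (by norm_num),
          ← ENNReal.ofReal_mul (by positivity)]
        congr 1
        ring

end FiniteRank

/-! ### Compactness in the interior, in terms of finitely many functionals -/

section Compactness

lemma lintegral_enorm_sq_eq {α G : Type*} [MeasurableSpace α] [NormedAddCommGroup G]
    {μ : Measure α} (u : Lp G 2 μ) : ∫⁻ x, ‖u x‖ₑ ^ 2 ∂μ = ENNReal.ofReal (‖u‖ ^ 2) := by
  have h := eLpNorm_eq_lintegral_rpow_enorm_toReal (f := u) (μ := μ) two_ne_zero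
    ENNReal.ofNat_ne_top
  simp only [ENNReal.toReal_ofNat, ENNReal.rpow_ofNat] at h
  rw [Lp.norm_def, ENNReal.ofReal_pow ENNReal.toReal_nonneg,
    ENNReal.ofReal_toReal (Lp.eLpNorm_ne_top u), h, ← ENNReal.rpow_natCast, ← ENNReal.rpow_mul]
  norm_num

/-- A cut-off test function, extended by zero outside `Ω`, vanishes near the points of `D` outside
`Ω` if the part of the boundary of `Ω` in `D` near the support of `χ` lies in `closure S`. -/
lemma indicator_eventuallyEq_zero {F : Type} [NormedAddCommGroup F] {Ω S D : Set F}
    (hΩ : IsOpen Ω) {χ φ : F → ℝ}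
    (h1 : ∀ x ∈ D, x ∈ frontier Ω → x ∈ tsupport χ → x ∈ closure S)
    (hφ : Disjoint (tsupport φ) (closure S)) {x : F} (hx : x ∈ D) (hxΩ : x ∉ Ω) :
    Ω.indicator (fun y => χ y * φ y) =ᶠ[𝓝 x] fun _ => 0 := by
  by_cases hxc : x ∈ closure Ω
  · have hxf : x ∈ frontier Ω := by
      rw [frontier, hΩ.interior_eq]
      exact ⟨hxc, hxΩ⟩
    by_cases hxχ : x ∈ tsupport χ
    · have hxφ : x ∉ tsupport φ := fun h => Set.disjoint_left.1 hφ h (h1 x hx hxf hxχ)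
      filter_upwards [notMem_tsupport_iff_eventuallyEq.1 hxφ] with y hy
      exact indicator_apply_eq_zero.2 fun _ => by rw [hy]; simp
    · filter_upwards [notMem_tsupport_iff_eventuallyEq.1 hxχ] with y hy
      exact indicator_apply_eq_zero.2 fun _ => by rw [hy]; simp
  · filter_upwards [isClosed_closure.isOpen_compl.mem_nhds hxc] with y hy
    exact indicator_of_notMem (fun h => hy (subset_closure h)) _

lemma indicator_eventuallyEq {F : Type} [NormedAddCommGroup F] {Ω : Set F} (hΩ : IsOpen Ω)
    (ψ : F → ℝ) {x : F} (hx : x ∈ Ω) :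
    Ω.indicator ψ =ᶠ[𝓝 x] ψ := by
  filter_upwards [hΩ.mem_nhds hx] with y hy
  exact indicator_of_mem hy _

variable {F : Type} [NormedAddCommGroup F] [InnerProductSpace ℝ F] [FiniteDimensional ℝ F]

lemma enorm_fderiv_eq (f : F → ℝ) (x : F) : ‖fderiv ℝ f x‖ₑ = ‖gradient f x‖ₑ := by
  rw [← ofReal_norm, ← ofReal_norm, gradient, LinearIsometryEquiv.norm_map]

/-- Extension by zero from `Ω` to the larger domain `D` keeps cut-off test functions smooth. -/
lemma contDiffOn_indicator {Ω S D : Set F} (hΩ : IsOpen Ω) {χ φ : F → ℝ}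
    (hχ : ContDiff ℝ (⊤ : ℕ∞) χ) (hφs : ContDiff ℝ (⊤ : ℕ∞) φ)
    (h1 : ∀ x ∈ D, x ∈ frontier Ω → x ∈ tsupport χ → x ∈ closure S)
    (hφ : Disjoint (tsupport φ) (closure S)) :
    ContDiffOn ℝ 1 (Ω.indicator fun y => χ y * φ y) D := by
  intro x hx
  refine ContDiffAt.contDiffWithinAt ?_
  by_cases hxΩ : x ∈ Ω
  · exact (((hχ.mul hφs).of_le (by exact_mod_cast le_top)).contDiffAt).congr_of_eventuallyEq
      (indicator_eventuallyEq hΩ _ hxΩ)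
  · exact contDiffAt_const.congr_of_eventuallyEq (indicator_eventuallyEq_zero hΩ h1 hφ hx hxΩ)

variable [MeasurableSpace F] [BorelSpace F]

lemma lintegral_fderiv_indicator_le {Ω S D : Set F} (hΩ : IsOpen Ω) (hD : IsOpen D) {χ φ : F → ℝ}
    (h1 : ∀ x ∈ D, x ∈ frontier Ω → x ∈ tsupport χ → x ∈ closure S)
    (hφ : Disjoint (tsupport φ) (closure S)) :
    ∫⁻ x in D, ‖fderiv ℝ (Ω.indicator fun y => χ y * φ y) x‖ₑ ^ 2 ≤
      ∫⁻ x in Ω, ‖gradient (fun y => χ y * φ y) x‖ₑ ^ 2 := by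
  rw [← lintegral_indicator hD.measurableSet, ← lintegral_indicator hΩ.measurableSet]
  refine lintegral_mono fun x => ?_
  by_cases hx : x ∈ D
  · rw [indicator_of_mem hx]
    by_cases hxΩ : x ∈ Ω
    · rw [indicator_of_mem hxΩ, (indicator_eventuallyEq hΩ _ hxΩ).fderiv_eq, enorm_fderiv_eq]
    · have h0 : fderiv ℝ (Ω.indicator fun y => χ y * φ y) x = 0 :=
        (indicator_eventuallyEq_zero hΩ h1 hφ hx hxΩ).fderiv_eq.trans (by simp)
      rw [← ofReal_norm, h0, norm_zero]
      simp
  · rw [indicator_of_notMem hx]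
    exact zero_le

lemma lintegral_indicator_sq {Ω D : Set F} (hΩ : MeasurableSet Ω) (hD : MeasurableSet D)
    {χ φ : F → ℝ} (h2 : ∀ x ∈ Ω, x ∈ tsupport χ → x ∈ D) :
    ∫⁻ x in D, ‖Ω.indicator (fun y => χ y * φ y) x‖ₑ ^ 2 = ∫⁻ x in Ω, ‖χ x * φ x‖ₑ ^ 2 := by
  rw [← lintegral_indicator hD, ← lintegral_indicator hΩ]
  refine lintegral_congr fun x => ?_
  by_cases hx : x ∈ Ω
  · rw [indicator_of_mem hx (f := fun x => ‖χ x * φ x‖ₑ ^ 2)]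
    by_cases hxD : x ∈ D
    · rw [indicator_of_mem hxD, indicator_of_mem hx]
    · rw [indicator_of_notMem hxD, image_eq_zero_of_notMem_tsupport fun h => hxD (h2 x hx h)]
      simp
  · rw [indicator_of_notMem hx]
    by_cases hxD : x ∈ D
    · rw [indicator_of_mem hxD, indicator_of_notMem hx]
      simp
    · rw [indicator_of_notMem hxD]

lemma lintegral_mul_sq_of_testPair {Ω : Set F} {χ : F → ℝ}
    (hχ : ContDiff ℝ (⊤ : ℕ∞) χ) {U V : L2Pair Ω} {φ : F → ℝ} (hφ : ContDiff ℝ (⊤ : ℕ∞) φ)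
    (hU1 : U.fst =ᵐ[volume.restrict Ω] φ) (hU2 : U.snd =ᵐ[volume.restrict Ω] gradient φ)
    (hV1 : V.fst =ᵐ[volume.restrict Ω] fun x => χ x * U.fst x)
    (hV2 : V.snd =ᵐ[volume.restrict Ω] fun x => χ x • U.snd x + U.fst x • gradient χ x) :
    ∫⁻ x in Ω, ‖χ x * φ x‖ₑ ^ 2 = ENNReal.ofReal (‖V.fst‖ ^ 2) ∧
    ∫⁻ x in Ω, ‖gradient (fun y => χ y * φ y) x‖ₑ ^ 2 = ENNReal.ofReal (‖V.snd‖ ^ 2) := by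
  rw [← lintegral_enorm_sq_eq, ← lintegral_enorm_sq_eq]
  constructor
  · refine lintegral_congr_ae ?_
    filter_upwards [hU1, hV1] with x h1 h2
    rw [h2, h1]
  · refine lintegral_congr_ae ?_
    filter_upwards [hU1, hU2, hV2] with x h1 h2 h3
    rw [h3, h1, h2, gradient_mul (hχ.differentiable (by simp) x) (hφ.differentiable (by simp) x)]

/-- A form of Rellich's theorem: where `χ` is supported, the `L²` norm is bounded by a small
multiple of the energy up to finitely many continuous functionals. Here `D` is the domain `Ω` with
its Dirichlet boundary removed, so only the free part of the boundary has to satisfy a cone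
condition. -/
lemma exists_functionals {Ω S D B : Set F} (hΩ : IsOpen Ω) (hD : IsOpen D) {v : F}
    (hv : ∀ x ∈ D, ∀ w ∈ Metric.ball v 2, ∀ s : ℝ, 0 ≤ s → x + s • w ∈ D)
    (hB : Bornology.IsBounded B) {χ : F → ℝ} (hχ : ContDiff ℝ (⊤ : ℕ∞) χ)
    (h1 : ∀ x ∈ D, x ∈ frontier Ω → x ∈ tsupport χ → x ∈ closure S)
    (h2 : ∀ x ∈ Ω, x ∈ tsupport χ → x ∈ D ∧ x ∈ B)
    {A : L2Pair Ω →L[ℝ] L2Pair Ω} (hA : ∀ U : L2Pair Ω,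
      ((A U).fst =ᵐ[volume.restrict Ω] fun x => χ x * U.fst x) ∧
      ((A U).snd =ᵐ[volume.restrict Ω] fun x => χ x • U.snd x + U.fst x • gradient χ x))
    {ε : ℝ} (hε : 0 < ε) :
    ∃ (k : ℕ) (ℓ : Fin k → L2Pair Ω →L[ℝ] ℝ), ∀ U ∈ sobolev Ω S,
      ‖(A U).fst‖ ^ 2 ≤ ε * ‖(A U).snd‖ ^ 2 + ∑ j, ℓ j U ^ 2 := by
  set M : ℝ := 2 * 2 ^ Module.finrank ℝ F * (‖v‖ + 2) ^ 2 with hM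
  have hM0 : 0 < M := by positivity
  obtain ⟨k, P, C, hP, hbound⟩ := exists_finite_rank_bound hD hv hB
    (ε := √(ε / M)) (Real.sqrt_pos.2 (by positivity))
  rw [Real.sq_sqrt (by positivity), ← hM, div_mul_cancel₀ _ hM0.ne'] at hbound
  have hPΩ : ∀ i, (volume.restrict Ω) (P i) ≠ ∞ := fun i =>
    ((Measure.restrict_apply_le _ _).trans_lt (hP i).2.lt_top).ne
  let ℓ : Fin k → L2Pair Ω →L[ℝ] ℝ := fun i => √C •
    (innerSL ℝ (indicatorConstLp 2 (hP i).1 (hPΩ i) (1 : ℝ))).comp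
      ((WithLp.fstL 2 ℝ _ _).comp A)
  refine ⟨k, ℓ, fun U hU => ?_⟩
  refine sobolev_induction (P := fun U => ‖(A U).fst‖ ^ 2 ≤ ε * ‖(A U).snd‖ ^ 2 + ∑ j, ℓ j U ^ 2)
    ?_ (fun U hU => ?_) hU
  · have e1 : Continuous fun U => (A U).fst :=
      ((WithLp.fstL 2 ℝ _ _).comp A).continuous
    have e2 : Continuous fun U => (A U).snd :=
      ((WithLp.sndL 2 ℝ _ _).comp A).continuous
    exact isClosed_le (by fun_prop) (by fun_prop)
  · obtain ⟨φ, hφ, hφc, hφS, hφ1, hφ2⟩ := hU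
    set f : F → ℝ := Ω.indicator fun y => χ y * φ y with hf
    have hψc : Continuous fun y => χ y * φ y := hχ.continuous.mul hφ.continuous
    have hfm : Measurable f := hψc.measurable.indicator hΩ.measurableSet
    have hf2 : MemLp f 2 (volume.restrict D) :=
      ((hψc.memLp_of_hasCompactSupport hφc.mul_left).indicator hΩ.measurableSet).restrict D
    have hfD : ∀ x, x ∉ D ∨ x ∉ B → f x = 0 := fun x hx =>
      indicator_apply_eq_zero.2 fun hxΩ => by
        have : x ∉ tsupport χ := fun h => hx.elim (· (h2 x hxΩ h).1) (· (h2 x hxΩ h).2)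
        rw [image_eq_zero_of_notMem_tsupport this, zero_mul]
    obtain ⟨n1, n2⟩ := lintegral_mul_sq_of_testPair hχ hφ hφ1 hφ2
      (hA U).1 (hA U).2
    have h3 := hbound f hfm (contDiffOn_indicator hΩ hχ hφ h1 hφS) hf2 fun x _ hx => hfD x (Or.inr hx)
    rw [lintegral_indicator_sq hΩ.measurableSet hD.measurableSet fun x hx h => (h2 x hx h).1, n1] at h3
    have h4 := lintegral_fderiv_indicator_le hΩ hD h1 hφS
    rw [n2] at h4
    have hℓ : ∀ i, ℓ i U = √C * ∫ x in P i ∩ D, f x := by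
      intro i
      change √C * ⟪indicatorConstLp 2 (hP i).1 (hPΩ i) (1 : ℝ), (A U).fst⟫ = _
      rw [L2.inner_indicatorConstLp_one, Measure.restrict_restrict (hP i).1]
      congr 1
      have e1 : ∫ x in P i ∩ Ω, (A U).fst x = ∫ x in P i ∩ Ω, χ x * φ x := by
        refine integral_congr_ae (ae_restrict_of_ae_restrict_of_subset inter_subset_right ?_)
        filter_upwards [hφ1, (hA U).1] with x e1 e2
        rw [e2, e1]
      rw [e1, ← integral_indicator ((hP i).1.inter hΩ.measurableSet),
        ← integral_indicator ((hP i).1.inter hD.measurableSet)]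
      refine integral_congr_ae (ae_of_all _ fun x => ?_)
      by_cases hxP : x ∈ P i
      · by_cases hxΩ : x ∈ Ω
        · by_cases hxD : x ∈ D
          · simp [hxP, hxΩ, hxD, hf]
          · have := hfD x (Or.inl hxD)
            simp only [hf, indicator_of_mem hxΩ] at this
            simp [hxP, hxΩ, hxD, this]
        · by_cases hxD : x ∈ D
          · simp [hxP, hxΩ, hxD, hf]
          · simp [hxP, hxΩ, hxD]
      · simp [hxP]
    have hsum : ∑ i, ℓ i U ^ 2 = C * ∑ i, (∫ x in P i ∩ D, f x) ^ 2 := by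
      rw [Finset.mul_sum]
      refine Finset.sum_congr rfl fun i _ => ?_
      rw [hℓ, mul_pow, Real.sq_sqrt C.coe_nonneg]
    have h5 : (C : ℝ≥0∞) * ∑ i, ‖∫ x in P i ∩ D, f x‖ₑ ^ 2 =
        ENNReal.ofReal (∑ i, ℓ i U ^ 2) := by
      rw [hsum, ENNReal.ofReal_mul C.coe_nonneg, ENNReal.ofReal_coe_nnreal,
        ENNReal.ofReal_sum_of_nonneg fun _ _ => sq_nonneg _]
      congr 1
      refine Finset.sum_congr rfl fun i _ => ?_
      rw [← ofReal_norm, ← ENNReal.ofReal_pow (norm_nonneg _), Real.norm_eq_abs, sq_abs]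
    rw [h5] at h3
    have h6 := h3.trans (add_le_add (mul_le_mul_right h4 _) le_rfl)
    have hnn : 0 ≤ ∑ i, ℓ i U ^ 2 := Finset.sum_nonneg fun _ _ => sq_nonneg _
    rw [← ENNReal.ofReal_mul hε.le, ← ENNReal.ofReal_add (by positivity) hnn] at h6
    exact (ENNReal.ofReal_le_ofReal_iff (by positivity)).1 h6

/-- A Poincaré inequality: if some admissible translation moves `Ω` off itself, the `L²` norm is
bounded by the energy. -/
lemma norm_fst_le_of_translate {Ω S D : Set F} (hΩ : IsOpen Ω) (hD : IsOpen D) (hΩD : Ω ⊆ D)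
    (h1 : ∀ x ∈ D, x ∈ frontier Ω → x ∈ closure S) {y : F}
    (hy : ∀ x ∈ D, ∀ t : ℝ, 0 ≤ t → t ≤ 1 → x + t • y ∈ D) (hyΩ : ∀ x ∈ Ω, x + y ∉ Ω)
    {U : L2Pair Ω} (hU : U ∈ sobolev Ω S) : ‖U.fst‖ ^ 2 ≤ ‖y‖ ^ 2 * ‖U.snd‖ ^ 2 := by
  refine sobolev_induction (P := fun U => ‖U.fst‖ ^ 2 ≤ ‖y‖ ^ 2 * ‖U.snd‖ ^ 2) ?_
    (fun U hU => ?_) hU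
  · have e1 : Continuous fun U : L2Pair Ω => U.fst := (WithLp.fstL 2 ℝ _ _).continuous
    have e2 : Continuous fun U : L2Pair Ω => U.snd := (WithLp.sndL 2 ℝ _ _).continuous
    exact isClosed_le (by fun_prop) (by fun_prop)
  · obtain ⟨φ, hφ, hφc, hφS, hφ1, hφ2⟩ := hU
    have hχ : ContDiff ℝ (⊤ : ℕ∞) fun _ : F => (1 : ℝ) := contDiff_const
    have h1' : ∀ x ∈ D, x ∈ frontier Ω → x ∈ tsupport (fun _ : F => (1 : ℝ)) → x ∈ closure S :=
      fun x hx hx' _ => h1 x hx hx'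
    obtain ⟨n1, n2⟩ := lintegral_mul_sq_of_testPair (V := U) hχ hφ hφ1 hφ2
      (by simp) (ae_of_all _ fun x => by simp [gradient_fun_const'])
    set f : F → ℝ := Ω.indicator fun y => 1 * φ y with hf
    have h3 := lintegral_translate_sub_le hD (contDiffOn_indicator hΩ hχ hφ h1' hφS) hy
    have h4 := lintegral_fderiv_indicator_le hΩ hD h1' hφS
    rw [n2] at h4
    have h5 : ∫⁻ x in D, ‖f x‖ₑ ^ 2 ≤ ∫⁻ x in D, ‖f (x + y) - f x‖ₑ ^ 2 := by
      refine lintegral_mono fun x => ?_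
      by_cases hx : x ∈ Ω
      · have : f (x + y) = 0 := indicator_of_notMem (hyΩ x hx) _
        rw [this, zero_sub, enorm_neg]
      · have : f x = 0 := indicator_of_notMem hx _
        simp [this]
    rw [hf, lintegral_indicator_sq hΩ.measurableSet hD.measurableSet fun x hx _ => hΩD hx, n1] at h5
    have h6 := (h5.trans h3).trans (mul_le_mul_right h4 _)
    rw [← ofReal_norm, ← ENNReal.ofReal_pow (norm_nonneg _), ← ENNReal.ofReal_mul (sq_nonneg _)] at h6
    exact (ENNReal.ofReal_le_ofReal_iff (by positivity)).1 h6

end Compactness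

/-! ### The Dirichlet problem on the cross-section -/

section CrossSection

section Forms

variable {F : Type} [NormedAddCommGroup F] [InnerProductSpace ℝ F] [FiniteDimensional ℝ F]
  [MeasurableSpace F] [BorelSpace F]

lemma exists_sum_sq_eq {Ω : Set F} {k₁ k₂ : ℕ} (ℓ₁ : Fin k₁ → L2Pair Ω →L[ℝ] ℝ)
    (ℓ₂ : Fin k₂ → L2Pair Ω →L[ℝ] ℝ) {a b : ℝ} (ha : 0 ≤ a) (hb : 0 ≤ b) :
    ∃ (k : ℕ) (ℓ : Fin k → L2Pair Ω →L[ℝ] ℝ), ∀ U,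
      ∑ j, ℓ j U ^ 2 = a * ∑ j, ℓ₁ j U ^ 2 + b * ∑ j, ℓ₂ j U ^ 2 := by
  refine ⟨k₁ + k₂, Fin.append (fun j => √a • ℓ₁ j) (fun j => √b • ℓ₂ j), fun U => ?_⟩
  simp [Fin.sum_univ_add, mul_pow, Real.sq_sqrt ha, Real.sq_sqrt hb, Finset.mul_sum]

/-- The Dirichlet problem in a bounded open set has empty essential spectrum. -/
lemma coerciveModFinite_of_isBounded {Ω : Set F} (hΩ : IsOpen Ω) (hb : Bornology.IsBounded Ω)
    (t : ℝ) : CoerciveModFinite Ω (frontier Ω) t := by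
  set T : ℝ := max t 1 with hT
  have hT0 : 0 < T := lt_of_lt_of_le one_pos (le_max_right _ _)
  obtain ⟨k, ℓ, hℓ⟩ := exists_functionals (S := frontier Ω) (D := univ) (B := Ω) (v := 0)
    (χ := fun _ => 1) hΩ isOpen_univ (fun _ _ _ _ _ _ => mem_univ _) hb contDiff_const
    (fun x _ hx _ => subset_closure hx) (fun x hx _ => ⟨mem_univ _, hx⟩)
    (A := ContinuousLinearMap.id ℝ _) (fun U => ⟨by simp, ae_of_all _ fun x => by
      simp [gradient_fun_const']⟩) (inv_pos.2 hT0)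
  obtain ⟨k', ℓ', hℓ'⟩ := exists_sum_sq_eq ℓ (Fin.elim0 : Fin 0 → _) hT0.le le_rfl
  refine ⟨k', ℓ', fun U hU => ?_⟩
  have h1 := hℓ U hU
  simp only [ContinuousLinearMap.id_apply] at h1
  rw [hℓ', zero_mul, add_zero]
  calc t * ‖U.fst‖ ^ 2 ≤ T * ‖U.fst‖ ^ 2 := by
        gcongr
        exact le_max_left _ _
    _ ≤ T * (T⁻¹ * ‖U.snd‖ ^ 2 + ∑ j, ℓ j U ^ 2) := by gcongr
    _ = _ := by rw [mul_add, mul_inv_cancel_left₀ hT0.ne']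

/-- The smallest eigenvalue of the Dirichlet problem is the constant in Poincaré's inequality. -/
lemma poincare_of_isLeast {Ω : Set F} (hΩ : IsOpen Ω) (hb : Bornology.IsBounded Ω) {μ : ℝ}
    (hμ : IsLeast {t | IsEigenvalue Ω (frontier Ω) t} μ) (hμ0 : 0 ≤ μ) {φ : F → ℝ}
    (hφ : ContDiff ℝ (⊤ : ℕ∞) φ) (hφc : HasCompactSupport φ)
    (hφS : Disjoint (tsupport φ) (frontier Ω)) :
    ENNReal.ofReal μ * ∫⁻ x in Ω, ‖φ x‖ₑ ^ 2 ≤ ∫⁻ x in Ω, ‖gradient φ x‖ₑ ^ 2 := by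
  have h1 : MemLp φ 2 (volume.restrict Ω) :=
    (hφ.continuous.memLp_of_hasCompactSupport hφc).restrict Ω
  have h2 : MemLp (gradient φ) 2 (volume.restrict Ω) := by
    refine ((hφ.continuous_gradient (by exact_mod_cast le_top)).memLp_of_hasCompactSupport ?_).restrict Ω
    exact IsCompact.of_isClosed_subset hφc (isClosed_tsupport _) (tsupport_gradient_subset φ)
  let U : L2Pair Ω := WithLp.toLp 2 (h1.toLp, h2.toLp)
  have hU : U ∈ sobolev Ω (frontier Ω) := by
    refine Submodule.le_topologicalClosure _ ⟨φ, hφ, hφc, ?_, h1.coeFn_toLp, h2.coeFn_toLp⟩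
    rwa [isClosed_frontier.closure_eq]
  have key := (coerciveModFinite_of_isBounded hΩ hb (μ + 1)).le_of_orthogonal hμ0 (lt_add_one μ) hU
    (fun t ht V hV => by
      have hV0 : V = 0 := by
        by_contra hne
        exact ht.not_ge (hμ.2 ((Submodule.ne_bot_iff _).2 ⟨V, hV, hne⟩))
      simp [hV0])
  have e1 : ∫⁻ x in Ω, ‖φ x‖ₑ ^ 2 = ENNReal.ofReal (‖U.fst‖ ^ 2) := by
    rw [← lintegral_enorm_sq_eq]
    refine lintegral_congr_ae ?_
    filter_upwards [h1.coeFn_toLp] with x hx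
    change _ = ‖h1.toLp φ x‖ₑ ^ 2
    rw [hx]
  have e2 : ∫⁻ x in Ω, ‖gradient φ x‖ₑ ^ 2 = ENNReal.ofReal (‖U.snd‖ ^ 2) := by
    rw [← lintegral_enorm_sq_eq]
    refine lintegral_congr_ae ?_
    filter_upwards [h2.coeFn_toLp] with x hx
    change _ = ‖h2.toLp _ x‖ₑ ^ 2
    rw [hx]
  rw [e1, e2, ← ENNReal.ofReal_mul hμ0]
  exact ENNReal.ofReal_le_ofReal key

end Forms

variable {E : Type} [NormedAddCommGroup E] [InnerProductSpace ℝ E]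

/-- The embedding of the cross-section, enlarged `h` times, at the height `z`. -/
noncomputable def sliceMap (h z : ℝ) (η : E) : WithLp 2 (E × ℝ) := WithLp.toLp 2 (h • η, z)

lemma hasFDerivAt_sliceMap (h z : ℝ) (η : E) :
    HasFDerivAt (sliceMap h z) (h • ((WithLp.prodContinuousLinearEquiv 2 ℝ E ℝ).symm :
      E × ℝ →L[ℝ] WithLp 2 (E × ℝ)).comp (ContinuousLinearMap.inl ℝ E ℝ)) η := by
  have h1 : (sliceMap h z : E → WithLp 2 (E × ℝ)) = fun η =>
      (h • ((WithLp.prodContinuousLinearEquiv 2 ℝ E ℝ).symm :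
      E × ℝ →L[ℝ] WithLp 2 (E × ℝ)).comp (ContinuousLinearMap.inl ℝ E ℝ)) η +
      WithLp.toLp 2 (0, z) := by
    funext η
    simp only [sliceMap, _root_.smul_apply, ContinuousLinearMap.comp_apply,
      ContinuousLinearMap.inl_apply, ContinuousLinearEquiv.coe_coe,
      WithLp.prodContinuousLinearEquiv_symm_apply]
    rw [← WithLp.toLp_smul, ← WithLp.toLp_add]
    simp
  rw [h1]
  exact (ContinuousLinearMap.hasFDerivAt _).add_const _

variable [FiniteDimensional ℝ E] [MeasurableSpace E] [BorelSpace E]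

lemma lintegral_withLp_prod {g : WithLp 2 (E × ℝ) → ℝ≥0∞} (hg : Measurable g) :
    ∫⁻ x, g x = ∫⁻ z : ℝ, ∫⁻ y : E, g (WithLp.toLp 2 (y, z)) := by
  rw [← (WithLp.volume_preserving_toLp E ℝ).lintegral_comp hg]
  exact lintegral_prod_symm' _ (hg.comp (WithLp.measurable_toLp 2 (E × ℝ)))

/-- Poincaré's inequality on the cross-sections of a cylinder, integrated along the cylinder. -/
lemma lintegral_cylinder_le {ω : Set E} (hω : IsOpen ω) (hb : Bornology.IsBounded ω) {μ : ℝ}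
    (hμ : IsLeast {t | IsEigenvalue ω (frontier ω) t} μ) (hμ0 : 0 ≤ μ) {h : ℝ} (hh : 0 < h)
    {ψ : WithLp 2 (E × ℝ) → ℝ} (hψ : ContDiff ℝ (⊤ : ℕ∞) ψ) (hψc : HasCompactSupport ψ)
    (hψS : ∀ x ∈ tsupport ψ, h⁻¹ • x.fst ∉ frontier ω) :
    ENNReal.ofReal μ * ∫⁻ x in {x | h⁻¹ • x.fst ∈ ω}, ‖ψ x‖ₑ ^ 2 ≤
      ENNReal.ofReal (h ^ 2) * ∫⁻ x in {x | h⁻¹ • x.fst ∈ ω}, ‖gradient ψ x‖ₑ ^ 2 := by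
  have hcont : ∀ z, Continuous (sliceMap (E := E) h z) := fun z =>
    continuous_iff_continuousAt.2 fun η => (hasFDerivAt_sliceMap h z η).continuousAt
  have hfst : Continuous fun x : WithLp 2 (E × ℝ) => h⁻¹ • x.fst := by fun_prop
  set Cy : Set (WithLp 2 (E × ℝ)) := {x | h⁻¹ • x.fst ∈ ω} with hCy
  have hCym : MeasurableSet Cy := (hω.preimage hfst).measurableSet
  have hmem : ∀ z η, sliceMap h z η ∈ Cy ↔ η ∈ ω := fun z η => by
    simp [hCy, sliceMap, smul_smul, inv_mul_cancel₀ hh.ne']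
  have hslice : ∀ z : ℝ, ENNReal.ofReal μ * ∫⁻ η in ω, ‖ψ (sliceMap h z η)‖ₑ ^ 2 ≤
      ENNReal.ofReal (h ^ 2) * ∫⁻ η in ω, ‖gradient ψ (sliceMap h z η)‖ₑ ^ 2 := by
    intro z
    have hs : ContDiff ℝ (⊤ : ℕ∞) (sliceMap (E := E) h z) := by
      unfold sliceMap
      exact (WithLp.prodContinuousLinearEquiv 2 ℝ E ℝ).symm.contDiff.comp
        ((contDiff_id.const_smul h).prodMk contDiff_const)
    have hts : tsupport (fun η => ψ (sliceMap h z η)) ⊆ sliceMap h z ⁻¹' tsupport ψ :=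
      closure_minimal (fun η hη => subset_tsupport _ hη) ((isClosed_tsupport ψ).preimage (hcont z))
    have h1 := poincare_of_isLeast hω hb hμ hμ0 (φ := fun η => ψ (sliceMap h z η)) (hψ.comp hs)
      (by
        refine HasCompactSupport.intro (hψc.isCompact.image hfst) fun η hη => ?_
        by_contra hne
        refine hη ⟨sliceMap h z η, subset_tsupport _ hne, ?_⟩
        simp [sliceMap, smul_smul, inv_mul_cancel₀ hh.ne'])
      (by
        rw [Set.disjoint_left]
        intro η hη hηf
        refine hψS _ (hts hη) ?_
        simpa [sliceMap, smul_smul, inv_mul_cancel₀ hh.ne'] using hηf)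
    refine h1.trans ?_
    rw [← lintegral_const_mul' _ _ ENNReal.ofReal_ne_top]
    refine lintegral_mono fun η => ?_
    -- the gradient along the section is at most `h` times the full gradient
    have h2 := ((hψ.differentiable (by simp) _).hasFDerivAt.comp η (hasFDerivAt_sliceMap h z η)).fderiv
    have h3 : ‖fderiv ℝ (fun η => ψ (sliceMap h z η)) η‖ ≤ h * ‖fderiv ℝ ψ (sliceMap h z η)‖ := by
      refine ContinuousLinearMap.opNorm_le_bound _ (by positivity) fun v => ?_
      change ‖fderiv ℝ (ψ ∘ sliceMap h z) η v‖ ≤ _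
      rw [h2, ContinuousLinearMap.comp_apply]
      refine (ContinuousLinearMap.le_opNorm _ _).trans ?_
      have h4 : ‖(h • ((WithLp.prodContinuousLinearEquiv 2 ℝ E ℝ).symm :
          E × ℝ →L[ℝ] WithLp 2 (E × ℝ)).comp (ContinuousLinearMap.inl ℝ E ℝ)) v‖ = h * ‖v‖ := by
        rw [_root_.smul_apply, norm_smul, Real.norm_of_nonneg hh.le]
        simp
      rw [h4]
      nlinarith [norm_nonneg v]
    rw [← enorm_fderiv_eq, ← enorm_fderiv_eq, ENNReal.ofReal_pow hh.le, ← mul_pow]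
    refine pow_le_pow_left' ?_ 2
    rw [← ofReal_norm, ← ofReal_norm, ← ENNReal.ofReal_mul hh.le]
    exact ENNReal.ofReal_le_ofReal h3
  -- Fubini's theorem, and the change of variables in each section
  have hint : ∀ g : WithLp 2 (E × ℝ) → ℝ≥0∞, Measurable g → ∫⁻ x in Cy, g x =
      ∫⁻ z : ℝ, ENNReal.ofReal (h ^ Module.finrank ℝ E) * ∫⁻ η in ω, g (sliceMap h z η) := by
    intro g hg
    rw [← lintegral_indicator hCym, lintegral_withLp_prod (hg.indicator hCym)]
    refine lintegral_congr fun z => ?_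
    have h1 := lintegral_comp_similarity (0 : E) hh (LinearIsometryEquiv.refl ℝ E)
      (fun y => Cy.indicator g (WithLp.toLp 2 (y, z)))
    have h2 : ∫⁻ η in ω, g (sliceMap h z η) =
        ∫⁻ η, Cy.indicator g (WithLp.toLp 2 (similarity 0 hh (LinearIsometryEquiv.refl ℝ E) η, z)) := by
      rw [← lintegral_indicator hω.measurableSet]
      refine lintegral_congr fun η => ?_
      have h3 : WithLp.toLp 2 (similarity 0 hh (LinearIsometryEquiv.refl ℝ E) η, z) =
          sliceMap h z η := by simp [sliceMap]
      rw [h3]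
      by_cases hη : η ∈ ω
      · rw [indicator_of_mem hη, indicator_of_mem ((hmem z η).2 hη)]
      · rw [indicator_of_notMem hη, indicator_of_notMem fun h => hη ((hmem z η).1 h)]
    rw [h2, h1, ← mul_assoc, ← ENNReal.ofReal_mul (by positivity), mul_inv_cancel₀ (by positivity),
      ENNReal.ofReal_one, one_mul]
  have hm1 : Measurable fun x => ‖ψ x‖ₑ ^ 2 := hψ.continuous.measurable.enorm.pow_const 2
  have hm2 : Measurable fun x => ‖gradient ψ x‖ₑ ^ 2 :=
    (hψ.continuous_gradient (by exact_mod_cast le_top)).measurable.enorm.pow_const 2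
  rw [hint _ hm1, hint _ hm2, ← lintegral_const_mul' _ _ ENNReal.ofReal_ne_top,
    ← lintegral_const_mul' _ _ ENNReal.ofReal_ne_top]
  refine lintegral_mono fun z => ?_
  rw [mul_left_comm, mul_left_comm (ENNReal.ofReal (h ^ 2))]
  exact mul_le_mul_right (hslice z) _

/-- Where `χ` is supported in the cylindrical part of `Ω`, with the lateral side in `S`, the energy
of `χ U` is at least `h⁻² μ` times the square of its norm. -/
lemma norm_fst_le_of_cylinder {ω : Set E} (hω : IsOpen ω) (hb : Bornology.IsBounded ω) {μ : ℝ}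
    (hμ : IsLeast {t | IsEigenvalue ω (frontier ω) t} μ) (hμ0 : 0 ≤ μ) {h : ℝ} (hh : 0 < h)
    {Ω S : Set (WithLp 2 (E × ℝ))} (hΩ : IsOpen Ω) {χ : WithLp 2 (E × ℝ) → ℝ}
    (hχ : ContDiff ℝ (⊤ : ℕ∞) χ) (h1 : ∀ x ∈ tsupport χ, x ∈ Ω ↔ h⁻¹ • x.fst ∈ ω)
    (h2 : ∀ x ∈ tsupport χ, h⁻¹ • x.fst ∈ frontier ω → x ∈ closure S)
    {A : L2Pair Ω →L[ℝ] L2Pair Ω} (hA : ∀ U : L2Pair Ω,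
      ((A U).fst =ᵐ[volume.restrict Ω] fun x => χ x * U.fst x) ∧
      ((A U).snd =ᵐ[volume.restrict Ω] fun x => χ x • U.snd x + U.fst x • gradient χ x))
    {U : L2Pair Ω} (hU : U ∈ sobolev Ω S) :
    μ * ‖(A U).fst‖ ^ 2 ≤ h ^ 2 * ‖(A U).snd‖ ^ 2 := by
  refine sobolev_induction (P := fun U => μ * ‖(A U).fst‖ ^ 2 ≤ h ^ 2 * ‖(A U).snd‖ ^ 2) ?_
    (fun U hU => ?_) hU
  · have e1 : Continuous fun U => (A U).fst :=
      ((WithLp.fstL 2 ℝ _ _).comp A).continuous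
    have e2 : Continuous fun U => (A U).snd :=
      ((WithLp.sndL 2 ℝ _ _).comp A).continuous
    exact isClosed_le (by fun_prop) (by fun_prop)
  · obtain ⟨φ, hφ, hφc, hφS, hφ1, hφ2⟩ := hU
    obtain ⟨n1, n2⟩ := lintegral_mul_sq_of_testPair hχ hφ hφ1 hφ2 (hA U).1 (hA U).2
    have hts : tsupport (fun y => χ y * φ y) ⊆ tsupport χ ∩ tsupport φ := by
      refine closure_minimal (fun x hx => ?_) ((isClosed_tsupport χ).inter (isClosed_tsupport φ))
      exact ⟨subset_tsupport _ (left_ne_zero_of_mul hx), subset_tsupport _ (right_ne_zero_of_mul hx)⟩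
    have key := lintegral_cylinder_le hω hb hμ hμ0 hh (hχ.mul hφ) hφc.mul_left
      fun x hx hxf => Set.disjoint_left.1 hφS (hts hx).2 (h2 x (hts hx).1 hxf)
    have hfst : Continuous fun x : WithLp 2 (E × ℝ) => h⁻¹ • x.fst := by fun_prop
    have hCym : MeasurableSet {x : WithLp 2 (E × ℝ) | h⁻¹ • x.fst ∈ ω} :=
      (hω.preimage hfst).measurableSet
    have hset : ∀ g : WithLp 2 (E × ℝ) → ℝ≥0∞, (∀ x ∉ tsupport χ, g x = 0) →
        ∫⁻ x in {x : WithLp 2 (E × ℝ) | h⁻¹ • x.fst ∈ ω}, g x = ∫⁻ x in Ω, g x := by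
      intro g hg
      rw [← lintegral_indicator hCym, ← lintegral_indicator hΩ.measurableSet]
      refine lintegral_congr fun x => ?_
      by_cases hx : x ∈ tsupport χ
      · by_cases hxΩ : x ∈ Ω
        · have hxC : x ∈ {x : WithLp 2 (E × ℝ) | h⁻¹ • x.fst ∈ ω} := (h1 x hx).1 hxΩ
          rw [indicator_of_mem hxΩ, indicator_of_mem hxC]
        · have hxC : x ∉ {x : WithLp 2 (E × ℝ) | h⁻¹ • x.fst ∈ ω} := fun h => hxΩ ((h1 x hx).2 h)
          rw [indicator_of_notMem hxΩ, indicator_of_notMem hxC]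
      · rw [indicator_apply_eq_zero.2 fun _ => hg x hx, indicator_apply_eq_zero.2 fun _ => hg x hx]
    rw [hset, hset, n1, n2, ← ENNReal.ofReal_mul hμ0, ← ENNReal.ofReal_mul (sq_nonneg _)] at key
    · exact (ENNReal.ofReal_le_ofReal_iff (by positivity)).1 key
    · intro x hx
      have : gradient (fun y => χ y * φ y) x = 0 := image_eq_zero_of_notMem_tsupport
        fun h => hx (hts (tsupport_gradient_subset _ h)).1
      rw [← ofReal_norm, this, norm_zero]
      simp
    · intro x hx
      rw [image_eq_zero_of_notMem_tsupport hx, zero_mul]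
      simp

end CrossSection

/-! ### Smooth cutoff functions of the axial variable -/

section Cutoff

lemma exists_abs_deriv_smoothTransition_le : ∃ C : ℝ, 1 ≤ C ∧
    ∀ x, |deriv Real.smoothTransition x| ≤ C := by
  have hc : Continuous (deriv Real.smoothTransition) :=
    (Real.smoothTransition.contDiff (n := 1)).continuous_deriv le_rfl
  obtain ⟨C, hC⟩ := isCompact_Icc.exists_bound_of_continuousOn (s := Icc (0 : ℝ) 1) hc.continuousOn
  refine ⟨max C 1, le_max_right _ _, fun x => ?_⟩
  rcases lt_or_ge x 0 with h | h
  · have : Real.smoothTransition =ᶠ[𝓝 x] fun _ => 0 := by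
      filter_upwards [gt_mem_nhds h] with y hy using Real.smoothTransition.zero_of_nonpos hy.le
    rw [this.deriv_eq]
    simp
  rcases lt_or_ge 1 x with h' | h'
  · have : Real.smoothTransition =ᶠ[𝓝 x] fun _ => 1 := by
      filter_upwards [lt_mem_nhds h'] with y hy using Real.smoothTransition.one_of_one_le hy.le
    rw [this.deriv_eq]
    simp
  · exact (hC x ⟨h, h'⟩).trans (le_max_left _ _)

/-- A smooth cutoff on the line: it is `1` on `J`, `0` off `I`, and its slope is at most `C`. -/
structure IsCutoff (f : ℝ → ℝ) (I J : Set ℝ) (C : ℝ) : Prop where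
  smooth : ContDiff ℝ (⊤ : ℕ∞) f
  nonneg : ∀ z, 0 ≤ f z
  le_one : ∀ z, f z ≤ 1
  eq_zero : ∀ z ∉ I, f z = 0
  eq_one : ∀ z ∈ J, f z = 1
  abs_deriv_le : ∀ z, |deriv f z| ≤ C

lemma IsCutoff.deriv_eq_zero {f : ℝ → ℝ} {I J : Set ℝ} {C : ℝ} (hf : IsCutoff f I J C) {z : ℝ}
    (hz : z ∉ I ∨ z ∈ J) : deriv f z = 0 := by
  rcases hz with hz | hz
  · refine IsLocalMin.deriv_eq_zero (Eventually.of_forall fun y => ?_)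
    rw [hf.eq_zero z hz]
    exact hf.nonneg y
  · refine IsLocalMax.deriv_eq_zero (Eventually.of_forall fun y => ?_)
    rw [hf.eq_one z hz]
    exact hf.le_one y

lemma isCutoff_smoothTransition {C : ℝ} (hC : ∀ x, |deriv Real.smoothTransition x| ≤ C) (a b : ℝ) :
    IsCutoff (fun z => Real.smoothTransition (a * z + b)) {z | 0 ≤ a * z + b} {z | 1 ≤ a * z + b}
      (|a| * C) := by
  refine ⟨?_, fun z => Real.smoothTransition.nonneg _, fun z => Real.smoothTransition.le_one _,
    fun z hz => Real.smoothTransition.zero_of_nonpos (not_le.1 hz).le,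
    fun z hz => Real.smoothTransition.one_of_one_le hz, fun z => ?_⟩
  · exact Real.smoothTransition.contDiff.comp ((contDiff_const.mul contDiff_id).add contDiff_const)
  · have h1 : HasDerivAt (fun z : ℝ => a * z + b) a z := by
      simpa using ((hasDerivAt_id z).const_mul a).add_const b
    have h2 : HasDerivAt (fun z => Real.smoothTransition (a * z + b)) _ z :=
      (((Real.smoothTransition.contDiff (n := 1)).differentiable (by simp) _).hasDerivAt).comp z h1
    rw [h2.deriv, abs_mul, mul_comm]
    gcongr
    exact hC _

lemma IsCutoff.mul {f g : ℝ → ℝ} {I J I' J' : Set ℝ} {C C' : ℝ} (hf : IsCutoff f I J C)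
    (hg : IsCutoff g I' J' C') : IsCutoff (fun z => f z * g z) (I ∩ I') (J ∩ J') (C + C') := by
  refine ⟨hf.smooth.mul hg.smooth, fun z => mul_nonneg (hf.nonneg z) (hg.nonneg z),
    fun z => mul_le_one₀ (hf.le_one z) (hg.nonneg z) (hg.le_one z), fun z hz => ?_, fun z hz => ?_,
    fun z => ?_⟩
  · rcases not_and_or.1 hz with h | h
    · rw [hf.eq_zero z h, zero_mul]
    · rw [hg.eq_zero z h, mul_zero]
  · rw [hf.eq_one z hz.1, hg.eq_one z hz.2, mul_one]
  · rw [deriv_fun_mul (hf.smooth.differentiable (by simp) z) (hg.smooth.differentiable (by simp) z)]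
    refine (abs_add_le _ _).trans ?_
    rw [abs_mul, abs_mul, abs_of_nonneg (hf.nonneg z), abs_of_nonneg (hg.nonneg z)]
    have h1 := mul_le_mul (hf.abs_deriv_le z) (hg.le_one z) (hg.nonneg z)
      ((abs_nonneg _).trans (hf.abs_deriv_le z))
    have h2 := mul_le_mul (hf.le_one z) (hg.abs_deriv_le z) (abs_nonneg _) zero_le_one
    linarith

lemma IsCutoff.mono {f : ℝ → ℝ} {I J I' J' : Set ℝ} {C C' : ℝ} (hf : IsCutoff f I J C)
    (hI : I ⊆ I') (hJ : J' ⊆ J) (hC : C ≤ C') : IsCutoff f I' J' C' :=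
  ⟨hf.smooth, hf.nonneg, hf.le_one, fun z hz => hf.eq_zero z fun h => hz (hI h),
    fun z hz => hf.eq_one z (hJ hz), fun z => (hf.abs_deriv_le z).trans hC⟩

variable {E : Type} [NormedAddCommGroup E] [InnerProductSpace ℝ E] [FiniteDimensional ℝ E]

lemma norm_gradient_comp_snd_le {f : ℝ → ℝ} (hf : Differentiable ℝ f) (x : WithLp 2 (E × ℝ)) :
    ‖gradient (fun x : WithLp 2 (E × ℝ) => f x.snd) x‖ ≤ |deriv f x.snd| := by
  have h1 : HasFDerivAt (fun x : WithLp 2 (E × ℝ) => f x.snd)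
      ((fderiv ℝ f x.snd).comp (WithLp.sndL 2 ℝ E ℝ)) x :=
    (hf x.snd).hasFDerivAt.comp x (WithLp.sndL 2 ℝ E ℝ).hasFDerivAt
  have h2 : ‖gradient (fun x : WithLp 2 (E × ℝ) => f x.snd) x‖ =
      ‖fderiv ℝ (fun x : WithLp 2 (E × ℝ) => f x.snd) x‖ := by
    simp [gradient]
  rw [h2, h1.fderiv]
  refine ContinuousLinearMap.opNorm_le_bound _ (abs_nonneg _) fun v => ?_
  rw [ContinuousLinearMap.comp_apply]
  refine (ContinuousLinearMap.le_opNorm _ _).trans ?_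
  rw [norm_deriv_eq_norm_fderiv.symm, Real.norm_eq_abs]
  gcongr
  exact WithLp.norm_snd_le _ v

lemma IsCutoff.isMultiplier {f : ℝ → ℝ} {I J : Set ℝ} {C : ℝ} (hf : IsCutoff f I J C) :
    IsMultiplier (fun x : WithLp 2 (E × ℝ) => f x.snd) (max C 1) := by
  refine ⟨hf.smooth.comp (WithLp.sndL 2 ℝ E ℝ).contDiff, fun x => ?_, fun x => ?_⟩
  · rw [abs_of_nonneg (hf.nonneg _)]
    exact (hf.le_one _).trans (le_max_right _ _)
  · exact (norm_gradient_comp_snd_le (hf.smooth.differentiable (by simp)) x).trans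
      ((hf.abs_deriv_le _).trans (le_max_left _ _))

lemma IsCutoff.tsupport_subset {f : ℝ → ℝ} {I J : Set ℝ} {C : ℝ} (hf : IsCutoff f I J C)
    (hI : IsClosed I) {x : WithLp 2 (E × ℝ)}
    (hx : x ∈ tsupport fun x : WithLp 2 (E × ℝ) => f x.snd) : x.snd ∈ I := by
  have hc : Continuous fun x : WithLp 2 (E × ℝ) => x.snd := by fun_prop
  refine closure_minimal (fun y hy => ?_) (hI.preimage hc) hx
  by_contra h
  exact hy (hf.eq_zero _ h)

lemma IsCutoff.norm_gradient_sq_le {f : ℝ → ℝ} {I J : Set ℝ} {C : ℝ} (hf : IsCutoff f I J C)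
    (x : WithLp 2 (E × ℝ)) :
    ‖gradient (fun x : WithLp 2 (E × ℝ) => f x.snd) x‖ ^ 2 ≤
      (I \ J).indicator (fun _ => C ^ 2) x.snd := by
  have h1 := norm_gradient_comp_snd_le (hf.smooth.differentiable (by simp)) x
  by_cases hx : x.snd ∈ I \ J
  · rw [indicator_of_mem hx]
    exact pow_le_pow_left₀ (norm_nonneg _) (h1.trans (hf.abs_deriv_le _)) 2
  · rw [indicator_of_notMem hx]
    have h2 : x.snd ∉ I ∨ x.snd ∈ J := by
      by_contra h
      push Not at h
      exact hx h
    rw [hf.deriv_eq_zero h2, abs_zero] at h1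
    rw [le_antisymm h1 (norm_nonneg _)]
    simp

end Cutoff

/-! ### The lateral sides of the cylinders -/

section Sides

variable {E : Type} [NormedAddCommGroup E] [InnerProductSpace ℝ E]

/-- The closure of the lateral side of the part `Ω` of an infinite cylinder that lies in `G`, where
`Γ` contains the graphs that bound `G`, and `T` is the part of `Γ` inside the cylinder. The edges
`{x ∈ Γ | h⁻¹ x ∈ ∂ω}` belong to the closure, because they can be approached vertically within the
lateral surface. -/
lemma mem_closure_side_iff {ω : Set E} (hω : IsOpen ω) {h : ℝ} (hh : h ≠ 0)
    {G Γ Ω : Set (WithLp 2 (E × ℝ))}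
    (hG : IsOpen G) (hΓ : IsClosed Γ) (hGΓ : Disjoint G Γ) (hcl : closure G ⊆ G ∪ Γ)
    (happ : ∀ x ∈ Γ, x ∈ closure (G ∩ {y | y.fst = x.fst}))
    (hΩ : ∀ x, x ∈ Ω ↔ h⁻¹ • x.fst ∈ ω ∧ x ∈ G) {T : Set (WithLp 2 (E × ℝ))}
    (hT : ∀ x, x ∈ T ↔ h⁻¹ • x.fst ∈ ω ∧ x ∈ Γ) (x : WithLp 2 (E × ℝ)) :
    x ∈ closure (frontier Ω \ closure T) ↔ h⁻¹ • x.fst ∈ frontier ω ∧ x ∈ G ∪ Γ := by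
  have hfst : Continuous fun x : WithLp 2 (E × ℝ) => h⁻¹ • x.fst := by fun_prop
  have hΩo : IsOpen Ω := by
    have : Ω = (fun x : WithLp 2 (E × ℝ) => h⁻¹ • x.fst) ⁻¹' ω ∩ G := by
      ext x
      exact hΩ x
    rw [this]
    exact (hω.preimage hfst).inter hG
  have hTΓ : closure T ⊆ Γ := closure_minimal (fun x hx => ((hT x).1 hx).2) hΓ
  have hside : ∀ x ∈ G, h⁻¹ • x.fst ∈ frontier ω → x ∈ frontier Ω \ closure T := by
    intro x hxG hx
    rw [hω.frontier_eq] at hx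
    refine ⟨?_, fun hxT => Set.disjoint_left.1 hGΓ hxG (hTΓ hxT)⟩
    rw [hΩo.frontier_eq]
    refine ⟨?_, fun hxΩ => hx.2 ((hΩ x).1 hxΩ).1⟩
    -- moving `x` horizontally
    have hcurve : Continuous fun η : E => (WithLp.toLp 2 (h • η, x.snd) : WithLp 2 (E × ℝ)) := by
      fun_prop
    have hval : (WithLp.toLp 2 (h • h⁻¹ • x.fst, x.snd) : WithLp 2 (E × ℝ)) = x := by
      rw [smul_smul, mul_inv_cancel₀ hh, one_smul]
      rfl
    rw [mem_closure_iff_nhds]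
    intro V hV
    have hV' : ∀ᶠ y in 𝓝 x, y ∈ V ∩ G := inter_mem hV (hG.mem_nhds hxG)
    rw [← hval] at hV'
    have h1 := (hcurve.continuousAt (x := h⁻¹ • x.fst)).eventually hV'
    obtain ⟨η, hη, hηω⟩ := (mem_closure_iff_nhds.1 hx.1) _ h1
    refine ⟨_, hη.1, (hΩ _).2 ⟨?_, hη.2⟩⟩
    simpa [smul_smul, inv_mul_cancel₀ hh] using hηω
  constructor
  · have hclosed : IsClosed {x : WithLp 2 (E × ℝ) | h⁻¹ • x.fst ∈ frontier ω ∧ x ∈ G ∪ Γ} := by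
      have h1 : G ∪ Γ = closure G ∪ Γ :=
        Subset.antisymm (union_subset_union_left _ subset_closure) (union_subset hcl subset_union_right)
      rw [h1]
      exact (isClosed_frontier.preimage hfst).inter (isClosed_closure.union hΓ)
    refine fun hx => closure_minimal ?_ hclosed hx
    rintro x ⟨hx, hxT⟩
    rw [hΩo.frontier_eq] at hx
    have h1 : x ∈ G ∪ Γ := hcl (closure_mono (fun y hy => ((hΩ y).1 hy).2) hx.1)
    have h2 : h⁻¹ • x.fst ∈ closure ω :=
      map_mem_closure (f := fun x : WithLp 2 (E × ℝ) => h⁻¹ • x.fst) hfst hx.1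
        fun y hy => ((hΩ y).1 hy).1
    refine ⟨?_, h1⟩
    rw [hω.frontier_eq]
    refine ⟨h2, fun h3 => ?_⟩
    rcases h1 with h1 | h1
    · exact hx.2 ((hΩ x).2 ⟨h3, h1⟩)
    · exact hxT (subset_closure ((hT x).2 ⟨h3, h1⟩))
  · rintro ⟨hx, hxG | hxΓ⟩
    · exact subset_closure (hside x hxG hx)
    · refine closure_mono ?_ (happ x hxΓ)
      rintro y ⟨hy, hyx⟩
      exact hside y hy (by rwa [show y.fst = x.fst from hyx])

lemma isOpen_semi {ω : Set E} (hω : IsOpen ω) {H : E → ℝ} (hH : Continuous H) :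
    IsOpen (semi ω H) :=
  (hω.preimage (by fun_prop : Continuous fun x : WithLp 2 (E × ℝ) => x.fst)).inter
    (isOpen_lt (f := fun x : WithLp 2 (E × ℝ) => -H x.fst) (g := fun x => x.snd)
      (by fun_prop) (by fun_prop))

lemma isOpen_thin {ω : Set E} (hω : IsOpen ω) {Hp Hm : E → ℝ} (hHp : Continuous Hp)
    (hHm : Continuous Hm) (h : ℝ) : IsOpen (thin ω Hp Hm h) :=
  (hω.preimage (by fun_prop : Continuous fun x : WithLp 2 (E × ℝ) => h⁻¹ • x.fst)).inter
    ((isOpen_lt (f := fun x : WithLp 2 (E × ℝ) => x.snd)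
      (g := fun x => 1 + h * Hp (h⁻¹ • x.fst)) (by fun_prop) (by fun_prop)).inter
    (isOpen_lt (f := fun x : WithLp 2 (E × ℝ) => -x.snd)
      (g := fun x => 1 + h * Hm (h⁻¹ • x.fst)) (by fun_prop) (by fun_prop)))

lemma mem_closure_of_vertical {G : Set (WithLp 2 (E × ℝ))} {x : WithLp 2 (E × ℝ)} (c : ℝ)
    (hG : ∀ᶠ s in 𝓝[>] (0 : ℝ), (WithLp.toLp 2 (x.fst, x.snd + s * c) : WithLp 2 (E × ℝ)) ∈ G) :
    x ∈ closure (G ∩ {y | y.fst = x.fst}) := by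
  have hc : Continuous fun s : ℝ => (WithLp.toLp 2 (x.fst, x.snd + s * c) : WithLp 2 (E × ℝ)) := by
    fun_prop
  have h1 : Tendsto (fun s : ℝ => (WithLp.toLp 2 (x.fst, x.snd + s * c) : WithLp 2 (E × ℝ)))
      (𝓝[>] 0) (𝓝 x) := by
    have := (hc.tendsto 0).mono_left (nhdsWithin_le_nhds (s := Ioi (0 : ℝ)))
    rwa [zero_mul, add_zero, show (WithLp.toLp 2 (x.fst, x.snd) : WithLp 2 (E × ℝ)) = x from rfl] at this
  exact mem_closure_of_tendsto h1 (hG.mono fun s hs => ⟨hs, rfl⟩)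

lemma mem_closure_semiSide_iff {ω : Set E} (hω : IsOpen ω) {H : E → ℝ} (hH : Continuous H)
    (x : WithLp 2 (E × ℝ)) :
    x ∈ closure (semiSide ω H) ↔ x.fst ∈ frontier ω ∧ -H x.fst ≤ x.snd := by
  have key := mem_closure_side_iff hω one_ne_zero
    (G := {x : WithLp 2 (E × ℝ) | -H x.fst < x.snd}) (Γ := {x | x.snd = -H x.fst})
    (Ω := semi ω H) (T := semiEnd ω H) (isOpen_lt (by fun_prop) (by fun_prop))
    (isClosed_eq (by fun_prop) (by fun_prop))
    (Set.disjoint_left.2 fun x hx hx' => ne_of_gt hx hx')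
    ((closure_lt_subset_le (by fun_prop) (by fun_prop)).trans fun x (hx : -H x.fst ≤ x.snd) =>
      (lt_or_eq_of_le hx).imp id Eq.symm)
    (fun x hx => mem_closure_of_vertical 1 (by
      filter_upwards [self_mem_nhdsWithin] with s hs
      change -H x.fst < x.snd + s * 1
      rw [show x.snd = -H x.fst from hx]
      linarith [mem_Ioi.1 hs]))
    (fun x => by simp [semi]) (fun x => by simp [semiEnd]) x
  rw [semiSide, key, inv_one, one_smul]
  refine and_congr_right fun _ => ⟨fun hx => hx.elim (fun h => le_of_lt h) fun h => le_of_eq (Eq.symm h),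
    fun hx => (lt_or_eq_of_le hx).imp id Eq.symm⟩

lemma mem_closure_thinSide_iff {ω : Set E} (hω : IsOpen ω) {Hp Hm : E → ℝ} (hHp : Continuous Hp)
    (hHm : Continuous Hm) {h : ℝ} (hh : h ≠ 0)
    (hgap : ∀ η, 0 < 1 + h * Hp η ∧ 0 < 1 + h * Hm η) (x : WithLp 2 (E × ℝ)) :
    x ∈ closure (thinSide ω Hp Hm h) ↔ h⁻¹ • x.fst ∈ frontier ω ∧
      x.snd ≤ 1 + h * Hp (h⁻¹ • x.fst) ∧ -x.snd ≤ 1 + h * Hm (h⁻¹ • x.fst) := by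
  have c1 : Continuous fun x : WithLp 2 (E × ℝ) => x.snd := by fun_prop
  have c2 : Continuous fun x : WithLp 2 (E × ℝ) => 1 + h * Hp (h⁻¹ • x.fst) := by fun_prop
  have c3 : Continuous fun x : WithLp 2 (E × ℝ) => 1 + h * Hm (h⁻¹ • x.fst) := by fun_prop
  -- the next equivalence describes `G ∪ Γ`
  have hU : ∀ x : WithLp 2 (E × ℝ), x ∈ ({x | x.snd < 1 + h * Hp (h⁻¹ • x.fst)} ∩
      {x | -x.snd < 1 + h * Hm (h⁻¹ • x.fst)}) ∪ (({x | x.snd = 1 + h * Hp (h⁻¹ • x.fst)} ∪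
      {x | -x.snd = 1 + h * Hm (h⁻¹ • x.fst)}) : Set (WithLp 2 (E × ℝ))) ↔
      x.snd ≤ 1 + h * Hp (h⁻¹ • x.fst) ∧ -x.snd ≤ 1 + h * Hm (h⁻¹ • x.fst) := by
    intro x
    have h1 := hgap (h⁻¹ • x.fst)
    simp only [mem_union, mem_inter_iff, mem_ofPred_eq]
    constructor
    · rintro (⟨h2, h3⟩ | h2 | h2) <;> constructor <;> linarith
    · rintro ⟨h2, h3⟩
      rcases h2.lt_or_eq with h2 | h2
      · rcases h3.lt_or_eq with h3 | h3
        · exact Or.inl ⟨h2, h3⟩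
        · exact Or.inr (Or.inr h3)
      · exact Or.inr (Or.inl h2)
  have key := mem_closure_side_iff hω hh
    (Ω := thin ω Hp Hm h) (T := thinEnds ω Hp Hm h) ((isOpen_lt c1 c2).inter (isOpen_lt c1.neg c3))
    ((isClosed_eq c1 c2).union (isClosed_eq c1.neg c3))
    (Set.disjoint_left.2 fun x hx hx' => hx'.elim (ne_of_lt hx.1) (ne_of_lt hx.2))
    (fun x hx => (hU x).2 ?_) (fun x hx => ?_)
    (fun x => Iff.rfl) (fun x => ?_) x
  · exact key.trans (and_congr_right fun _ => hU x)
  · exact closure_minimal (t := {x : WithLp 2 (E × ℝ) | x.snd ≤ 1 + h * Hp (h⁻¹ • x.fst) ∧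
      -x.snd ≤ 1 + h * Hm (h⁻¹ • x.fst)}) (fun y hy => ⟨le_of_lt hy.1, le_of_lt hy.2⟩)
      ((isClosed_le c1 c2).inter (isClosed_le c1.neg c3)) hx
  · have h1 := hgap (h⁻¹ • x.fst)
    rcases hx with hx | hx
    · refine mem_closure_of_vertical (-1) ?_
      filter_upwards [self_mem_nhdsWithin, nhdsWithin_le_nhds (gt_mem_nhds h1.1)] with s hs hs'
      have hx' : x.snd = 1 + h * Hp (h⁻¹ • x.fst) := hx
      have hs : 0 < s := hs
      constructor
      · change x.snd + s * -1 < 1 + h * Hp (h⁻¹ • x.fst)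
        linarith
      · change -(x.snd + s * -1) < 1 + h * Hm (h⁻¹ • x.fst)
        linarith
    · refine mem_closure_of_vertical 1 ?_
      filter_upwards [self_mem_nhdsWithin, nhdsWithin_le_nhds (gt_mem_nhds h1.2)] with s hs hs'
      have hx' : -x.snd = 1 + h * Hm (h⁻¹ • x.fst) := hx
      have hs : 0 < s := hs
      constructor
      · change x.snd + s * 1 < 1 + h * Hp (h⁻¹ • x.fst)
        linarith
      · change -(x.snd + s * 1) < 1 + h * Hm (h⁻¹ • x.fst)
        linarith
  · simp only [thinEnds, mem_union, mem_ofPred_eq]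
    tauto

/-- The region on one side of the graph of a Lipschitz function is mapped into itself by the
translations along an open cone of directions. -/
lemma add_smul_mem_of_lipschitz {G : E → ℝ} {K : ℝ≥0} (hG : LipschitzWith K G) {ε : ℝ}
    (hε : ε ^ 2 = 1) {x : WithLp 2 (E × ℝ)} (hx : ε * x.snd < G x.fst) {w : WithLp 2 (E × ℝ)}
    (hw : w ∈ Metric.ball (WithLp.toLp 2 (0, -ε * (2 + 2 * K)) : WithLp 2 (E × ℝ)) 2) {s : ℝ}
    (hs : 0 ≤ s) : ε * (x + s • w).snd < G (x + s • w).fst := by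
  rw [Metric.mem_ball, dist_eq_norm] at hw
  have h1 := (WithLp.norm_fst_le _ (w - WithLp.toLp 2 (0, -ε * (2 + 2 * (K : ℝ))))).trans hw.le
  have h2 := (WithLp.norm_snd_le _ (w - WithLp.toLp 2 (0, -ε * (2 + 2 * (K : ℝ))))).trans hw.le
  simp only [WithLp.sub_fst, WithLp.sub_snd, Real.norm_eq_abs] at h1 h2
  have h1 : ‖w.fst‖ ≤ 2 := by simpa using h1
  have h3 := hG.dist_le_mul x.fst (x + s • w).fst
  rw [dist_eq_norm, dist_eq_norm, Real.norm_eq_abs] at h3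
  have h4 : ‖x.fst - (x + s • w).fst‖ = s * ‖w.fst‖ := by
    simp [norm_smul, abs_of_nonneg hs]
  rw [h4] at h3
  have h5 := (abs_le.1 h3).2
  have h6 : |ε| = 1 := by
    rw [← sq_eq_sq₀ (abs_nonneg _) zero_le_one, sq_abs, hε, one_pow]
  have h7 : |ε * (w.snd - -ε * (2 + 2 * K))| ≤ 2 := by rwa [abs_mul, h6, one_mul]
  have h8 : ε * (w.snd - -ε * (2 + 2 * K)) = ε * w.snd + (2 + 2 * K) := by
    linear_combination (2 + 2 * (K : ℝ)) * hε
  rw [h8] at h7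
  have h9 := (abs_le.1 h7).2
  simp only [WithLp.add_fst, WithLp.add_snd, WithLp.smul_fst, WithLp.smul_snd, smul_eq_mul] at h5 ⊢
  have h10 : (K : ℝ) * (s * ‖w.fst‖) ≤ s * (2 * K) := by
    have := mul_le_mul_of_nonneg_left h1 (mul_nonneg K.coe_nonneg hs)
    linarith
  have h11 : s * (ε * w.snd) ≤ s * (-(2 * K)) := mul_le_mul_of_nonneg_left (by linarith) hs
  linarith

end Sides

/-! ### Localization with a partition of unity -/

section Weights

variable {F : Type} [NormedAddCommGroup F] [InnerProductSpace ℝ F] [FiniteDimensional ℝ F]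
  [MeasurableSpace F] [BorelSpace F]

lemma norm_sq_eq_integral {G : Type*} [NormedAddCommGroup G] [InnerProductSpace ℝ G]
    {μ : Measure F} (f : Lp G 2 μ) :
    ‖f‖ ^ 2 = ∫ x, ‖f x‖ ^ 2 ∂μ ∧ Integrable (fun x => ‖f x‖ ^ 2) μ := by
  have h1 := L2.integrable_inner (𝕜 := ℝ) f f
  simp only [real_inner_self_eq_norm_sq] at h1
  refine ⟨?_, h1⟩
  rw [← real_inner_self_eq_norm_sq, L2.inner_def]
  simp only [real_inner_self_eq_norm_sq]

lemma norm_sq_snd_mul_le {Ω : Set F} {χ κ : F → ℝ} {c : ℝ} (h1 : ∀ x, |χ x| ≤ 1)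
    (h2 : ∀ x, ‖gradient χ x‖ ≤ c * |κ x|) {U V W : L2Pair Ω}
    (hV : V.fst =ᵐ[volume.restrict Ω] fun x => κ x * U.fst x)
    (hW : W.snd =ᵐ[volume.restrict Ω] fun x => χ x • U.snd x + U.fst x • gradient χ x) {s : ℝ}
    (hs : 0 < s) :
    ‖W.snd‖ ^ 2 ≤ (1 + s) * ‖U.snd‖ ^ 2 + (1 + s⁻¹) * c ^ 2 * ‖V.fst‖ ^ 2 := by
  obtain ⟨e1, i1⟩ := norm_sq_eq_integral W.snd
  obtain ⟨e2, i2⟩ := norm_sq_eq_integral U.snd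
  obtain ⟨e3, i3⟩ := norm_sq_eq_integral V.fst
  rw [e1, e2, e3, ← integral_const_mul, ← integral_const_mul,
    ← integral_add (i2.const_mul _) (i3.const_mul _)]
  refine integral_mono_ae i1 ((i2.const_mul _).add (i3.const_mul _)) ?_
  filter_upwards [hV, hW] with x hx1 hx2
  rw [hx1, hx2]
  have n1 : ‖χ x • U.snd x‖ ≤ ‖U.snd x‖ := by
    rw [norm_smul]
    exact mul_le_of_le_one_left (norm_nonneg _) (h1 x)
  have n2 : ‖U.fst x • gradient χ x‖ ≤ c * ‖κ x * U.fst x‖ := by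
    rw [norm_smul, norm_mul, Real.norm_eq_abs (κ x)]
    nlinarith [mul_le_mul_of_nonneg_left (h2 x) (norm_nonneg (U.fst x))]
  have n3 := (norm_add_le (χ x • U.snd x) (U.fst x • gradient χ x)).trans (add_le_add n1 n2)
  have n4 := pow_le_pow_left₀ (norm_nonneg _) n3 2
  refine n4.trans ?_
  set a := ‖U.snd x‖
  set b := c * ‖κ x * U.fst x‖ with hb
  have h5 : (1 + s⁻¹) * c ^ 2 * ‖κ x * U.fst x‖ ^ 2 = (1 + s⁻¹) * b ^ 2 := by rw [hb]; ring
  rw [h5]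
  have h6 : (1 + s) * a ^ 2 + (1 + s⁻¹) * b ^ 2 - (a + b) ^ 2 = s * (a - s⁻¹ * b) ^ 2 := by
    field_simp
    ring
  nlinarith [mul_nonneg hs.le (sq_nonneg (a - s⁻¹ * b))]

lemma norm_sq_snd_mul_le_two {Ω : Set F} {χ : F → ℝ} {c : ℝ} (h1 : ∀ x, |χ x| ≤ 1)
    (h2 : ∀ x, ‖gradient χ x‖ ≤ c) {U W : L2Pair Ω}
    (hW : W.snd =ᵐ[volume.restrict Ω] fun x => χ x • U.snd x + U.fst x • gradient χ x) :
    ‖W.snd‖ ^ 2 ≤ 2 * ‖U.snd‖ ^ 2 + 2 * c ^ 2 * ‖U.fst‖ ^ 2 := by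
  have h3 : U.fst =ᵐ[volume.restrict Ω] fun x => (1 : ℝ) * U.fst x := by simp
  have := norm_sq_snd_mul_le (κ := fun _ => 1) h1 (fun x => by simpa using h2 x) h3 hW one_pos
  rw [inv_one, one_add_one_eq_two] at this
  exact this

lemma norm_sq_fst_le_add {Ω : Set F} {χ κ : F → ℝ} (h : ∀ x, 1 ≤ χ x ^ 2 + κ x ^ 2)
    {U V W : L2Pair Ω} (hV : V.fst =ᵐ[volume.restrict Ω] fun x => χ x * U.fst x)
    (hW : W.fst =ᵐ[volume.restrict Ω] fun x => κ x * U.fst x) :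
    ‖U.fst‖ ^ 2 ≤ ‖V.fst‖ ^ 2 + ‖W.fst‖ ^ 2 := by
  obtain ⟨e1, i1⟩ := norm_sq_eq_integral U.fst
  obtain ⟨e2, i2⟩ := norm_sq_eq_integral V.fst
  obtain ⟨e3, i3⟩ := norm_sq_eq_integral W.fst
  rw [e1, e2, e3, ← integral_add i2 i3]
  refine integral_mono_ae i1 (i2.add i3) ?_
  filter_upwards [hV, hW] with x hx1 hx2
  simp only [hx1, hx2, Real.norm_eq_abs, sq_abs]
  nlinarith [mul_le_mul_of_nonneg_right (h x) (sq_nonneg (U.fst x))]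

/-- Far parts `A U` with energy above `μ` and near parts `B U` subject to a compactness estimate
give coercivity below `μ`. -/
lemma coerciveModFinite_of_far_near {Ω S : Set F} {A B : L2Pair Ω →L[ℝ] L2Pair Ω} {μ t C : ℝ}
    (ht : 0 < t) (htμ : t < μ) (hpart : ∀ U, ‖U.fst‖ ^ 2 ≤ ‖(A U).fst‖ ^ 2 + ‖(B U).fst‖ ^ 2)
    (hfar : ∀ U ∈ sobolev Ω S, μ * ‖(A U).fst‖ ^ 2 ≤ ‖(A U).snd‖ ^ 2)
    (henA : ∀ U, ∀ s > 0, ‖(A U).snd‖ ^ 2 ≤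
      (1 + s) * ‖U.snd‖ ^ 2 + (1 + s⁻¹) * C ^ 2 * ‖(B U).fst‖ ^ 2)
    (henB : ∀ U, ‖(B U).snd‖ ^ 2 ≤ 2 * ‖U.snd‖ ^ 2 + 2 * C ^ 2 * ‖U.fst‖ ^ 2)
    (hnear : ∀ ε > 0, ∃ (k : ℕ) (ℓ : Fin k → L2Pair Ω →L[ℝ] ℝ), ∀ U ∈ sobolev Ω S,
      ‖(B U).fst‖ ^ 2 ≤ ε * ‖(B U).snd‖ ^ 2 + ∑ j, ℓ j U ^ 2) :
    CoerciveModFinite Ω S t := by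
  have hμ0 : 0 < μ := ht.trans htμ
  -- chosen such that `(μ - δ) / (1 + 2 δ) = t`: the far part costs a factor `1 + δ` of the energy,
  -- and the near part is at most `δ` times the norm of `H¹` up to functionals
  set δ : ℝ := (μ - t) / (1 + 2 * t) with hδ
  have hδ0 : 0 < δ := div_pos (by linarith) (by linarith)
  have hδe : δ * (1 + 2 * t) = μ - t := div_mul_cancel₀ _ (by linarith)
  set M : ℝ := (1 + δ⁻¹) * C ^ 2 + μ with hM
  have hM0 : 0 < M := by positivity
  set ε : ℝ := δ / (M * (2 + 2 * C ^ 2)) with hε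
  have hε0 : 0 < ε := by positivity
  obtain ⟨k, ℓ, hℓ⟩ := hnear ε hε0
  obtain ⟨k', ℓ', hℓ'⟩ := exists_sum_sq_eq ℓ (Fin.elim0 : Fin 0 → _)
    (a := M * (1 + 2 * δ)⁻¹) (b := 0) (by positivity) le_rfl
  refine ⟨k', ℓ', fun U hU => ?_⟩
  rw [hℓ', zero_mul, add_zero]
  have e1 := hfar U hU
  have e2 := hℓ U hU
  have e3 := hpart U
  have e4 := henA U δ hδ0
  have e5 := henB U
  have hx0 : 0 ≤ ‖U.fst‖ ^ 2 := sq_nonneg _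
  have hb0 : 0 ≤ ‖U.snd‖ ^ 2 := sq_nonneg _
  generalize ‖U.fst‖ ^ 2 = x at *
  generalize ‖(A U).fst‖ ^ 2 = y at *
  generalize ‖(B U).fst‖ ^ 2 = w at *
  generalize ‖U.snd‖ ^ 2 = b at *
  generalize ∑ j, ℓ j U ^ 2 = Q at *
  have e6 : M * w ≤ δ * (b + x) + M * Q := by
    have h1 : w ≤ ε * ((2 + 2 * C ^ 2) * (b + x)) + Q := by
      refine e2.trans (add_le_add (mul_le_mul_of_nonneg_left (e5.trans ?_) hε0.le) le_rfl)
      nlinarith [mul_nonneg (sq_nonneg C) hb0]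
    calc M * w ≤ M * (ε * ((2 + 2 * C ^ 2) * (b + x)) + Q) := by gcongr
      _ = (M * (2 + 2 * C ^ 2) * ε) * (b + x) + M * Q := by ring
      _ = δ * (b + x) + M * Q := by
        rw [hε, mul_div_cancel₀ _ (by positivity : M * (2 + 2 * C ^ 2) ≠ 0)]
  have e7 : μ * x ≤ (1 + δ) * b + M * w := by
    have := mul_le_mul_of_nonneg_left e3 hμ0.le
    rw [hM]
    linarith
  have e8 : (1 + 2 * δ) * (t * x) ≤ (1 + 2 * δ) * b + M * Q := by
    have : (1 + 2 * δ) * (t * x) = μ * x - δ * x := by linear_combination x * hδe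
    rw [this]
    linarith
  have h12 : 0 < 1 + 2 * δ := by linarith
  calc t * x = (1 + 2 * δ)⁻¹ * ((1 + 2 * δ) * (t * x)) := by rw [inv_mul_cancel_left₀ h12.ne']
    _ ≤ (1 + 2 * δ)⁻¹ * ((1 + 2 * δ) * b + M * Q) := by gcongr
    _ = b + M * (1 + 2 * δ)⁻¹ * Q := by
      rw [mul_add, inv_mul_cancel_left₀ h12.ne']
      ring

/-- Two near parts that cover `Ω`, each subject to a compactness estimate, give coercivity at every
level. -/
lemma coerciveModFinite_of_near {Ω S : Set F} {A B : L2Pair Ω →L[ℝ] L2Pair Ω} {C : ℝ}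
    (hpart : ∀ U, ‖U.fst‖ ^ 2 ≤ ‖(A U).fst‖ ^ 2 + ‖(B U).fst‖ ^ 2)
    (henA : ∀ U, ‖(A U).snd‖ ^ 2 ≤ 2 * ‖U.snd‖ ^ 2 + 2 * C ^ 2 * ‖U.fst‖ ^ 2)
    (henB : ∀ U, ‖(B U).snd‖ ^ 2 ≤ 2 * ‖U.snd‖ ^ 2 + 2 * C ^ 2 * ‖U.fst‖ ^ 2)
    (hA : ∀ ε > 0, ∃ (k : ℕ) (ℓ : Fin k → L2Pair Ω →L[ℝ] ℝ), ∀ U ∈ sobolev Ω S,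
      ‖(A U).fst‖ ^ 2 ≤ ε * ‖(A U).snd‖ ^ 2 + ∑ j, ℓ j U ^ 2)
    (hB : ∀ ε > 0, ∃ (k : ℕ) (ℓ : Fin k → L2Pair Ω →L[ℝ] ℝ), ∀ U ∈ sobolev Ω S,
      ‖(B U).fst‖ ^ 2 ≤ ε * ‖(B U).snd‖ ^ 2 + ∑ j, ℓ j U ^ 2) (t : ℝ) :
    CoerciveModFinite Ω S t := by
  set T : ℝ := max t 1 with hT
  have hT0 : 0 < T := lt_of_lt_of_le one_pos (le_max_right _ _)
  -- chosen such that `1 - 4 ε C² = 4 ε T`: the near parts cost at most `4 ε` times the energy plus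
  -- `4 ε C² ‖u‖²`
  set ε : ℝ := (4 * C ^ 2 + 4 * T)⁻¹ with hε
  have hε0 : 0 < ε := by positivity
  have hεe : ε * (4 * C ^ 2 + 4 * T) = 1 := inv_mul_cancel₀ (by positivity)
  obtain ⟨k₁, ℓ₁, h₁⟩ := hA ε hε0
  obtain ⟨k₂, ℓ₂, h₂⟩ := hB ε hε0
  set N : ℝ := (4 * ε)⁻¹ with hN
  have hN0 : 0 < N := by positivity
  have hNe : N * (4 * ε) = 1 := inv_mul_cancel₀ (by positivity)
  have hNe' : N = C ^ 2 + T := by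
    rw [hN, hε]
    field_simp
  obtain ⟨k', ℓ', hℓ'⟩ := exists_sum_sq_eq ℓ₁ ℓ₂ hN0.le hN0.le
  refine ⟨k', ℓ', fun U hU => ?_⟩
  rw [hℓ']
  have e1 := h₁ U hU
  have e2 := h₂ U hU
  have e3 := hpart U
  have e4 := mul_le_mul_of_nonneg_left (henA U) hε0.le
  have e5 := mul_le_mul_of_nonneg_left (henB U) hε0.le
  have hx0 : 0 ≤ ‖U.fst‖ ^ 2 := sq_nonneg _
  have htT : t ≤ T := le_max_left _ _
  generalize ‖U.fst‖ ^ 2 = x at *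
  generalize ‖U.snd‖ ^ 2 = b at *
  generalize ∑ j, ℓ₁ j U ^ 2 = Q₁ at *
  generalize ∑ j, ℓ₂ j U ^ 2 = Q₂ at *
  have e6 : x ≤ 4 * ε * (b + C ^ 2 * x) + (Q₁ + Q₂) := by linarith
  have e7 := mul_le_mul_of_nonneg_left e6 hN0.le
  have e8 : N * (4 * ε * (b + C ^ 2 * x) + (Q₁ + Q₂)) = b + C ^ 2 * x + N * (Q₁ + Q₂) := by
    linear_combination (b + C ^ 2 * x) * hNe
  rw [e8] at e7
  have e9 : N * x = C ^ 2 * x + T * x := by rw [hNe']; ring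
  have e10 := mul_le_mul_of_nonneg_right htT hx0
  linarith

end Weights

/-! ### Coercivity in the cylinders -/

section Coercivity

variable {E : Type} [NormedAddCommGroup E] [InnerProductSpace ℝ E]

lemma isBounded_cylinder {ω : Set E} (hb : Bornology.IsBounded ω) {c : ℝ} (hc : c ≠ 0) (R : ℝ) :
    Bornology.IsBounded {x : WithLp 2 (E × ℝ) | c • x.fst ∈ ω ∧ |x.snd| ≤ R} := by
  obtain ⟨M, hM⟩ := isBounded_iff_forall_norm_le.1 hb
  refine isBounded_iff_forall_norm_le.2 ⟨|c|⁻¹ * M + R, fun x hx => ?_⟩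
  have h1 := hM _ hx.1
  rw [norm_smul, Real.norm_eq_abs] at h1
  have h2 : ‖x.fst‖ ≤ |c|⁻¹ * M := by
    rw [inv_mul_eq_div, le_div_iff₀ (abs_pos.2 hc)]
    linarith
  have h3 : ‖x‖ ≤ ‖x.fst‖ + ‖x.snd‖ := by
    rw [WithLp.prod_norm_eq_of_L2, Real.sqrt_le_left (by positivity)]
    nlinarith [norm_nonneg x.fst, norm_nonneg x.snd]
  have h4 : ‖x.snd‖ ≤ R := hx.2
  linarith

lemma mem_closure_semiSide_of_mem_frontier {ω : Set E} {H : E → ℝ} (hH : Continuous H)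
    {x : WithLp 2 (E × ℝ)} (hx : x ∈ frontier (semi ω H)) (h : -H x.fst < x.snd) :
    x ∈ closure (semiSide ω H) := by
  refine subset_closure ⟨hx, fun hx' => ?_⟩
  have h1 : x ∈ {x : WithLp 2 (E × ℝ) | x.snd = -H x.fst} :=
    closure_minimal (fun y hy => hy.2) (isClosed_eq (f := fun x : WithLp 2 (E × ℝ) => x.snd)
      (g := fun x => -H x.fst) (by fun_prop) (by fun_prop)) hx'
  exact h.ne' h1

lemma mem_closure_thinSide_of_mem_frontier {ω : Set E} {Hp Hm : E → ℝ} (hHp : Continuous Hp)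
    (hHm : Continuous Hm) {h : ℝ} {x : WithLp 2 (E × ℝ)} (hx : x ∈ frontier (thin ω Hp Hm h))
    (h1 : x.snd < 1 + h * Hp (h⁻¹ • x.fst)) (h2 : -x.snd < 1 + h * Hm (h⁻¹ • x.fst)) :
    x ∈ closure (thinSide ω Hp Hm h) := by
  refine subset_closure ⟨hx, fun hx' => ?_⟩
  rw [thinEnds, closure_union] at hx'
  rcases hx' with hx' | hx'
  · have h3 : x ∈ {x : WithLp 2 (E × ℝ) | x.snd = 1 + h * Hp (h⁻¹ • x.fst)} :=
      closure_minimal (fun y hy => hy.2) (isClosed_eq (f := fun x : WithLp 2 (E × ℝ) => x.snd)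
        (g := fun x => 1 + h * Hp (h⁻¹ • x.fst)) (by fun_prop) (by fun_prop)) hx'
    exact h1.ne h3
  · have h3 : x ∈ {x : WithLp 2 (E × ℝ) | -x.snd = 1 + h * Hm (h⁻¹ • x.fst)} :=
      closure_minimal (fun y hy => hy.2) (isClosed_eq (f := fun x : WithLp 2 (E × ℝ) => -x.snd)
        (g := fun x => 1 + h * Hm (h⁻¹ • x.fst)) (by fun_prop) (by fun_prop)) hx'
    exact h2.ne h3

variable [FiniteDimensional ℝ E] [MeasurableSpace E] [BorelSpace E]

/-- The essential spectrum of the semi-infinite cylinder does not reach below the first Dirichlet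
eigenvalue of the cross-section. -/
lemma coerciveModFinite_semi {ω : Set E} (hω : IsOpen ω) (hb : Bornology.IsBounded ω) {μ : ℝ}
    (hμ : IsLeast {t | IsEigenvalue ω (frontier ω) t} μ) {H : E → ℝ} {K : ℝ≥0}
    (hH : LipschitzWith K H) {a : ℝ} (ha : ∀ η, |H η| ≤ a) {t : ℝ} (ht : 0 < t) (htμ : t < μ) :
    CoerciveModFinite (semi ω H) (semiSide ω H) t := by
  obtain ⟨C, hC1, hC⟩ := exists_abs_deriv_smoothTransition_le
  have hΩ := isOpen_semi hω hH.continuous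
  have hf := isCutoff_smoothTransition hC 1 (-(a + 1))
  have hg := isCutoff_smoothTransition hC (-1) (a + 4)
  simp only [abs_one, one_mul, abs_neg] at hf hg
  -- `f` rises on `[a + 1, a + 2]`, and `g`, which falls on `[a + 3, a + 4]`, is `1` there
  set f : ℝ → ℝ := fun z => Real.smoothTransition (z + -(a + 1)) with hfd
  set g : ℝ → ℝ := fun z => Real.smoothTransition (-1 * z + (a + 4)) with hgd
  obtain ⟨A, hA, -⟩ := exists_multiplication (semiSide ω H) hΩ.measurableSet (hf.isMultiplier (E := E))
  obtain ⟨B, hB, -⟩ := exists_multiplication (semiSide ω H) hΩ.measurableSet (hg.isMultiplier (E := E))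
  have hIf : IsClosed {z : ℝ | 0 ≤ z + -(a + 1)} := isClosed_le (by fun_prop) (by fun_prop)
  have hIg : IsClosed {z : ℝ | 0 ≤ -1 * z + (a + 4)} := isClosed_le (by fun_prop) (by fun_prop)
  have hsuppf : ∀ x ∈ tsupport (fun x : WithLp 2 (E × ℝ) => f x.snd), a + 1 ≤ x.snd := fun x hx => by
    have : 0 ≤ x.snd + -(a + 1) := hf.tsupport_subset hIf hx
    linarith
  have hsuppg : ∀ x ∈ tsupport (fun x : WithLp 2 (E × ℝ) => g x.snd), x.snd ≤ a + 4 := fun x hx => by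
    have : 0 ≤ -1 * x.snd + (a + 4) := hg.tsupport_subset hIg hx
    linarith
  have hμ0 : 0 < μ := ht.trans htμ
  -- the far part, where the energy dominates `μ`
  have far : ∀ U ∈ sobolev (semi ω H) (semiSide ω H), μ * ‖(A U).fst‖ ^ 2 ≤ ‖(A U).snd‖ ^ 2 := by
    intro U hU
    have := norm_fst_le_of_cylinder hω hb hμ hμ0.le one_pos hΩ (hf.isMultiplier (E := E)).smooth
      (fun x hx => ?_) (fun x hx hxω => ?_) hA hU
    · simpa using this
    · rw [inv_one, one_smul]
      refine ⟨fun h => h.1, fun h => ⟨h, ?_⟩⟩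
      linarith [(abs_le.1 (ha x.fst)).1, hsuppf x hx]
    · rw [inv_one, one_smul] at hxω
      refine (mem_closure_semiSide_iff hω hH.continuous x).2 ⟨hxω, ?_⟩
      linarith [(abs_le.1 (ha x.fst)).1, hsuppf x hx]
  -- the near part, compact
  have near : ∀ ε > 0, ∃ (k : ℕ) (ℓ : Fin k → L2Pair (semi ω H) →L[ℝ] ℝ),
      ∀ U ∈ sobolev (semi ω H) (semiSide ω H),
      ‖(B U).fst‖ ^ 2 ≤ ε * ‖(B U).snd‖ ^ 2 + ∑ j, ℓ j U ^ 2 := by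
    intro ε hε
    refine exists_functionals (D := {x : WithLp 2 (E × ℝ) | -1 * x.snd < H x.fst})
      (B := {x | (1 : ℝ) • x.fst ∈ ω ∧ |x.snd| ≤ a + 4})
      (v := WithLp.toLp 2 (0, -(-1) * (2 + 2 * (K : ℝ)))) hΩ
      (isOpen_lt (f := fun x : WithLp 2 (E × ℝ) => -1 * x.snd) (g := fun x => H x.fst)
        (by fun_prop) (hH.continuous.comp (by fun_prop)))
      (fun x hx w hw s hs => add_smul_mem_of_lipschitz hH (by norm_num) hx hw hs)
      (isBounded_cylinder hb one_ne_zero _) (hg.isMultiplier (E := E)).smooth (fun x hx hxf _ => ?_)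
      (fun x hx hxs => ?_) hB hε
    · refine mem_closure_semiSide_of_mem_frontier hH.continuous hxf ?_
      have : -1 * x.snd < H x.fst := hx
      linarith
    · have h1 := hx.2
      have h2 := hsuppg x hxs
      refine ⟨?_, by simpa using hx.1, abs_le.2 ⟨?_, h2⟩⟩
      · change -1 * x.snd < H x.fst
        linarith
      · linarith [(abs_le.1 (ha x.fst)).2]
  have hpart : ∀ x : WithLp 2 (E × ℝ), 1 ≤ f x.snd ^ 2 + g x.snd ^ 2 := by
    intro x
    rcases le_total (a + 2) x.snd with h | h
    · have : f x.snd = 1 := hf.eq_one _ (by change 1 ≤ x.snd + -(a + 1); linarith)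
      rw [this]
      nlinarith [sq_nonneg (g x.snd)]
    · have : g x.snd = 1 := hg.eq_one _ (by change 1 ≤ -1 * x.snd + (a + 4); linarith)
      rw [this]
      nlinarith [sq_nonneg (f x.snd)]
  have hgradf : ∀ x : WithLp 2 (E × ℝ),
      ‖gradient (fun x : WithLp 2 (E × ℝ) => f x.snd) x‖ ≤ C * |g x.snd| := by
    intro x
    have h1 := hf.norm_gradient_sq_le x
    by_cases hx : x.snd ∈ {z : ℝ | 0 ≤ z + -(a + 1)} \ {z | 1 ≤ z + -(a + 1)}
    · have h3 : ¬ 1 ≤ x.snd + -(a + 1) := hx.2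
      have h2 : g x.snd = 1 := hg.eq_one _ (by change 1 ≤ -1 * x.snd + (a + 4); linarith)
      rw [indicator_of_mem hx] at h1
      rw [h2, abs_one, mul_one]
      exact abs_le_of_sq_le_sq' h1 (by linarith) |>.2
    · rw [indicator_of_notMem hx] at h1
      have h2 : ‖gradient (fun x : WithLp 2 (E × ℝ) => f x.snd) x‖ = 0 := by
        have := sq_nonneg ‖gradient (fun x : WithLp 2 (E × ℝ) => f x.snd) x‖
        exact pow_eq_zero_iff two_ne_zero |>.1 (le_antisymm h1 this)
      rw [h2]
      positivity
  have energy : ∀ U, ‖(B U).snd‖ ^ 2 ≤ 2 * ‖U.snd‖ ^ 2 + 2 * C ^ 2 * ‖U.fst‖ ^ 2 := fun U =>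
    norm_sq_snd_mul_le_two (fun x => by rw [abs_of_nonneg (hg.nonneg _)]; exact hg.le_one _)
      (fun x => (norm_gradient_comp_snd_le (hg.smooth.differentiable (by simp)) x).trans
        (hg.abs_deriv_le _)) (hB U).2
  exact coerciveModFinite_of_far_near ht htμ (fun U => norm_sq_fst_le_add hpart (hA U).1 (hB U).1) far
    (fun U δ hδ => norm_sq_snd_mul_le (fun x => by rw [abs_of_nonneg (hf.nonneg _)]; exact hf.le_one _)
      hgradf (hB U).1 (hA U).2 hδ) energy near

/-- The compactness estimate for the half `e z ≥ -1/2` of the thin cylinder, `e = ±1`. -/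
lemma exists_functionals_half {ω : Set E} (hb : Bornology.IsBounded ω) {h : ℝ} (hh : h ≠ 0)
    {Ω S : Set (WithLp 2 (E × ℝ))} (hΩ : IsOpen Ω) {G : E → ℝ} {K : ℝ≥0} (hG : LipschitzWith K G)
    {e R : ℝ} (he : e ^ 2 = 1) (hΩG : ∀ x ∈ Ω, e * x.snd < G x.fst ∧ h⁻¹ • x.fst ∈ ω ∧ |x.snd| ≤ R)
    (hS : ∀ x ∈ frontier Ω, e * x.snd < G x.fst → -(1 / 2) ≤ e * x.snd → x ∈ closure S)
    {C : ℝ} (hC : ∀ x, |deriv Real.smoothTransition x| ≤ C) :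
    ∃ A : L2Pair Ω →L[ℝ] L2Pair Ω,
      (∀ U, (A U).fst =ᵐ[volume.restrict Ω]
        fun x => Real.smoothTransition (2 * e * x.snd + 1) * U.fst x) ∧
      (∀ U, ‖(A U).snd‖ ^ 2 ≤ 2 * ‖U.snd‖ ^ 2 + 2 * (2 * C) ^ 2 * ‖U.fst‖ ^ 2) ∧
      ∀ ε > 0, ∃ (k : ℕ) (ℓ : Fin k → L2Pair Ω →L[ℝ] ℝ), ∀ U ∈ sobolev Ω S,
        ‖(A U).fst‖ ^ 2 ≤ ε * ‖(A U).snd‖ ^ 2 + ∑ j, ℓ j U ^ 2 := by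
  have he1 : |2 * e| = 2 := by
    have : |e| = 1 := by rw [← sq_eq_sq₀ (abs_nonneg _) zero_le_one, sq_abs, he, one_pow]
    rw [abs_mul, this, abs_two, mul_one]
  have hf := isCutoff_smoothTransition hC (2 * e) 1
  rw [he1] at hf
  obtain ⟨A, hA, -⟩ := exists_multiplication S hΩ.measurableSet (hf.isMultiplier (E := E))
  have hsupp : ∀ x ∈ tsupport (fun x : WithLp 2 (E × ℝ) =>
      Real.smoothTransition (2 * e * x.snd + 1)), -(1 / 2) ≤ e * x.snd := fun x hx => by
    have : 0 ≤ 2 * e * x.snd + 1 :=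
      hf.tsupport_subset (isClosed_le (by fun_prop) (by fun_prop)) hx
    linarith
  refine ⟨A, fun U => (hA U).1, fun U => norm_sq_snd_mul_le_two
    (fun x => by rw [abs_of_nonneg (hf.nonneg _)]; exact hf.le_one _)
      (fun x => (norm_gradient_comp_snd_le (hf.smooth.differentiable (by simp)) x).trans
        (hf.abs_deriv_le _)) (hA U).2, fun ε hε => ?_⟩
  refine exists_functionals (D := {x : WithLp 2 (E × ℝ) | e * x.snd < G x.fst})
    (B := {x | h⁻¹ • x.fst ∈ ω ∧ |x.snd| ≤ R})
    (v := WithLp.toLp 2 (0, -e * (2 + 2 * (K : ℝ)))) hΩ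
    (isOpen_lt (f := fun x : WithLp 2 (E × ℝ) => e * x.snd) (g := fun x => G x.fst)
      (by fun_prop) (hG.continuous.comp (by fun_prop)))
    (fun x hx w hw s hs => add_smul_mem_of_lipschitz hG he hx hw hs)
    (isBounded_cylinder hb (inv_ne_zero hh) _) (hf.isMultiplier (E := E)).smooth
    (fun x hx hxf hxs => hS x hxf hx (hsupp x hxs))
    (fun x hx _ => ⟨(hΩG x hx).1, (hΩG x hx).2⟩) hA hε

lemma lipschitzWith_scaled {H : E → ℝ} {K : ℝ≥0} (hH : LipschitzWith K H) {h : ℝ} (hh : 0 < h) :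
    LipschitzWith K fun y => 1 + h * H (h⁻¹ • y) := by
  refine LipschitzWith.of_dist_le_mul fun x y => ?_
  have h1 := hH.dist_le_mul (h⁻¹ • x) (h⁻¹ • y)
  rw [dist_eq_norm, dist_eq_norm, ← smul_sub, norm_smul, norm_inv, Real.norm_of_nonneg hh.le] at h1
  rw [dist_eq_norm, dist_eq_norm, add_sub_add_left_eq_sub, ← mul_sub, norm_mul,
    Real.norm_of_nonneg hh.le]
  calc h * ‖H (h⁻¹ • x) - H (h⁻¹ • y)‖ ≤ h * (K * (h⁻¹ * ‖x - y‖)) := by gcongr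
    _ = K * ‖x - y‖ := by field_simp

/-- The thin cylinder has empty essential spectrum. Each of its two halves has a Lipschitz graph as
its free boundary. -/
lemma coerciveModFinite_thin {ω : Set E} (hω : IsOpen ω) (hb : Bornology.IsBounded ω)
    {Hp Hm : E → ℝ} {Kp Km : ℝ≥0} (hHp : LipschitzWith Kp Hp) (hHm : LipschitzWith Km Hm) {a : ℝ}
    (hap : ∀ η, |Hp η| ≤ a) (ham : ∀ η, |Hm η| ≤ a) {h : ℝ} (hh : 0 < h) (hha : h * a ≤ 1 / 4)
    (t : ℝ) : CoerciveModFinite (thin ω Hp Hm h) (thinSide ω Hp Hm h) t := by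
  obtain ⟨C, hC1, hC⟩ := exists_abs_deriv_smoothTransition_le
  have hΩ := isOpen_thin hω hHp.continuous hHm.continuous h
  have bd : ∀ {H : E → ℝ}, (∀ η, |H η| ≤ a) → ∀ η, |h * H η| ≤ 1 / 4 := fun hH η => by
    rw [abs_mul, abs_of_pos hh]
    exact (mul_le_mul_of_nonneg_left (hH η) hh.le).trans hha
  have hR : ∀ x ∈ thin ω Hp Hm h, |x.snd| ≤ 2 := fun x hx => by
    have h1 := (abs_le.1 (bd hap (h⁻¹ • x.fst))).2
    have h2 := (abs_le.1 (bd ham (h⁻¹ • x.fst))).2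
    have h3 := hx.2.1
    have h4 := hx.2.2
    exact abs_le.2 ⟨by linarith, by linarith⟩
  obtain ⟨A, hA1, hA2, hA3⟩ := exists_functionals_half (S := thinSide ω Hp Hm h) (R := 2) (e := 1)
    hb hh.ne' hΩ
    (lipschitzWith_scaled hHp hh) (by norm_num)
    (fun x hx => ⟨by rw [one_mul]; exact hx.2.1, hx.1, hR x hx⟩)
    (fun x hx h1 h2 => mem_closure_thinSide_of_mem_frontier hHp.continuous hHm.continuous hx
      (by linarith) (by linarith [(abs_le.1 (bd ham (h⁻¹ • x.fst))).1])) hC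
  obtain ⟨B, hB1, hB2, hB3⟩ := exists_functionals_half (S := thinSide ω Hp Hm h) (R := 2) (e := -1)
    hb hh.ne' hΩ
    (lipschitzWith_scaled hHm hh) (by norm_num)
    (fun x hx => ⟨by rw [neg_one_mul]; exact hx.2.2, hx.1, hR x hx⟩)
    (fun x hx h1 h2 => mem_closure_thinSide_of_mem_frontier hHp.continuous hHm.continuous hx
      (by linarith [(abs_le.1 (bd hap (h⁻¹ • x.fst))).1]) (by linarith)) hC
  refine coerciveModFinite_of_near (fun U => norm_sq_fst_le_add (fun x => ?_) (hA1 U) (hB1 U))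
    hA2 hB2 hA3 hB3 t
  rcases le_total 0 x.snd with hx | hx
  · rw [Real.smoothTransition.one_of_one_le (by linarith : 1 ≤ 2 * 1 * x.snd + 1)]
    nlinarith [sq_nonneg (Real.smoothTransition (2 * -1 * x.snd + 1))]
  · rw [Real.smoothTransition.one_of_one_le (by linarith : 1 ≤ 2 * -1 * x.snd + 1)]
    nlinarith [sq_nonneg (Real.smoothTransition (2 * 1 * x.snd + 1))]

/-- `0` is not in the spectrum of the semi-infinite cylinder: a slanted translation moves the
cylinder off itself without crossing the curved end. -/
lemma exists_poincare_semi [Nontrivial E] {ω : Set E} (hω : IsOpen ω) (hb : Bornology.IsBounded ω)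
    {H : E → ℝ} {K : ℝ≥0} (hH : LipschitzWith K H) :
    ∃ c : ℝ, ∀ U ∈ sobolev (semi ω H) (semiSide ω H), ‖U.fst‖ ^ 2 ≤ c * ‖U.snd‖ ^ 2 := by
  obtain ⟨M, hM⟩ := isBounded_iff_forall_norm_le.1 hb
  -- a horizontal shift longer than the diameter, lifted at the slope `K` of the end
  obtain ⟨v, hv⟩ := exists_norm_eq E (abs_nonneg (2 * M + 1))
  have hvM : 2 * M + 1 ≤ ‖v‖ := hv ▸ le_abs_self _
  refine ⟨‖(WithLp.toLp 2 (v, K * ‖v‖) : WithLp 2 (E × ℝ))‖ ^ 2, fun U hU => ?_⟩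
  refine norm_fst_le_of_translate (D := {x : WithLp 2 (E × ℝ) | -H x.fst < x.snd})
    (isOpen_semi hω hH.continuous)
    (isOpen_lt (f := fun x : WithLp 2 (E × ℝ) => -H x.fst) (g := fun x => x.snd)
      ((hH.continuous.comp (by fun_prop)).neg) (by fun_prop)) (fun x hx => hx.2)
    (fun x hx hxf => mem_closure_semiSide_of_mem_frontier hH.continuous hxf hx) (fun x hx t ht _ => ?_)
    (fun x hx hx' => ?_) hU
  · have h1 := hH.dist_le_mul (x.fst + t • v) x.fst
    rw [dist_eq_norm, dist_eq_norm, Real.norm_eq_abs, add_sub_cancel_left, norm_smul,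
      Real.norm_of_nonneg ht] at h1
    have hx' : -H x.fst < x.snd := hx
    change -H (x.fst + t • v) < x.snd + t * (K * ‖v‖)
    linarith [(abs_le.1 h1).1]
  · have h1 := hM _ hx.1
    have h2 : ‖x.fst + v‖ ≤ M := hM _ hx'.1
    have h3 := norm_sub_le (x.fst + v) x.fst
    rw [add_sub_cancel_left] at h3
    linarith

end Coercivity

/-! ### Infinite dimension of `H̊¹` -/

section Sequence

variable {F : Type} [NormedAddCommGroup F] [InnerProductSpace ℝ F] [FiniteDimensional ℝ F]
  [MeasurableSpace F] [BorelSpace F]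

/-- `H̊¹(Ω; S)` contains infinitely many orthonormal functions: bumps with disjoint supports. -/
lemma exists_orthonormal_mem_sobolev [Nontrivial F] {Ω S : Set F} (hΩ : IsOpen Ω) (hne : Ω.Nonempty)
    (hS : Disjoint Ω (closure S)) : ∃ φ : ℕ → L2Pair Ω, (∀ k, φ k ∈ sobolev Ω S) ∧
      ∀ j k, ⟪(φ j).fst, (φ k).fst⟫ = if j = k then 1 else 0 := by
  obtain ⟨x₀, hx₀⟩ := hne
  have : Infinite Ω := by
    have : (𝓝[≠] x₀).NeBot := Module.punctured_nhds_neBot ℝ F x₀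
    exact (infinite_of_mem_nhds x₀ (hΩ.mem_nhds hx₀)).to_subtype
  obtain ⟨V, hV1, hV0, hV2⟩ := exists_seq_infinite_isOpen_pairwise_disjoint Ω
  have hbump : ∀ k, ∃ f : F → ℝ, ContDiff ℝ (⊤ : ℕ∞) f ∧ HasCompactSupport f ∧
      tsupport f ⊆ Subtype.val '' V k ∧ ∃ x ∈ Ω, f x ≠ 0 := by
    intro k
    obtain ⟨x, hx⟩ := (hV1 k).nonempty
    have ho : IsOpen (Subtype.val '' V k) := hΩ.isOpenMap_subtype_val _ (hV0 k)
    obtain ⟨f, hf1, hf2, hf3, -, hf5⟩ := exists_contDiff_tsupport_subset (n := ⊤)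
      (ho.mem_nhds (mem_image_of_mem _ hx))
    exact ⟨f, hf3, hf2, hf1, x, x.2, by rw [hf5]; exact one_ne_zero⟩
  choose f hf1 hf2 hf3 hf4 using hbump
  have m1 : ∀ k, MemLp (f k) 2 (volume.restrict Ω) := fun k =>
    ((hf1 k).continuous.memLp_of_hasCompactSupport (hf2 k)).restrict Ω
  have m2 : ∀ k, MemLp (gradient (f k)) 2 (volume.restrict Ω) := fun k => by
    refine (((hf1 k).continuous_gradient (by exact_mod_cast le_top)).memLp_of_hasCompactSupport
      ?_).restrict Ω
    exact IsCompact.of_isClosed_subset (hf2 k) (isClosed_tsupport _) (tsupport_gradient_subset _)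
  let ψ : ℕ → L2Pair Ω := fun k => WithLp.toLp 2 ((m1 k).toLp, (m2 k).toLp)
  have hψ : ∀ k, ψ k ∈ sobolev Ω S := fun k => by
    refine Submodule.le_topologicalClosure _ ⟨f k, hf1 k, hf2 k, ?_, (m1 k).coeFn_toLp,
      (m2 k).coeFn_toLp⟩
    exact hS.mono_left ((hf3 k).trans (image_subset_iff.2 fun x _ => x.2))
  have hin : ∀ j k, ⟪(ψ j).fst, (ψ k).fst⟫ = ∫ x in Ω, f j x * f k x := fun j k => by
    rw [L2.inner_def]
    refine integral_congr_ae ?_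
    filter_upwards [(m1 j).coeFn_toLp, (m1 k).coeFn_toLp] with x h1 h2
    change ⟪(m1 j).toLp _ x, (m1 k).toLp _ x⟫ = _
    rw [h1, h2, inner_eq_mul_real]
  have hpos : ∀ k, 0 < ‖(ψ k).fst‖ := fun k => by
    rw [norm_pos_iff]
    intro h0
    have h1 : f k =ᵐ[volume.restrict Ω] fun _ => 0 := by
      have h2 : (m1 k).toLp (f k) = 0 := h0
      exact (m1 k).coeFn_toLp.symm.trans (h2 ▸ Lp.coeFn_zero _ _ _)
    have h3 := Measure.eqOn_open_of_ae_eq h1 hΩ (hf1 k).continuous.continuousOn continuousOn_const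
    obtain ⟨x, hx, hx'⟩ := hf4 k
    exact hx' (h3 hx)
  refine ⟨fun k => ‖(ψ k).fst‖⁻¹ • ψ k, fun k => Submodule.smul_mem _ _ (hψ k), fun j k => ?_⟩
  simp only [WithLp.smul_fst, real_inner_smul_left, real_inner_smul_right]
  split_ifs with hjk
  · subst hjk
    rw [real_inner_self_eq_norm_sq]
    have := (hpos j).ne'
    field_simp
  · have : ⟪(ψ j).fst, (ψ k).fst⟫ = 0 := by
      rw [hin]
      refine integral_eq_zero_of_ae (ae_of_all _ fun x => ?_)
      have hd : Disjoint (Subtype.val '' V j) (Subtype.val '' V k) :=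
        (Set.disjoint_image_iff Subtype.val_injective).2 (hV2 hjk)
      by_contra hne
      have hne' : f j x * f k x ≠ 0 := hne
      exact Set.disjoint_left.1 hd (hf3 j (subset_tsupport _ (left_ne_zero_of_mul hne')))
        (hf3 k (subset_tsupport _ (right_ne_zero_of_mul hne')))
    rw [this]
    simp

end Sequence

/-! ### Exponential decay below the threshold -/

section Decay

variable {E : Type} [NormedAddCommGroup E] [InnerProductSpace ℝ E] [FiniteDimensional ℝ E]
  [MeasurableSpace E] [BorelSpace E] {Ω S : Set (WithLp 2 (E × ℝ))}

/-- The part of `‖u‖²` that sits at the heights `z ∈ J`. -/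
noncomputable def mass (U : L2Pair Ω) (J : Set ℝ) : ℝ :=
  ∫ x in Ω, J.indicator (fun _ => U.fst x ^ 2) x.snd

lemma integrable_mass (U : L2Pair Ω) {J : Set ℝ} (hJ : MeasurableSet J) :
    IntegrableOn (fun x => J.indicator (fun _ => U.fst x ^ 2) x.snd) Ω := by
  have hc : Continuous fun x : WithLp 2 (E × ℝ) => x.snd := by fun_prop
  have h1 := (norm_sq_eq_integral U.fst).2.indicator (hJ.preimage hc.measurable)
  refine h1.congr (ae_of_all _ fun x => ?_)
  by_cases hx : x.snd ∈ J
  · simp [indicator, hx]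
  · simp [indicator, hx]

lemma mass_nonneg (U : L2Pair Ω) (J : Set ℝ) : 0 ≤ mass U J :=
  integral_nonneg fun _ => indicator_nonneg (fun _ _ => sq_nonneg _) _

lemma mass_mono (U : L2Pair Ω) {I J : Set ℝ} (hI : MeasurableSet I) (hJ : MeasurableSet J)
    (h : I ⊆ J) : mass U I ≤ mass U J :=
  integral_mono (integrable_mass U hI) (integrable_mass U hJ) fun _ =>
    indicator_le_indicator_of_subset h (fun _ => sq_nonneg _) _

lemma mass_le (U : L2Pair Ω) {J : Set ℝ} (hJ : MeasurableSet J) : mass U J ≤ ‖U.fst‖ ^ 2 := by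
  rw [(norm_sq_eq_integral U.fst).1]
  refine integral_mono (integrable_mass U hJ) (norm_sq_eq_integral U.fst).2 fun x => ?_
  change J.indicator _ _ ≤ ‖U.fst x‖ ^ 2
  rw [Real.norm_eq_abs, sq_abs]
  exact indicator_le_self' (fun _ _ => sq_nonneg _) _

lemma abs_integral_le_mass {f : WithLp 2 (E × ℝ) → ℝ} (hf : Continuous f) {c : ℝ} (hc : 0 ≤ c)
    {J : Set ℝ} (hJ : MeasurableSet J) (hfJ : ∀ x, |f x| ≤ J.indicator (fun _ => c) x.snd)
    (U W : L2Pair Ω) :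
    |∫ x in Ω, f x * (U.fst x * W.fst x)| ≤ c / 2 * (mass U J + mass W J) := by
  have hfc : ∀ x, |f x| ≤ c := fun x => (hfJ x).trans (indicator_le_self' (fun _ _ => hc) _)
  rw [mass, mass, ← integral_add (integrable_mass U hJ) (integrable_mass W hJ), ← integral_const_mul]
  refine abs_integral_le_integral_abs.trans (integral_mono (integrable_bdd_mul_fst U W hf hfc).abs
    (((integrable_mass U hJ).add (integrable_mass W hJ)).const_mul _) fun x => ?_)
  have h1 := hfJ x
  simp only [abs_mul]
  by_cases hx : x.snd ∈ J
  · simp only [indicator_of_mem hx] at h1 ⊢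
    have h2 := mul_le_mul_of_nonneg_right h1 (mul_nonneg (abs_nonneg (U.fst x)) (abs_nonneg (W.fst x)))
    nlinarith [mul_nonneg hc (sq_nonneg (|U.fst x| - |W.fst x|)), sq_abs (U.fst x), sq_abs (W.fst x)]
  · simp only [indicator_of_notMem hx] at h1 ⊢
    rw [le_antisymm h1 (abs_nonneg _)]
    simp

lemma mass_diff (U : L2Pair Ω) {I J : Set ℝ} (hI : MeasurableSet I) (hJ : MeasurableSet J)
    (h : J ⊆ I) : mass U (I \ J) = mass U I - mass U J := by
  rw [mass, mass, mass, ← integral_sub (integrable_mass U hI) (integrable_mass U hJ)]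
  refine integral_congr_ae (ae_of_all _ fun x => ?_)
  by_cases h1 : x.snd ∈ J
  · simp [h1, h h1]
  · by_cases h2 : x.snd ∈ I <;> simp [h1, h2]

/-- One step of hole filling: in the cylindrical part, the mass of an eigenvector below the
threshold in `J` is at most a fixed proportion of its mass in `I`. The estimate that comes out of
Poincaré's inequality is `δ mass J ≤ C² mass (I \ J)`. -/
lemma mass_le_mass_of_cutoff {ω : Set E} (hω : IsOpen ω) (hb : Bornology.IsBounded ω) {μ : ℝ}
    (hμ : IsLeast {t | IsEigenvalue ω (frontier ω) t} μ) (hμ0 : 0 ≤ μ) {h : ℝ} (hh : 0 < h)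
    (hΩ : IsOpen Ω) {f : ℝ → ℝ} {I J : Set ℝ} {C : ℝ} (hf : IsCutoff f I J (h⁻¹ * C))
    (hI : IsClosed I) (hJ : IsClosed J) (h1 : ∀ x, x.snd ∈ I → (x ∈ Ω ↔ h⁻¹ • x.fst ∈ ω))
    (h2 : ∀ x, x.snd ∈ I → h⁻¹ • x.fst ∈ frontier ω → x ∈ closure S) {t δ : ℝ} (hδ : 0 < δ)
    (ht : h ^ 2 * t ≤ μ - δ) {U : L2Pair Ω} (hU : U ∈ eigenspace Ω S t) :
    mass U J ≤ C ^ 2 / (C ^ 2 + δ) * mass U I := by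
  have hχ := hf.isMultiplier (E := E)
  have hJI : J ⊆ I := fun z hz => by
    by_contra hzI
    have := hf.eq_zero z hzI
    rw [hf.eq_one z hz] at this
    exact one_ne_zero this
  obtain ⟨A, hA, -, hA1, hA2⟩ := exists_multiplication S hΩ.measurableSet hχ
  have key := norm_fst_le_of_cylinder hω hb hμ hμ0 hh hΩ hχ.smooth
    (fun x hx => h1 x (hf.tsupport_subset hI hx)) (fun x hx => h2 x (hf.tsupport_subset hI hx)) hA hU.1
  rw [← real_inner_self_eq_norm_sq, ← real_inner_self_eq_norm_sq, hA1, hA2,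
    inner_localized hΩ.measurableSet hχ hU hU, add_self_div_two] at key
  have e1 : mass U J ≤ ∫ x in Ω, f x.snd ^ 2 * (U.fst x * U.fst x) := by
    refine integral_mono (integrable_mass U hJ.measurableSet) (integrable_bdd_mul_fst U U (D := 1)
      (hχ.smooth.continuous.pow 2) fun x => ?_) fun x => ?_
    · rw [abs_of_nonneg (sq_nonneg _)]
      exact pow_le_one₀ (hf.nonneg _) (hf.le_one _)
    · by_cases hx : x.snd ∈ J
      · simp only [indicator_of_mem hx, hf.eq_one _ hx, one_mul, pow_two, le_refl]
      · simp only [indicator_of_notMem hx]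
        exact mul_nonneg (sq_nonneg _) (mul_self_nonneg _)
  have e2 : ∫ x in Ω, ‖gradient (fun x : WithLp 2 (E × ℝ) => f x.snd) x‖ ^ 2 *
      (U.fst x * U.fst x) ≤ (h⁻¹ * C) ^ 2 * mass U (I \ J) := by
    have h3 := abs_integral_le_mass ((hχ.smooth.continuous_gradient (by exact_mod_cast le_top)).norm.pow 2)
      (sq_nonneg (h⁻¹ * C)) (hI.measurableSet.diff hJ.measurableSet) (fun x => by
        rw [abs_of_nonneg (sq_nonneg _)]
        exact hf.norm_gradient_sq_le x) U U
    refine (le_abs_self _).trans (h3.trans (le_of_eq ?_))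
    ring
  rw [mass_diff U hI.measurableSet hJ.measurableSet hJI] at e2
  generalize ∫ x in Ω, f x.snd ^ 2 * (U.fst x * U.fst x) = P at *
  generalize ∫ x in Ω, ‖gradient (fun x : WithLp 2 (E × ℝ) => f x.snd) x‖ ^ 2 *
      (U.fst x * U.fst x) = Q at *
  have hP : 0 ≤ P := (mass_nonneg U J).trans e1
  have e3 : h ^ 2 * Q ≤ C ^ 2 * (mass U I - mass U J) := by
    have := mul_le_mul_of_nonneg_left e2 (sq_nonneg h)
    have h4 : h ^ 2 * ((h⁻¹ * C) ^ 2 * (mass U I - mass U J)) = C ^ 2 * (mass U I - mass U J) := by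
      field_simp
    rwa [h4] at this
  have e4 : δ * P ≤ h ^ 2 * Q := by
    nlinarith [mul_le_mul_of_nonneg_right ht hP]
  have e5 := mul_le_mul_of_nonneg_left e1 hδ.le
  rw [div_mul_eq_mul_div, le_div_iff₀ (by positivity)]
  linarith

lemma pow_floor_le {q : ℝ} (hq : 0 < q) (hq1 : q < 1) (x : ℝ) :
    q ^ ⌊x⌋₊ ≤ q⁻¹ * Real.exp (-(-Real.log q) * x) := by
  have h1 : q⁻¹ * Real.exp (-(-Real.log q) * x) = q ^ (x - 1) := by
    rw [Real.rpow_sub hq, Real.rpow_one, Real.rpow_def_of_pos hq, neg_neg]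
    field_simp
  rw [h1, ← Real.rpow_natCast]
  exact Real.rpow_le_rpow_of_exponent_ge hq hq1.le (by linarith [Nat.lt_floor_add_one x])

lemma mass_le_pow {U : L2Pair Ω} {J : ℕ → Set ℝ} (hJ : ∀ k, MeasurableSet (J k)) {q : ℝ} (hq : 0 ≤ q)
    (h : ∀ k, mass U (J (k + 1)) ≤ q * mass U (J k)) (k : ℕ) :
    mass U (J k) ≤ q ^ k * ‖U.fst‖ ^ 2 := by
  induction k with
  | zero => simpa using mass_le U (hJ 0)
  | succ k ih =>
    calc _ ≤ q * mass U (J k) := h k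
      _ ≤ q * (q ^ k * ‖U.fst‖ ^ 2) := by gcongr
      _ = _ := by ring

/-- Eigenvectors of the semi-infinite cylinder below the threshold decay exponentially. -/
lemma exists_decay_semi {ω : Set E} (hω : IsOpen ω) (hb : Bornology.IsBounded ω) {μ : ℝ}
    (hμ : IsLeast {t | IsEigenvalue ω (frontier ω) t} μ) (hμ0 : 0 ≤ μ) {δ : ℝ} (hδ : 0 < δ) {a : ℝ} :
    ∃ τ > 0, ∃ D > 0, ∀ {H : E → ℝ}, Continuous H → (∀ η, |H η| ≤ a) → ∀ t ≤ μ - δ,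
      ∀ U ∈ eigenspace (semi ω H) (semiSide ω H) t, ∀ s : ℝ,
        mass U (Ici s) ≤ D * Real.exp (-τ * s) * ‖U.fst‖ ^ 2 := by
  obtain ⟨C, hC1, hC⟩ := exists_abs_deriv_smoothTransition_le
  set q : ℝ := C ^ 2 / (C ^ 2 + δ) with hq
  have hq0 : 0 < q := by positivity
  have hq1 : q < 1 := (div_lt_one (by positivity)).2 (by linarith)
  refine ⟨-Real.log q, neg_pos.2 (Real.log_neg hq0 hq1), q⁻¹ * Real.exp (-Real.log q * (a + 1)),
    by positivity, fun {H} hH ha t ht U hU s => ?_⟩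
  -- above the height `a` the domain is a straight cylinder; one step of hole filling per unit length
  have hstep : ∀ k : ℕ, mass U (Ici (a + 1 + (k + 1 : ℕ))) ≤ q * mass U (Ici (a + 1 + (k : ℕ))) := by
    intro k
    have hf := isCutoff_smoothTransition hC 1 (-(a + 1 + k))
    have hI : ∀ x : WithLp 2 (E × ℝ), x.snd ∈ Ici (a + 1 + (k : ℝ)) → -H x.fst < x.snd := by
      intro x hx
      have h1 := (abs_le.1 (ha x.fst)).1
      have h2 : (0 : ℝ) ≤ k := Nat.cast_nonneg k
      have h3 : a + 1 + (k : ℝ) ≤ x.snd := hx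
      linarith
    refine mass_le_mass_of_cutoff hω hb hμ hμ0 one_pos (isOpen_semi hω hH)
      (hf.mono (I' := Ici (a + 1 + k)) (J' := Ici (a + 1 + (k + 1 : ℕ))) (fun z hz => ?_)
        (fun z hz => ?_) (by simp)) isClosed_Ici isClosed_Ici (fun x hx => ?_) (fun x hx hx' => ?_)
      hδ (by linarith) hU
    · have hz : 0 ≤ 1 * z + -(a + 1 + (k : ℝ)) := hz
      exact mem_Ici.2 (by linarith)
    · have hz : a + 1 + ((k + 1 : ℕ) : ℝ) ≤ z := hz
      push_cast at hz
      change 1 ≤ 1 * z + -(a + 1 + (k : ℝ))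
      linarith
    · rw [inv_one, one_smul]
      exact ⟨fun h => h.1, fun h => ⟨h, hI x hx⟩⟩
    · rw [inv_one, one_smul] at hx'
      exact (mem_closure_semiSide_iff hω hH x).2 ⟨hx', (hI x hx).le⟩
  have h1 := mass_le_pow (J := fun k : ℕ => Ici (a + 1 + (k : ℝ))) (fun k => measurableSet_Ici) hq0.le hstep ⌊s - (a + 1)⌋₊
  have h2 := pow_floor_le hq0 hq1 (s - (a + 1))
  have h3 : q⁻¹ * Real.exp (-(-Real.log q) * (s - (a + 1))) =
      q⁻¹ * Real.exp (-Real.log q * (a + 1)) * Real.exp (-(-Real.log q) * s) := by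
    rw [mul_assoc, ← Real.exp_add]
    ring_nf
  rw [← h3]
  rcases le_total (a + 1) s with hs | hs
  · refine (mass_mono U measurableSet_Ici measurableSet_Ici (Ici_subset_Ici.2 ?_)).trans
      (h1.trans (mul_le_mul_of_nonneg_right h2 (sq_nonneg _)))
    linarith [Nat.floor_le (sub_nonneg.2 hs)]
  · rw [Nat.floor_of_nonpos (by linarith), pow_zero] at h2
    exact (mass_le U measurableSet_Ici).trans (le_mul_of_one_le_left (sq_nonneg _) h2)

/-- Eigenvectors of the thin cylinder below the threshold are exponentially small in its middle. -/
lemma exists_decay_thin {ω : Set E} (hω : IsOpen ω) (hb : Bornology.IsBounded ω) {μ : ℝ}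
    (hμ : IsLeast {t | IsEigenvalue ω (frontier ω) t} μ) (hμ0 : 0 ≤ μ) {δ : ℝ} (hδ : 0 < δ) {a : ℝ} :
    ∃ τ > 0, ∃ D > 0, ∀ {Hp Hm : E → ℝ}, Continuous Hp → Continuous Hm → (∀ η, |Hp η| ≤ a) →
      (∀ η, |Hm η| ≤ a) → ∀ h : ℝ, 0 < h → h * a < 1 / 4 → ∀ t, h ^ 2 * t ≤ μ - δ →
      ∀ U ∈ eigenspace (thin ω Hp Hm h) (thinSide ω Hp Hm h) t,
        mass U (Icc (-(1 / 2)) (1 / 2)) ≤ D * Real.exp (-τ / h) * ‖U.fst‖ ^ 2 := by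
  obtain ⟨C, hC1, hC⟩ := exists_abs_deriv_smoothTransition_le
  set q : ℝ := (2 * C) ^ 2 / ((2 * C) ^ 2 + δ) with hq
  have hq0 : 0 < q := by positivity
  have hq1 : q < 1 := (div_lt_one (by positivity)).2 (by linarith)
  refine ⟨-Real.log q / 4, div_pos (neg_pos.2 (Real.log_neg hq0 hq1)) (by norm_num), q⁻¹,
    by positivity, fun {Hp Hm} hHp hHm hap ham h hh hha t ht U hU => ?_⟩
  have bd : ∀ {H : E → ℝ}, (∀ η, |H η| ≤ a) → ∀ η, |h * H η| < 1 / 4 := fun hH η => by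
    rw [abs_mul, abs_of_pos hh]
    exact (mul_le_mul_of_nonneg_left (hH η) hh.le).trans_lt hha
  -- for `|z| ≤ 3/4` the domain is a straight cylinder; each step of hole filling shortens the
  -- interval by `h` at both ends, until `1/2` is reached after `1 / (4 h)` steps
  have hstep : ∀ k : ℕ, mass U (Icc (-(3 / 4 - (k + 1 : ℕ) * h)) (3 / 4 - (k + 1 : ℕ) * h)) ≤
      q * mass U (Icc (-(3 / 4 - (k : ℕ) * h)) (3 / 4 - (k : ℕ) * h)) := by
    intro k
    have hf := (isCutoff_smoothTransition hC h⁻¹ (h⁻¹ * (3 / 4 - k * h))).mul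
      (isCutoff_smoothTransition hC (-h⁻¹) (h⁻¹ * (3 / 4 - k * h)))
    have hkh : 0 ≤ (k : ℝ) * h := by positivity
    have hI : ∀ x : WithLp 2 (E × ℝ), x.snd ∈ Icc (-(3 / 4 - (k : ℕ) * h)) (3 / 4 - (k : ℕ) * h) →
        x.snd < 1 + h * Hp (h⁻¹ • x.fst) ∧ -x.snd < 1 + h * Hm (h⁻¹ • x.fst) := by
      intro x hx
      have h1 := (abs_lt.1 (bd hap (h⁻¹ • x.fst))).1
      have h2 := (abs_lt.1 (bd ham (h⁻¹ • x.fst))).1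
      exact ⟨by linarith [hx.2], by linarith [hx.1]⟩
    refine mass_le_mass_of_cutoff hω hb hμ hμ0 hh (isOpen_thin hω hHp hHm h)
      (hf.mono (I' := Icc (-(3 / 4 - (k : ℕ) * h)) (3 / 4 - (k : ℕ) * h))
        (J' := Icc (-(3 / 4 - (k + 1 : ℕ) * h)) (3 / 4 - (k + 1 : ℕ) * h)) (fun z hz => ?_)
        (fun z hz => ?_) ?_) isClosed_Icc isClosed_Icc (fun x hx => ?_) (fun x hx hx' => ?_)
      hδ ht hU
    · have h1 : 0 ≤ h⁻¹ * z + h⁻¹ * (3 / 4 - k * h) := hz.1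
      have h2 : 0 ≤ -h⁻¹ * z + h⁻¹ * (3 / 4 - k * h) := hz.2
      rw [← mul_add] at h1
      rw [neg_mul, ← mul_neg, ← mul_add] at h2
      have h1 := (mul_nonneg_iff_of_pos_left (inv_pos.2 hh)).1 h1
      have h2 := (mul_nonneg_iff_of_pos_left (inv_pos.2 hh)).1 h2
      exact ⟨by linarith, by linarith⟩
    · have hz1 := hz.1
      have hz2 := hz.2
      push_cast at hz1 hz2
      constructor
      · change 1 ≤ h⁻¹ * z + h⁻¹ * (3 / 4 - k * h)
        rw [← mul_add, inv_mul_eq_div, le_div_iff₀ hh]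
        linarith
      · change 1 ≤ -h⁻¹ * z + h⁻¹ * (3 / 4 - k * h)
        rw [neg_mul, ← mul_neg, ← mul_add, inv_mul_eq_div, le_div_iff₀ hh]
        linarith
    · rw [abs_neg, abs_of_pos (inv_pos.2 hh)]
      linarith
    · exact ⟨fun h => h.1, fun h => ⟨h, hI x hx⟩⟩
    · refine (mem_closure_thinSide_iff hω hHp hHm hh.ne' (fun η => ?_) x).2
        ⟨hx', (hI x hx).1.le, (hI x hx).2.le⟩
      exact ⟨by linarith [(abs_lt.1 (bd hap η)).1], by linarith [(abs_lt.1 (bd ham η)).1]⟩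
  have h1 := mass_le_pow (J := fun k : ℕ => Icc (-(3 / 4 - (k : ℝ) * h)) (3 / 4 - (k : ℝ) * h))
    (fun k => measurableSet_Icc) hq0.le hstep ⌊(4 * h)⁻¹⌋₊
  have h2 := pow_floor_le hq0 hq1 (4 * h)⁻¹
  have h3 : -(-Real.log q) * (4 * h)⁻¹ = -(-Real.log q / 4) / h := by
    field_simp
  rw [h3] at h2
  have h4 : (⌊(4 * h)⁻¹⌋₊ : ℝ) * h ≤ 1 / 4 := by
    have := mul_le_mul_of_nonneg_right (Nat.floor_le (by positivity : 0 ≤ (4 * h)⁻¹)) hh.le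
    refine this.trans (le_of_eq ?_)
    field_simp
  exact (mass_mono U measurableSet_Icc measurableSet_Icc (Icc_subset_Icc (by linarith)
    (by linarith))).trans (h1.trans (mul_le_mul_of_nonneg_right h2 (sq_nonneg _)))

end Decay

/-! ### Transport between the thin and the semi-infinite cylinders -/

section Gluing

variable {E : Type} [NormedAddCommGroup E] [InnerProductSpace ℝ E]

lemma exists_reflection {e : ℝ} (he : e ^ 2 = 1) :
    ∃ R : WithLp 2 (E × ℝ) ≃ₗᵢ[ℝ] WithLp 2 (E × ℝ), ∀ x, R x = WithLp.toLp 2 (x.fst, e * x.snd) := by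
  rcases (sq_eq_sq_iff_eq_or_eq_neg.1 (he.trans (one_pow 2).symm) : e = 1 ∨ e = -1) with rfl | rfl
  · exact ⟨LinearIsometryEquiv.refl ℝ _, fun x => by simp; rfl⟩
  · exact ⟨LinearIsometryEquiv.withLpProdCongr 2 (LinearIsometryEquiv.refl ℝ E)
      (LinearIsometryEquiv.neg ℝ), fun x => by simp⟩

variable [FiniteDimensional ℝ E] [MeasurableSpace E] [BorelSpace E]

lemma abs_integral_mul_sub_inner_le {Ω : Set (WithLp 2 (E × ℝ))} {f : WithLp 2 (E × ℝ) → ℝ}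
    (hf : Continuous f) {L : Set ℝ} (hL : MeasurableSet L)
    (hfL : ∀ x, |f x - 1| ≤ L.indicator (fun _ => 1) x.snd) (U W : L2Pair Ω) :
    |(∫ x in Ω, f x * (U.fst x * W.fst x)) - ⟪U.fst, W.fst⟫| ≤ 1 / 2 * (mass U L + mass W L) := by
  have h1 : ⟪U.fst, W.fst⟫ = ∫ x in Ω, U.fst x * W.fst x := by
    rw [L2.inner_def]
    simp only [inner_eq_mul_real]
  have hb : ∀ x, |f x| ≤ 2 := fun x => by
    have h2 := (hfL x).trans (indicator_le_self' (fun _ _ => zero_le_one) _)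
    rw [abs_le] at h2 ⊢
    constructor <;> linarith [h2.1, h2.2]
  rw [h1, ← integral_sub (integrable_bdd_mul_fst U W hf hb) (integrable_mul_fst U W)]
  have h3 := abs_integral_le_mass (hf.sub continuous_const) zero_le_one hL hfL U W
  refine le_trans (le_of_eq ?_) h3
  congr 2
  funext x
  change f x * _ - _ = (f x - 1) * _
  ring

lemma IsCutoff.abs_integral_gradient_le {Ω : Set (WithLp 2 (E × ℝ))} {f : ℝ → ℝ} {I J L : Set ℝ}
    {C : ℝ} (hf : IsCutoff f I J C) (hL : MeasurableSet L) (hIJ : I \ J ⊆ L) (U W : L2Pair Ω) :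
    |∫ x in Ω, ‖gradient (fun x : WithLp 2 (E × ℝ) => f x.snd) x‖ ^ 2 * (U.fst x * W.fst x)| ≤
      C ^ 2 / 2 * (mass U L + mass W L) := by
  refine abs_integral_le_mass ((hf.isMultiplier.smooth.continuous_gradient
    (by exact_mod_cast le_top)).norm.pow 2) (sq_nonneg C) hL (fun x => ?_) U W
  rw [abs_of_nonneg (sq_nonneg _)]
  exact (hf.norm_gradient_sq_le x).trans
    (indicator_le_indicator_of_subset hIJ (fun _ => sq_nonneg _) _)

set_option maxHeartbeats 1000000 in
/-- Eigenvectors of a semi-infinite cylinder, cut off and scaled, become functions on the half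
`e z > 0` of the thin cylinder, almost with the same Gram matrices. The sign `e = ±1` selects the
end, and `H'` is the profile of the opposite end. -/
lemma exists_semi_to_thin {ω : Set E} (hω : IsOpen ω) {H H' : E → ℝ} (hH : Continuous H) {a : ℝ}
    (ha' : ∀ η, |H' η| ≤ a) {e : ℝ} (he : e ^ 2 = 1) {h : ℝ} (hh : 0 < h) (hha : h * a < 1 / 4)
    {Ω S : Set (WithLp 2 (E × ℝ))} (hΩ : IsOpen Ω)
    (hmem : ∀ x, x ∈ Ω ↔ h⁻¹ • x.fst ∈ ω ∧ e * x.snd < 1 + h * H (h⁻¹ • x.fst) ∧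
      -(e * x.snd) < 1 + h * H' (h⁻¹ • x.fst))
    (hS : ∀ x, x ∈ closure S ↔ h⁻¹ • x.fst ∈ frontier ω ∧ e * x.snd ≤ 1 + h * H (h⁻¹ • x.fst) ∧
      -(e * x.snd) ≤ 1 + h * H' (h⁻¹ • x.fst))
    {C : ℝ} (hC : ∀ x, |deriv Real.smoothTransition x| ≤ C) :
    ∃ A : L2Pair (semi ω H) →L[ℝ] L2Pair Ω,
      (∀ U ∈ sobolev (semi ω H) (semiSide ω H), A U ∈ sobolev Ω S) ∧
      (∀ U, ∀ᵐ x ∂volume.restrict Ω, e * x.snd ≤ 0 → (A U).fst x = 0 ∧ (A U).snd x = 0) ∧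
      ∀ s t U W, U ∈ eigenspace (semi ω H) (semiSide ω H) s →
        W ∈ eigenspace (semi ω H) (semiSide ω H) t →
        |⟪(A U).fst, (A W).fst⟫ - ⟪U.fst, W.fst⟫| ≤
          1 / 2 * (mass U (Ici (2 * h)⁻¹) + mass W (Ici (2 * h)⁻¹)) ∧
        |h ^ 2 * ⟪(A U).snd, (A W).snd⟫ - (s + t) / 2 * ⟪U.fst, W.fst⟫| ≤
          (|(s + t) / 2| + (4 * h * C) ^ 2) / 2 *
            (mass U (Ici (2 * h)⁻¹) + mass W (Ici (2 * h)⁻¹)) := by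
  obtain ⟨R, hR⟩ := exists_reflection (E := E) (e := -e) (by rw [neg_sq, he])
  -- in the variable `ζ` of the semi-infinite cylinder the cutoff falls between `1 / (2 h)` and
  -- `3 / (4 h)`; after the change of variables `ζ = (1 - e z) / h` it vanishes for `e z ≤ 1/4`
  have hf := isCutoff_smoothTransition hC (-(4 * h)) 3
  rw [abs_neg, abs_of_pos (by positivity : 0 < 4 * h)] at hf
  have hχ := hf.isMultiplier (E := E)
  have hI : IsClosed {z : ℝ | 0 ≤ -(4 * h) * z + 3} := isClosed_le (by fun_prop) (by fun_prop)
  have hΩs := isOpen_semi hω hH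
  set p : WithLp 2 (E × ℝ) := WithLp.toLp 2 (0, h⁻¹) with hp
  have hΦ1 : ∀ x, (similarity p (inv_pos.2 hh) R x).fst = h⁻¹ • x.fst := fun x => by
    simp [hR, hp]
  have hΦ2 : ∀ x, (similarity p (inv_pos.2 hh) R x).snd = h⁻¹ * (1 - e * x.snd) := fun x => by
    rw [similarity_apply, hR]
    change h⁻¹ + h⁻¹ * (-e * x.snd) = _
    ring
  have hsupp : ∀ x, similarity p (inv_pos.2 hh) R x ∈ tsupport (fun x : WithLp 2 (E × ℝ) =>
      Real.smoothTransition (-(4 * h) * x.snd + 3)) → 1 / 4 ≤ e * x.snd := fun x hx => by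
    have h1 : 0 ≤ -(4 * h) * (similarity p (inv_pos.2 hh) R x).snd + 3 := hf.tsupport_subset hI hx
    rw [hΦ2] at h1
    have h2 : -(4 * h) * (h⁻¹ * (1 - e * x.snd)) = -4 * (1 - e * x.snd) := by
      field_simp
    linarith
  have hmem' : ∀ x, similarity p (inv_pos.2 hh) R x ∈ semi ω H ↔
      h⁻¹ • x.fst ∈ ω ∧ e * x.snd < 1 + h * H (h⁻¹ • x.fst) := fun x => by
    change (similarity p (inv_pos.2 hh) R x).fst ∈ ω ∧
      -H (similarity p (inv_pos.2 hh) R x).fst < (similarity p (inv_pos.2 hh) R x).snd ↔ _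
    rw [hΦ1, hΦ2, inv_mul_eq_div, lt_div_iff₀ hh]
    refine and_congr_right fun _ => ⟨fun h1 => by linarith, fun h1 => by linarith⟩
  obtain ⟨A, hA, hA1, hA2, hA3⟩ := exists_transport (S' := S) (S := semiSide ω H) hΩs.measurableSet
    hΩ.measurableSet hχ p (inv_pos.2 hh) R (fun x hx => by
      have h1 := hsupp x hx
      have h2 : h * -H' (h⁻¹ • x.fst) ≤ h * a :=
        mul_le_mul_of_nonneg_left (neg_le.1 (abs_le.1 (ha' (h⁻¹ • x.fst))).1) hh.le
      rw [hmem, hmem']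
      exact ⟨fun h3 => ⟨h3.1, h3.2.1⟩, fun h3 => ⟨h3.1, h3.2, by linarith⟩⟩) (fun x hx _ => by
      obtain ⟨h3, h4, -⟩ := (hS x).1 hx
      rw [mem_closure_semiSide_iff hω hH, hΦ1, hΦ2, inv_mul_eq_div, le_div_iff₀ hh]
      exact ⟨h3, by linarith⟩)
  have hJ : ∀ z : ℝ, z ∉ Ici (2 * h)⁻¹ → 1 ≤ -(4 * h) * z + 3 := fun z hz => by
    have h1 : z < (2 * h)⁻¹ := not_le.1 hz
    have h2 := mul_lt_mul_of_pos_left h1 (by positivity : 0 < 4 * h)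
    have h3 : 4 * h * (2 * h)⁻¹ = 2 := by field_simp; norm_num
    linarith
  refine ⟨A, hA1, fun U => ?_, fun s t U W hU hW => ?_⟩
  · filter_upwards [(hA U).1, (hA U).2] with x h1 h2 hx
    have hz : (similarity p (inv_pos.2 hh) R x).snd ∉ {z : ℝ | 0 ≤ -(4 * h) * z + 3} := by
      intro h3
      have h3 : 0 ≤ -(4 * h) * (similarity p (inv_pos.2 hh) R x).snd + 3 := h3
      rw [hΦ2] at h3
      have h2 : -(4 * h) * (h⁻¹ * (1 - e * x.snd)) = -4 * (1 - e * x.snd) := by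
        field_simp
      linarith
    have hz0 := hf.eq_zero _ hz
    have hg := hf.norm_gradient_sq_le (similarity p (inv_pos.2 hh) R x)
    rw [indicator_of_notMem fun h => hz h.1] at hg
    have hg0 := norm_eq_zero.1 (pow_eq_zero_iff two_ne_zero |>.1 (le_antisymm hg (sq_nonneg _)))
    rw [h1, h2]
    constructor
    · rw [indicator_apply_eq_zero.2 fun _ => by rw [hz0, zero_mul], mul_zero]
    · rw [indicator_apply_eq_zero.2 fun _ => by rw [hz0, hg0, zero_smul, smul_zero, zero_add],
        map_zero, smul_zero]
  · have e1 := abs_integral_mul_sub_inner_le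
      (f := fun x => Real.smoothTransition (-(4 * h) * x.snd + 3) ^ 2) (hχ.smooth.continuous.pow 2)
      (measurableSet_Ici (a := (2 * h)⁻¹)) (fun x => by
        by_cases hx : x.snd ∈ Ici (2 * h)⁻¹
        · rw [indicator_of_mem hx, abs_le]
          have h1 := pow_le_one₀ (n := 2) (hf.nonneg x.snd) (hf.le_one x.snd)
          have h2 := sq_nonneg (Real.smoothTransition (-(4 * h) * x.snd + 3))
          constructor <;> linarith
        · have h1 := hf.eq_one x.snd (hJ _ hx)
          rw [indicator_of_notMem hx, h1]
          simp) U W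
    have e2 := hf.abs_integral_gradient_le (measurableSet_Ici (a := (2 * h)⁻¹))
      (fun z hz => by
        by_contra hz'
        exact hz.2 (hJ z hz')) U W
    rw [hA2, hA3, inner_localized hΩs.measurableSet hχ hU hW]
    refine ⟨e1, ?_⟩
    generalize ∫ y in semi ω H, Real.smoothTransition (-(4 * h) * y.snd + 3) ^ 2 *
      (U.fst y * W.fst y) = P at *
    generalize ∫ y in semi ω H, ‖gradient (fun x : WithLp 2 (E × ℝ) =>
      Real.smoothTransition (-(4 * h) * x.snd + 3)) y‖ ^ 2 * (U.fst y * W.fst y) = Q at *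
    rw [← mul_assoc, ← mul_pow, mul_inv_cancel₀ hh.ne', one_pow, one_mul]
    calc |(s + t) / 2 * P + Q - (s + t) / 2 * ⟪U.fst, W.fst⟫|
        = |(s + t) / 2 * (P - ⟪U.fst, W.fst⟫) + Q| := by ring_nf
      _ ≤ |(s + t) / 2 * (P - ⟪U.fst, W.fst⟫)| + |Q| := abs_add_le _ _
      _ ≤ |(s + t) / 2| * (1 / 2 * (mass U (Ici (2 * h)⁻¹) + mass W (Ici (2 * h)⁻¹))) +
          (4 * h * C) ^ 2 / 2 * (mass U (Ici (2 * h)⁻¹) + mass W (Ici (2 * h)⁻¹)) := by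
        rw [abs_mul]
        gcongr
      _ = _ := by ring

set_option maxHeartbeats 1000000 in
/-- The half `e z > 0` of a function on the thin cylinder, cut off and scaled, becomes a function
on the semi-infinite cylinder. -/
lemma exists_thin_to_semi {ω : Set E} (hω : IsOpen ω) {H H' : E → ℝ} (hH : Continuous H) {a : ℝ}
    (ha' : ∀ η, |H' η| ≤ a) {e : ℝ} (he : e ^ 2 = 1) {h : ℝ} (hh : 0 < h) (hha : h * a < 1 / 4)
    {Ω S : Set (WithLp 2 (E × ℝ))} (hΩ : IsOpen Ω)
    (hmem : ∀ x, x ∈ Ω ↔ h⁻¹ • x.fst ∈ ω ∧ e * x.snd < 1 + h * H (h⁻¹ • x.fst) ∧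
      -(e * x.snd) < 1 + h * H' (h⁻¹ • x.fst))
    (hS : ∀ x, x ∈ closure S ↔ h⁻¹ • x.fst ∈ frontier ω ∧ e * x.snd ≤ 1 + h * H (h⁻¹ • x.fst) ∧
      -(e * x.snd) ≤ 1 + h * H' (h⁻¹ • x.fst))
    {C : ℝ} (hC : ∀ x, |deriv Real.smoothTransition x| ≤ C) :
    ∃ A : L2Pair Ω →L[ℝ] L2Pair (semi ω H),
      (∀ U ∈ sobolev Ω S, A U ∈ sobolev (semi ω H) (semiSide ω H)) ∧
      ∀ s t U W, U ∈ eigenspace Ω S s → W ∈ eigenspace Ω S t →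
        ⟪(A U).fst, (A W).fst⟫ =
          ∫ x in Ω, Real.smoothTransition (4 * e * x.snd + -1) ^ 2 * (U.fst x * W.fst x) ∧
        |⟪(A U).snd, (A W).snd⟫ - h ^ 2 * ((s + t) / 2 * ⟪(A U).fst, (A W).fst⟫)| ≤
          h ^ 2 * ((4 * C) ^ 2 / 2 *
            (mass U (Icc (-(1 / 2)) (1 / 2)) + mass W (Icc (-(1 / 2)) (1 / 2)))) := by
  obtain ⟨R, hR⟩ := exists_reflection (E := E) (e := -e) (by rw [neg_sq, he])
  have habs : |e| = 1 := by rw [← sq_eq_sq₀ (abs_nonneg _) zero_le_one, sq_abs, he, one_pow]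
  -- the cutoff rises from `0` at `e z = 1/4` to `1` at `e z = 1/2`
  have hf := isCutoff_smoothTransition hC (4 * e) (-1)
  rw [abs_mul, habs, mul_one, abs_of_pos (by norm_num : (0 : ℝ) < 4)] at hf
  have hχ := hf.isMultiplier (E := E)
  have hI : IsClosed {z : ℝ | 0 ≤ 4 * e * z + -1} := isClosed_le (by fun_prop) (by fun_prop)
  have hΩs := isOpen_semi hω hH
  set p : WithLp 2 (E × ℝ) := WithLp.toLp 2 (0, e) with hp
  have hΦ1 : ∀ x, h⁻¹ • (similarity p hh R x).fst = x.fst := fun x => by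
    simp [hR, hp, smul_smul, inv_mul_cancel₀ hh.ne']
  have hΦ2 : ∀ x, e * (similarity p hh R x).snd = 1 - h * x.snd := fun x => by
    rw [similarity_apply, hR]
    change e * (e + h * (-e * x.snd)) = _
    linear_combination (1 - h * x.snd) * he
  obtain ⟨A, -, hA1, hA2, hA3⟩ := exists_transport (S' := semiSide ω H) (S := S) hΩ.measurableSet
    hΩs.measurableSet hχ p hh R (fun x hx => by
      have h1 : 0 ≤ 4 * e * (similarity p hh R x).snd + -1 := hf.tsupport_subset hI hx
      rw [mul_assoc, hΦ2] at h1
      have h2 : h * -H' x.fst ≤ h * a :=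
        mul_le_mul_of_nonneg_left (neg_le.1 (abs_le.1 (ha' x.fst)).1) hh.le
      rw [hmem, hΦ1, hΦ2]
      change x.fst ∈ ω ∧ -H x.fst < x.snd ↔ _
      refine and_congr_right fun _ => ⟨fun h3 => ⟨?_, by linarith⟩, fun h3 => ?_⟩
      · nlinarith
      · by_contra h4
        nlinarith [not_lt.1 h4, h3.1]) (fun x hx hx' => by
      have h1 : 0 ≤ 4 * e * (similarity p hh R x).snd + -1 := hf.tsupport_subset hI hx'
      rw [mul_assoc, hΦ2] at h1
      have h2 : h * -H' x.fst ≤ h * a :=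
        mul_le_mul_of_nonneg_left (neg_le.1 (abs_le.1 (ha' x.fst)).1) hh.le
      obtain ⟨h3, h4⟩ := (mem_closure_semiSide_iff hω hH x).1 hx
      rw [hS, hΦ1, hΦ2]
      exact ⟨h3, by nlinarith, by linarith⟩)
  refine ⟨A, hA1, fun s t U W hU hW => ⟨hA2 U W, ?_⟩⟩
  have e2 := hf.abs_integral_gradient_le (L := Icc (-(1 / 2)) (1 / 2)) measurableSet_Icc
    (fun z hz => by
      have h1 : ¬ 1 ≤ 4 * e * z + -1 := hz.2
      have h2 : 0 ≤ 4 * e * z + -1 := hz.1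
      rw [mem_Icc, ← abs_le, ← one_mul |z|, ← habs, ← abs_mul, abs_le]
      constructor <;> linarith) U W
  rw [hA2, hA3, inner_localized hΩ.measurableSet hχ hU hW, ← mul_sub, add_sub_cancel_left, abs_mul,
    abs_of_nonneg (sq_nonneg h)]
  gcongr

end Gluing

/-! ### Min-max comparison with approximate Gram matrices -/

section Comparison

lemma abs_sum_gram_sub_le {κ : Type*} [Fintype κ] [DecidableEq κ] (c d : κ → ℝ) (B : κ → κ → ℝ)
    {ε : ℝ} (hε : 0 ≤ ε) (hB : ∀ i j, |B i j - if i = j then d i else 0| ≤ ε) :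
    |(∑ i, ∑ j, c i * c j * B i j) - ∑ i, d i * c i ^ 2| ≤ Fintype.card κ * ε * ∑ i, c i ^ 2 := by
  have h1 : ∑ i, d i * c i ^ 2 = ∑ i, ∑ j, c i * c j * (if i = j then d i else 0) := by
    refine Finset.sum_congr rfl fun i _ => ?_
    simp only [mul_ite, mul_zero, Finset.sum_ite_eq, Finset.mem_univ, if_true]
    ring
  have h2 : (∑ i, |c i|) ^ 2 ≤ Fintype.card κ * ∑ i, c i ^ 2 := by
    have := sq_sum_le_card_mul_sum_sq (s := Finset.univ) (f := fun i => |c i|)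
    simpa [Finset.card_univ] using this
  rw [h1, ← Finset.sum_sub_distrib]
  simp only [← Finset.sum_sub_distrib, ← mul_sub]
  calc _ ≤ ∑ i, ∑ j, |c i * c j * (B i j - if i = j then d i else 0)| :=
        (Finset.abs_sum_le_sum_abs _ _).trans (Finset.sum_le_sum fun i _ =>
          Finset.abs_sum_le_sum_abs _ _)
    _ ≤ ∑ i, ∑ j, |c i| * |c j| * ε := by
        refine Finset.sum_le_sum fun i _ => Finset.sum_le_sum fun j _ => ?_
        rw [abs_mul, abs_mul]
        exact mul_le_mul_of_nonneg_left (hB i j) (by positivity)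
    _ = ε * (∑ i, |c i|) ^ 2 := by
        rw [pow_two, Finset.sum_mul_sum, Finset.mul_sum]
        refine Finset.sum_congr rfl fun i _ => ?_
        rw [Finset.mul_sum]
        refine Finset.sum_congr rfl fun j _ => ?_
        ring
    _ ≤ ε * (Fintype.card κ * ∑ i, c i ^ 2) := by gcongr
    _ = _ := by ring

/-- A Rayleigh quotient bound for an almost orthonormal, almost diagonal system. -/
lemma rayleigh_le {κ : Type*} [Fintype κ] [DecidableEq κ] {c d : κ → ℝ} (hc : c ≠ 0)
    {B A : κ → κ → ℝ} {ε t T : ℝ} (hε : 0 ≤ ε) (ht : 0 ≤ t)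
    (hB : ∀ i j, |B i j - if i = j then 1 else 0| ≤ ε)
    (hA : ∀ i j, |A i j - if i = j then d i else 0| ≤ ε) (hd : ∀ i, d i ≤ T)
    (h : t * (∑ i, ∑ j, c i * c j * B i j) ≤ ∑ i, ∑ j, c i * c j * A i j) :
    t * (1 - Fintype.card κ * ε) ≤ T + Fintype.card κ * ε := by
  have h1 := abs_sum_gram_sub_le c (fun _ => 1) B hε hB
  have h2 := abs_sum_gram_sub_le c d A hε hA
  have h3 : 0 < ∑ i, c i ^ 2 := by
    obtain ⟨i, hi⟩ := Function.ne_iff.1 hc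
    have hi : c i ≠ 0 := hi
    exact Finset.sum_pos' (fun _ _ => sq_nonneg _) ⟨i, Finset.mem_univ _, by positivity⟩
  have h4 : ∑ i, d i * c i ^ 2 ≤ T * ∑ i, c i ^ 2 := by
    rw [Finset.mul_sum]
    exact Finset.sum_le_sum fun i _ => mul_le_mul_of_nonneg_right (hd i) (sq_nonneg _)
  simp only [one_mul] at h1
  have h5 := mul_le_mul_of_nonneg_left (abs_le.1 h1).1 ht
  refine le_of_mul_le_mul_right ?_ h3
  linarith [(abs_le.1 h2).2]

variable {F : Type} [NormedAddCommGroup F] [InnerProductSpace ℝ F] [FiniteDimensional ℝ F]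
  [MeasurableSpace F] [BorelSpace F] {Ω S : Set F}

lemma IsEigenvalueSequence.exists_isEigenbasis {lam : ℕ → ℝ} (h : IsEigenvalueSequence Ω S lam) :
    ∃ w : ℕ → L2Pair Ω, IsEigenbasis Ω S lam w ∧
      ∀ t, ∀ V ∈ eigenspace Ω S t, V ∈ Submodule.span ℝ (w '' {i | lam i = t}) := by
  obtain ⟨w, hw, hspan⟩ := h.2.2.exists_isEigenbasis fun t => by
    have h1 : ∀ᶠ i in atTop, lam i ≠ t := (h.2.1.eventually_gt_atTop t).mono fun i hi => hi.ne'
    have h2 : {i | lam i = t}.Finite := by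
      rw [← Nat.cofinite_eq_atTop, eventually_cofinite] at h1
      simpa using h1
    exact h2.to_subtype
  exact ⟨w, hw, fun t => hspan t (mem_univ t)⟩

lemma IsEigenbasis.ne_zero {ι : Type*} [DecidableEq ι] {L : ι → ℝ} {u : ι → L2Pair Ω}
    (hu : IsEigenbasis Ω S L u) (i : ι) : u i ≠ 0 := fun h => by
  have := hu.orth i i
  simp [h] at this

lemma IsEigenbasis.norm_fst_sq {ι : Type*} [DecidableEq ι] {L : ι → ℝ} {u : ι → L2Pair Ω}
    (hu : IsEigenbasis Ω S L u) (i : ι) : ‖(u i).fst‖ ^ 2 = 1 := by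
  rw [← real_inner_self_eq_norm_sq, hu.orth, if_pos rfl]

lemma IsEigenbasis.nonneg {ι : Type*} [DecidableEq ι] {L : ι → ℝ} {u : ι → L2Pair Ω}
    (hu : IsEigenbasis Ω S L u) (i : ι) : 0 ≤ L i :=
  nonneg_of_mem_eigenspace (hu.mem i) (hu.ne_zero i)

/-- The min-max principle: every space of more than `m` trial functions contains a nontrivial
combination whose Rayleigh quotient is at least the `m`-th eigenvalue. -/
lemma IsEigenvalueSequence.exists_trial {lam : ℕ → ℝ} (hlam : IsEigenvalueSequence Ω S lam)
    (hco : ∀ t, CoerciveModFinite Ω S t) {κ : Type*} [Fintype κ] {m : ℕ}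
    (hm : m < Fintype.card κ) {φ : κ → L2Pair Ω} (hφ : ∀ i, φ i ∈ sobolev Ω S) :
    ∃ c : κ → ℝ, c ≠ 0 ∧ lam m * (∑ i, ∑ j, c i * c j * ⟪(φ i).fst, (φ j).fst⟫) ≤
      ∑ i, ∑ j, c i * c j * ⟪(φ i).snd, (φ j).snd⟫ := by
  obtain ⟨w, hw, hspan⟩ := hlam.exists_isEigenbasis
  obtain ⟨c, hc0, hc⟩ := exists_ne_zero_sum_mul_eq_zero (κ := κ) (κ' := Fin m) (by simpa using hm)
    fun i j => ⟪(w j).fst, (φ i).fst⟫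
  refine ⟨c, hc0, ?_⟩
  rw [← norm_sq_fst_sum, ← norm_sq_snd_sum]
  refine (hco (lam m + 1)).le_of_orthogonal (hw.nonneg m) (lt_add_one _)
    (Submodule.sum_mem _ fun i _ => Submodule.smul_mem _ _ (hφ i)) fun t ht V hV => ?_
  refine inner_fst_eq_zero_of_mem_span ?_ (hspan t V hV)
  rintro _ ⟨j, rfl, rfl⟩
  -- an eigenvalue below `lam m` has an index below `m`
  have hj : j < m := lt_of_not_ge fun h => ht.not_ge (hlam.1 h)
  rw [fst_sum_smul, inner_sum]
  simp only [real_inner_smul_right]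
  exact hc ⟨j, hj⟩

/-- If `0` is not an eigenvalue and all eigenvalues in `(0, M]` are listed, a function orthogonal to
the eigenvectors with listed eigenvalues below `T ≤ M` has Rayleigh quotient at least `T`. -/
lemma ListsEigenvalues.le_of_orthogonal {M : ℝ} {ι : Type} [DecidableEq ι] {L : ι → ℝ}
    {u : ι → L2Pair Ω}
    (hspan : ∀ t ∈ Ioc 0 M, ∀ V ∈ eigenspace Ω S t, V ∈ Submodule.span ℝ (u '' {i | L i = t}))
    {C : ℝ} (hC : ∀ U ∈ sobolev Ω S, ‖U.fst‖ ^ 2 ≤ C * ‖U.snd‖ ^ 2) {T t₁ : ℝ} (hT : 0 ≤ T)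
    (hTM : T ≤ M) (hT₁ : T < t₁) (hco : CoerciveModFinite Ω S t₁) {U : L2Pair Ω}
    (hU : U ∈ sobolev Ω S) (horth : ∀ i, L i < T → ⟪(u i).fst, U.fst⟫ = 0) :
    T * ‖U.fst‖ ^ 2 ≤ ‖U.snd‖ ^ 2 := by
  refine hco.le_of_orthogonal hT hT₁ hU fun t ht V hV => ?_
  by_cases hV0 : V = 0
  · simp [hV0]
  have ht0 : 0 < t := by
    refine lt_of_le_of_ne (nonneg_of_mem_eigenspace hV hV0) fun h0 => ?_
    have h1 := norm_sq_snd_of_mem_eigenspace hV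
    have h2 := hC V hV.1
    have h3 := pow_pos (norm_fst_pos_of_mem_eigenspace hV hV0) 2
    rw [h1, ← h0, zero_mul, mul_zero] at h2
    linarith
  refine inner_fst_eq_zero_of_mem_span ?_ (hspan t ⟨ht0, ht.le.trans hTM⟩ V hV)
  rintro _ ⟨i, rfl, rfl⟩
  exact horth i ht

lemma inner_eq_zero_of_ae {G : Type*} [NormedAddCommGroup G] [InnerProductSpace ℝ G]
    {μ : Measure F} {f g : Lp G 2 μ} (h : ∀ᵐ x ∂μ, f x = 0 ∨ g x = 0) : ⟪f, g⟫ = 0 := by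
  rw [L2.inner_def]
  refine integral_eq_zero_of_ae ?_
  filter_upwards [h] with x hx
  rcases hx with hx | hx <;> simp [hx]

lemma exp_neg_div_le {τ h : ℝ} (hτ : 0 < τ) (hh : 0 < h) : Real.exp (-τ / h) ≤ h / τ := by
  have h1 : τ / h ≤ Real.exp (τ / h) := by linarith [Real.add_one_le_exp (τ / h)]
  rw [neg_div, Real.exp_neg, ← inv_div τ h]
  exact inv_anti₀ (by positivity) h1

lemma inv_sq_mul_exp_le {τ h : ℝ} (hτ : 0 < τ) (hh : 0 < h) :
    h⁻¹ ^ 2 * Real.exp (-τ / h) ≤ 8 / τ ^ 2 * Real.exp (-(τ / 2) / h) := by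
  have h1 : (τ / 2 / h) ^ 2 / 2 ≤ Real.exp (τ / 2 / h) := by
    have := Real.quadratic_le_exp_of_nonneg (x := τ / 2 / h) (by positivity)
    have h2 : 0 ≤ τ / 2 / h := by positivity
    linarith
  have h3 : Real.exp (-τ / h) = Real.exp (-(τ / 2) / h) * Real.exp (-(τ / 2) / h) := by
    rw [← Real.exp_add]
    congr 1
    ring
  have h4 : h⁻¹ ^ 2 * Real.exp (-(τ / 2) / h) ≤ 8 / τ ^ 2 := by
    rw [neg_div, Real.exp_neg]
    have h5 := inv_anti₀ (by positivity) h1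
    refine (mul_le_mul_of_nonneg_left h5 (by positivity)).trans (le_of_eq ?_)
    field_simp
    norm_num
  rw [h3, ← mul_assoc]
  exact mul_le_mul_of_nonneg_right h4 (Real.exp_nonneg _)

end Comparison

/-! ### Trial functions for the two comparisons -/

section Main

variable {E : Type} [NormedAddCommGroup E] [InnerProductSpace ℝ E] [FiniteDimensional ℝ E]
  [MeasurableSpace E] [BorelSpace E] {ω : Set E} {Hp Hm : E → ℝ} {h : ℝ}

lemma mem_thin_iff_pos (x : WithLp 2 (E × ℝ)) : x ∈ thin ω Hp Hm h ↔ h⁻¹ • x.fst ∈ ω ∧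
    1 * x.snd < 1 + h * Hp (h⁻¹ • x.fst) ∧ -(1 * x.snd) < 1 + h * Hm (h⁻¹ • x.fst) := by
  rw [one_mul]
  exact Iff.rfl

lemma mem_thin_iff_neg (x : WithLp 2 (E × ℝ)) : x ∈ thin ω Hp Hm h ↔ h⁻¹ • x.fst ∈ ω ∧
    -1 * x.snd < 1 + h * Hm (h⁻¹ • x.fst) ∧ -(-1 * x.snd) < 1 + h * Hp (h⁻¹ • x.fst) := by
  rw [neg_one_mul, neg_neg]
  exact and_congr_right fun _ => and_comm

lemma gap_of_mul_lt {H : E → ℝ} {a : ℝ} (ha : ∀ η, |H η| ≤ a) (hh : 0 < h) (hha : h * a < 1 / 4)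
    (η : E) : 0 < 1 + h * H η := by
  have := mul_le_mul_of_nonneg_left (neg_le.1 (abs_le.1 (ha η)).1) hh.le
  linarith

/-- The eigenvectors of the two semi-infinite cylinders, glued into the two halves of the thin
cylinder, are almost orthonormal there, with almost diagonal energy form. -/
lemma exists_trial_functions (hω : IsOpen ω) (hHp : Continuous Hp) (hHm : Continuous Hm) {a : ℝ}
    (hap : ∀ η, |Hp η| ≤ a) (ham : ∀ η, |Hm η| ≤ a) (hh : 0 < h) (hh1 : h ≤ 1)
    (hha : h * a < 1 / 4) {C : ℝ} (hC : ∀ x, |deriv Real.smoothTransition x| ≤ C)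
    {ι κ : Type} [DecidableEq ι] [DecidableEq κ] {Λp : ι → ℝ} {Λm : κ → ℝ}
    {up : ι → L2Pair (semi ω Hp)} {um : κ → L2Pair (semi ω Hm)}
    (hup : IsEigenbasis (semi ω Hp) (semiSide ω Hp) Λp up)
    (hum : IsEigenbasis (semi ω Hm) (semiSide ω Hm) Λm um) {μ ε : ℝ}
    (hμ : 0 ≤ μ) (hε : 0 ≤ ε) (hΛp : ∀ i, Λp i ≤ μ) (hΛm : ∀ i, Λm i ≤ μ)
    (hmp : ∀ i, mass (up i) (Ici (2 * h)⁻¹) ≤ ε) (hmm : ∀ i, mass (um i) (Ici (2 * h)⁻¹) ≤ ε) :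
    ∃ φ : ι ⊕ κ → L2Pair (thin ω Hp Hm h),
      (∀ r, φ r ∈ sobolev (thin ω Hp Hm h) (thinSide ω Hp Hm h)) ∧
      (∀ r s, |⟪(φ r).fst, (φ s).fst⟫ - if r = s then 1 else 0| ≤ (μ + 1 + 16 * C ^ 2) * ε) ∧
      ∀ r s, |h ^ 2 * ⟪(φ r).snd, (φ s).snd⟫ - if r = s then Sum.elim Λp Λm r else 0| ≤
        (μ + 1 + 16 * C ^ 2) * ε := by
  have hΩ := isOpen_thin hω hHp hHm h
  have hcl := mem_closure_thinSide_iff hω hHp hHm hh.ne'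
    fun η => ⟨gap_of_mul_lt hap hh hha η, gap_of_mul_lt ham hh hha η⟩
  obtain ⟨A, hA1, hA2, hA3⟩ := exists_semi_to_thin (e := 1) (S := thinSide ω Hp Hm h) hω hHp ham
    (by norm_num) hh hha hΩ mem_thin_iff_pos (fun x => by rw [hcl, one_mul]) hC
  obtain ⟨B, hB1, hB2, hB3⟩ := exists_semi_to_thin (e := -1) (S := thinSide ω Hp Hm h) hω hHm hap
    (by norm_num) hh hha hΩ mem_thin_iff_neg
    (fun x => by rw [hcl, neg_one_mul, neg_neg, and_comm (a := x.snd ≤ _)]) hC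
  have hdis : ∀ U W, ⟪(A U).fst, (B W).fst⟫ = 0 ∧ ⟪(A U).snd, (B W).snd⟫ = 0 := fun U W => by
    constructor
    all_goals
      refine inner_eq_zero_of_ae ?_
      filter_upwards [hA2 U, hB2 W] with x hx1 hx2
      rcases le_total x.snd 0 with hx | hx
    · exact Or.inl (hx1 (by linarith)).1
    · exact Or.inr (hx2 (by linarith)).1
    · exact Or.inl (hx1 (by linarith)).2
    · exact Or.inr (hx2 (by linarith)).2
  have hdis' : ∀ U W, ⟪(B W).fst, (A U).fst⟫ = 0 ∧ ⟪(B W).snd, (A U).snd⟫ = 0 := fun U W =>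
    ⟨by rw [real_inner_comm, (hdis U W).1], by rw [real_inner_comm, (hdis U W).2]⟩
  -- the error bounds in terms of the masses
  have herr : ∀ {s t x y : ℝ}, 0 ≤ s → s ≤ μ → 0 ≤ t → t ≤ μ → 0 ≤ x → x ≤ ε → 0 ≤ y → y ≤ ε →
      1 / 2 * (x + y) ≤ (μ + 1 + 16 * C ^ 2) * ε ∧
      (|(s + t) / 2| + (4 * h * C) ^ 2) / 2 * (x + y) ≤ (μ + 1 + 16 * C ^ 2) * ε := by
    intro s t x y hs hsμ ht htμ hx hxε hy hyε
    have h1 : (h * C) ^ 2 ≤ C ^ 2 := by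
      rw [mul_pow]
      exact mul_le_of_le_one_left (sq_nonneg _) (pow_le_one₀ hh.le hh1)
    have h2 : |(s + t) / 2| ≤ μ := by
      rw [abs_of_nonneg (by linarith)]
      linarith
    have h3 : 0 ≤ μ := hs.trans hsμ
    have h4 : 0 ≤ ε := hx.trans hxε
    constructor
    · nlinarith [mul_nonneg h3 h4, mul_nonneg (sq_nonneg C) h4]
    · calc _ ≤ (μ + 16 * C ^ 2) / 2 * (ε + ε) := by
            gcongr
            nlinarith
        _ ≤ _ := by linarith
  refine ⟨Sum.elim (fun i => A (up i)) fun j => B (um j), ?_, ?_, ?_⟩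
  · rintro (i | j)
    · exact hA1 _ (hup.mem i).1
    · exact hB1 _ (hum.mem j).1
  · have h0 : 0 ≤ (μ + 1 + 16 * C ^ 2) * ε := by positivity
    rintro (i | i) (j | j)
    · have h1 := (hA3 _ _ _ _ (hup.mem i) (hup.mem j)).1
      rw [hup.orth] at h1
      simp only [Sum.elim_inl, Sum.inl.injEq]
      exact h1.trans (herr (hup.nonneg i) (hΛp i) (hup.nonneg j) (hΛp j) (mass_nonneg _ _) (hmp i)
        (mass_nonneg _ _) (hmp j)).1
    · simpa [(hdis _ _).1] using h0
    · simpa [(hdis' _ _).1] using h0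
    · have h1 := (hB3 _ _ _ _ (hum.mem i) (hum.mem j)).1
      rw [hum.orth] at h1
      simp only [Sum.elim_inr, Sum.inr.injEq]
      exact h1.trans (herr (hum.nonneg i) (hΛm i) (hum.nonneg j) (hΛm j) (mass_nonneg _ _) (hmm i)
        (mass_nonneg _ _) (hmm j)).1
  · have h0 : 0 ≤ (μ + 1 + 16 * C ^ 2) * ε := by positivity
    have havg : ∀ {ι : Type} [DecidableEq ι] (L : ι → ℝ) (i j : ι),
        (L i + L j) / 2 * (if i = j then (1 : ℝ) else 0) = if i = j then L i else 0 := by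
      intro ι _ L i j
      split_ifs with hij
      · rw [hij]
        ring
      · rw [mul_zero]
    rintro (i | i) (j | j)
    · have h1 := (hA3 _ _ _ _ (hup.mem i) (hup.mem j)).2
      rw [hup.orth, havg] at h1
      simp only [Sum.elim_inl, Sum.inl.injEq]
      exact h1.trans (herr (hup.nonneg i) (hΛp i) (hup.nonneg j) (hΛp j) (mass_nonneg _ _) (hmp i)
        (mass_nonneg _ _) (hmp j)).2
    · simpa [(hdis _ _).2] using h0
    · simpa [(hdis' _ _).2] using h0
    · have h1 := (hB3 _ _ _ _ (hum.mem i) (hum.mem j)).2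
      rw [hum.orth, havg] at h1
      simp only [Sum.elim_inr, Sum.inr.injEq]
      exact h1.trans (herr (hum.nonneg i) (hΛm i) (hum.nonneg j) (hΛm j) (mass_nonneg _ _) (hmm i)
        (mass_nonneg _ _) (hmm j)).2

/-- The squares of the cutoffs to the two halves add up to `1` outside the middle. -/
lemma abs_halves_sub_one_le (z : ℝ) :
    |Real.smoothTransition (4 * 1 * z + -1) ^ 2 + Real.smoothTransition (4 * -1 * z + -1) ^ 2 - 1| ≤
      (Icc (-(1 / 2)) (1 / 2)).indicator (fun _ => 1) z := by
  have hle : ∀ z : ℝ, 0 ≤ Real.smoothTransition z ^ 2 ∧ Real.smoothTransition z ^ 2 ≤ 1 := fun z =>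
    ⟨sq_nonneg _, pow_le_one₀ (Real.smoothTransition.nonneg _) (Real.smoothTransition.le_one _)⟩
  by_cases hz : z ∈ Icc (-(1 / 2) : ℝ) (1 / 2)
  · rw [indicator_of_mem hz, abs_le]
    have h1 := hle (4 * 1 * z + -1)
    have h2 := hle (4 * -1 * z + -1)
    constructor <;> linarith [h1.1, h1.2, h2.1, h2.2]
  · rw [indicator_of_notMem hz]
    have h3 : (1 / 2 < z) ∨ (z < -(1 / 2)) := by
      by_contra h4
      push Not at h4
      exact hz ⟨h4.2, h4.1⟩
    rcases h3 with h3 | h3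
    · rw [Real.smoothTransition.one_of_one_le (by linarith : 1 ≤ 4 * 1 * z + -1),
        Real.smoothTransition.zero_of_nonpos (by linarith : 4 * -1 * z + -1 ≤ 0)]
      simp
    · rw [Real.smoothTransition.one_of_one_le (by linarith : 1 ≤ 4 * -1 * z + -1),
        Real.smoothTransition.zero_of_nonpos (by linarith : 4 * 1 * z + -1 ≤ 0)]
      simp

lemma abs_integral_halves_sub_le {Ω : Set (WithLp 2 (E × ℝ))} (U W : L2Pair Ω) :
    |(∫ x in Ω, Real.smoothTransition (4 * 1 * x.snd + -1) ^ 2 * (U.fst x * W.fst x)) +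
        (∫ x in Ω, Real.smoothTransition (4 * -1 * x.snd + -1) ^ 2 * (U.fst x * W.fst x)) -
        ⟪U.fst, W.fst⟫| ≤
      1 / 2 * (mass U (Icc (-(1 / 2)) (1 / 2)) + mass W (Icc (-(1 / 2)) (1 / 2))) := by
  have c : ∀ b : ℝ, Continuous fun x : WithLp 2 (E × ℝ) =>
      Real.smoothTransition (4 * b * x.snd + -1) ^ 2 := fun b =>
    (Real.smoothTransition.continuous.comp (by fun_prop)).pow 2
  have hb : ∀ z : ℝ, |Real.smoothTransition z ^ 2| ≤ 1 := fun z => by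
    rw [abs_of_nonneg (sq_nonneg _)]
    exact pow_le_one₀ (Real.smoothTransition.nonneg _) (Real.smoothTransition.le_one _)
  rw [← integral_add (integrable_bdd_mul_fst _ _ (c 1) fun x => hb _)
      (integrable_bdd_mul_fst _ _ (c (-1)) fun x => hb _)]
  have e1 := abs_integral_mul_sub_inner_le
    (f := fun x => Real.smoothTransition (4 * 1 * x.snd + -1) ^ 2 +
      Real.smoothTransition (4 * -1 * x.snd + -1) ^ 2) ((c 1).add (c (-1)))
    (measurableSet_Icc (a := (-(1 / 2) : ℝ)) (b := 1 / 2)) (fun x => abs_halves_sub_one_le x.snd) U W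
  simpa only [add_mul] using e1

lemma abs_add_sub_le {a₁ a₂ b₁ b₂ α d μ ε k : ℝ} (hα : 0 ≤ α) (hαμ : α ≤ μ)
    (h₁ : |a₁ - α * b₁| ≤ k) (h₂ : |a₂ - α * b₂| ≤ k) (h₃ : |b₁ + b₂ - d| ≤ ε) :
    |a₁ + a₂ - α * d| ≤ k + k + μ * ε := by
  have h4 : |α * (b₁ + b₂ - d)| ≤ μ * ε := by
    rw [abs_mul, abs_of_nonneg hα]
    exact mul_le_mul hαμ h₃ (abs_nonneg _) (hα.trans hαμ)
  have h5 : a₁ + a₂ - α * d = (a₁ - α * b₁) + (a₂ - α * b₂) + α * (b₁ + b₂ - d) := by ring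
  rw [h5]
  exact (abs_add_le _ _).trans (add_le_add ((abs_add_le _ _).trans (add_le_add h₁ h₂)) h4)

/-- The Gram matrix and the energy matrix of the two halves of eigenvectors `w i`, `w j`. -/
lemma gram_halves_le {Ω S : Set (WithLp 2 (E × ℝ))} {ι : Type} [DecidableEq ι] {lam : ι → ℝ}
    {w : ι → L2Pair Ω} (hw : IsEigenbasis Ω S lam w) (hh1 : h ^ 2 ≤ 1) {C μ ε : ℝ} (hμ : 0 ≤ μ)
    (hε : 0 ≤ ε) {i j : ι} (hi : h ^ 2 * lam i ≤ μ) (hj : h ^ 2 * lam j ≤ μ)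
    (mi : mass (w i) (Icc (-(1 / 2)) (1 / 2)) ≤ ε) (mj : mass (w j) (Icc (-(1 / 2)) (1 / 2)) ≤ ε)
    {p₁ p₂ q₁ q₂ : ℝ}
    (a1 : p₁ = ∫ x in Ω, Real.smoothTransition (4 * 1 * x.snd + -1) ^ 2 *
      ((w i).fst x * (w j).fst x))
    (b1 : p₂ = ∫ x in Ω, Real.smoothTransition (4 * -1 * x.snd + -1) ^ 2 *
      ((w i).fst x * (w j).fst x))
    (a2 : |q₁ - h ^ 2 * ((lam i + lam j) / 2 * p₁)| ≤ h ^ 2 * ((4 * C) ^ 2 / 2 *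
      (mass (w i) (Icc (-(1 / 2)) (1 / 2)) + mass (w j) (Icc (-(1 / 2)) (1 / 2)))))
    (b2 : |q₂ - h ^ 2 * ((lam i + lam j) / 2 * p₂)| ≤ h ^ 2 * ((4 * C) ^ 2 / 2 *
      (mass (w i) (Icc (-(1 / 2)) (1 / 2)) + mass (w j) (Icc (-(1 / 2)) (1 / 2))))) :
    |p₁ + p₂ - if i = j then 1 else 0| ≤ (μ + 1 + 32 * C ^ 2) * ε ∧
      |q₁ + q₂ - if i = j then h ^ 2 * lam i else 0| ≤ (μ + 1 + 32 * C ^ 2) * ε := by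
  have e1 := abs_integral_halves_sub_le (w i) (w j)
  rw [← a1, ← b1, hw.orth] at e1
  have hm : mass (w i) (Icc (-(1 / 2)) (1 / 2)) + mass (w j) (Icc (-(1 / 2)) (1 / 2)) ≤ 2 * ε := by
    linarith
  have hm0 : 0 ≤ mass (w i) (Icc (-(1 / 2)) (1 / 2)) + mass (w j) (Icc (-(1 / 2)) (1 / 2)) :=
    add_nonneg (mass_nonneg _ _) (mass_nonneg _ _)
  have hi0 := hw.nonneg i
  have hj0 := hw.nonneg j
  have havg : (if i = j then h ^ 2 * lam i else 0) =
      h ^ 2 * ((lam i + lam j) / 2) * if i = j then 1 else 0 := by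
    split_ifs with hij
    · rw [hij]
      ring
    · rw [mul_zero]
  rw [havg]
  rw [← mul_assoc] at a2 b2
  generalize mass (w i) (Icc (-(1 / 2)) (1 / 2)) + mass (w j) (Icc (-(1 / 2)) (1 / 2)) = m at a2 b2 e1 hm hm0
  have e2 : |p₁ + p₂ - if i = j then 1 else 0| ≤ ε := e1.trans (by linarith only [hm])
  have hC0 := sq_nonneg C
  have hμε := mul_nonneg hμ hε
  have hCε := mul_nonneg hC0 hε
  have e3 : h ^ 2 * ((4 * C) ^ 2 / 2 * m) ≤ 16 * C ^ 2 * ε := by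
    refine (mul_le_of_le_one_left (mul_nonneg (by positivity) hm0) hh1).trans ?_
    refine (mul_le_mul_of_nonneg_left hm (by positivity)).trans (le_of_eq ?_)
    ring
  have e4 : h ^ 2 * ((lam i + lam j) / 2) ≤ μ := by
    have : h ^ 2 * ((lam i + lam j) / 2) = (h ^ 2 * lam i + h ^ 2 * lam j) / 2 := by ring
    rw [this]
    linarith only [hi, hj]
  have e5 : 0 ≤ h ^ 2 * ((lam i + lam j) / 2) := by positivity
  exact ⟨e2.trans (by linarith only [hμε, hCε]),
    (abs_add_sub_le e5 e4 (a2.trans e3) (b2.trans e3) e2).trans (by linarith only [hε, hμε, hCε])⟩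

/-- Eigenvectors of the thin cylinder below the threshold, cut into two halves, stay almost
orthonormal on the union of the two semi-infinite cylinders, with almost diagonal energy form. -/
lemma exists_halves (hω : IsOpen ω) (hHp : Continuous Hp) (hHm : Continuous Hm) {a : ℝ}
    (hap : ∀ η, |Hp η| ≤ a) (ham : ∀ η, |Hm η| ≤ a) (hh : 0 < h) (hh1 : h ≤ 1)
    (hha : h * a < 1 / 4) {C : ℝ} (hC : ∀ x, |deriv Real.smoothTransition x| ≤ C) :
    ∃ (A : L2Pair (thin ω Hp Hm h) →L[ℝ] L2Pair (semi ω Hp))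
      (B : L2Pair (thin ω Hp Hm h) →L[ℝ] L2Pair (semi ω Hm)),
      (∀ U ∈ sobolev (thin ω Hp Hm h) (thinSide ω Hp Hm h),
        A U ∈ sobolev (semi ω Hp) (semiSide ω Hp) ∧ B U ∈ sobolev (semi ω Hm) (semiSide ω Hm)) ∧
      ∀ {ι : Type} [DecidableEq ι] {lam : ι → ℝ} {w : ι → L2Pair (thin ω Hp Hm h)},
        IsEigenbasis (thin ω Hp Hm h) (thinSide ω Hp Hm h) lam w → ∀ {μ ε : ℝ}, 0 ≤ μ → 0 ≤ ε →
        ∀ i j, h ^ 2 * lam i ≤ μ → h ^ 2 * lam j ≤ μ →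
        mass (w i) (Icc (-(1 / 2)) (1 / 2)) ≤ ε → mass (w j) (Icc (-(1 / 2)) (1 / 2)) ≤ ε →
        |(⟪(A (w i)).fst, (A (w j)).fst⟫ + ⟪(B (w i)).fst, (B (w j)).fst⟫) -
          if i = j then 1 else 0| ≤ (μ + 1 + 32 * C ^ 2) * ε ∧
        |(⟪(A (w i)).snd, (A (w j)).snd⟫ + ⟪(B (w i)).snd, (B (w j)).snd⟫) -
          if i = j then h ^ 2 * lam i else 0| ≤ (μ + 1 + 32 * C ^ 2) * ε := by
  have hΩ := isOpen_thin hω hHp hHm h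
  have hcl := mem_closure_thinSide_iff hω hHp hHm hh.ne'
    fun η => ⟨gap_of_mul_lt hap hh hha η, gap_of_mul_lt ham hh hha η⟩
  have hSp : ∀ x : WithLp 2 (E × ℝ), x ∈ closure (thinSide ω Hp Hm h) ↔ h⁻¹ • x.fst ∈ frontier ω ∧
      1 * x.snd ≤ 1 + h * Hp (h⁻¹ • x.fst) ∧ -(1 * x.snd) ≤ 1 + h * Hm (h⁻¹ • x.fst) :=
    fun x => by rw [hcl, one_mul]
  have hSm : ∀ x : WithLp 2 (E × ℝ), x ∈ closure (thinSide ω Hp Hm h) ↔ h⁻¹ • x.fst ∈ frontier ω ∧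
      -1 * x.snd ≤ 1 + h * Hm (h⁻¹ • x.fst) ∧ -(-1 * x.snd) ≤ 1 + h * Hp (h⁻¹ • x.fst) :=
    fun x => by rw [hcl, neg_one_mul, neg_neg, and_comm (a := x.snd ≤ _)]
  have hApos := exists_thin_to_semi (e := 1) hω hHp ham (one_pow 2) hh hha hΩ mem_thin_iff_pos hSp hC
  have hBneg := exists_thin_to_semi (e := -1) hω hHm hap (neg_one_sq) hh hha hΩ mem_thin_iff_neg hSm hC
  obtain ⟨A, hA1, hA2⟩ := hApos
  obtain ⟨B, hB1, hB2⟩ := hBneg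
  refine ⟨A, B, fun U hU => ⟨hA1 U hU, hB1 U hU⟩, fun {ι _ lam w} hw {μ ε} hμ hε i j hi hj mi mj => ?_⟩
  obtain ⟨a1, a2⟩ := hA2 _ _ _ _ (hw.mem i) (hw.mem j)
  obtain ⟨b1, b2⟩ := hB2 _ _ _ _ (hw.mem i) (hw.mem j)
  exact gram_halves_le hw (pow_le_one₀ hh.le hh1) hμ hε hi hj mi mj a1 b1 a2 b2

end Main

/-! ### Bounds for single eigenvalues -/

section Bounds

variable {F : Type} [NormedAddCommGroup F] [InnerProductSpace ℝ F] [FiniteDimensional ℝ F]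
  [MeasurableSpace F] [BorelSpace F] {Ω S : Set F}

/-- The upper bound for the `p`-th eigenvalue by `p + 1` approximate eigenvectors. -/
lemma eigenvalue_le_of_trial {lam : ℕ → ℝ} (hlam : IsEigenvalueSequence Ω S lam)
    (hco : ∀ t, CoerciveModFinite Ω S t) {ι : Type} [DecidableEq ι] {φ : ι → L2Pair Ω}
    (hφ : ∀ i, φ i ∈ sobolev Ω S) {L : ι → ℝ} {r ε : ℝ} (hr : 0 ≤ r) (hε : 0 ≤ ε)
    (hB : ∀ i j, |⟪(φ i).fst, (φ j).fst⟫ - if i = j then 1 else 0| ≤ ε)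
    (hA : ∀ i j, |r * ⟪(φ i).snd, (φ j).snd⟫ - if i = j then L i else 0| ≤ ε)
    {n : ℕ} {Λ : Fin n → ℝ} (hmono : Monotone Λ) (e : Fin n ≃ ι) (hL : ∀ q, Λ q = L (e q))
    (p : Fin n) :
    r * lam p * (1 - ((p : ℕ) + 1 : ℝ) * ε) ≤ Λ p + ((p : ℕ) + 1 : ℝ) * ε := by
  have hcard : Fintype.card (Iic p) = p + 1 := by simp
  obtain ⟨c, hc0, hc⟩ := hlam.exists_trial hco (κ := Iic p) (m := p)
    (by rw [hcard]; exact Nat.lt_succ_self _) (φ := fun q => φ (e q)) fun q => hφ _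
  obtain ⟨w, hw, -⟩ := hlam.exists_isEigenbasis
  have key := rayleigh_le (κ := Iic p) (c := c) (d := fun q => Λ q) (T := Λ p) (t := r * lam p)
    (B := fun q q' => ⟪(φ (e q)).fst, (φ (e q')).fst⟫)
    (A := fun q q' => r * ⟪(φ (e q)).snd, (φ (e q')).snd⟫) hc0 hε
    (mul_nonneg hr (hw.nonneg p))
    (fun q q' => by
      have := hB (e q) (e q')
      simpa [Subtype.ext_iff] using this)
    (fun q q' => by
      have := hA (e q) (e q')
      rw [← hL] at this
      simpa [Subtype.ext_iff] using this) (fun q => hmono q.2) ?_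
  · rw [hcard] at key
    push_cast at key
    exact key
  · have h1 := mul_le_mul_of_nonneg_left hc hr
    rw [← mul_assoc] at h1
    refine h1.trans (le_of_eq ?_)
    simp only [Finset.mul_sum]
    exact Finset.sum_congr rfl fun i _ => Finset.sum_congr rfl fun j _ => by ring

/-- The lower bound: the first `p + 1` eigenvectors, carried to two limit problems, cannot all have
energy below the `p`-th eigenvalue of the union of those problems. -/
lemma le_of_halves {Ω₁ S₁ Ω₂ S₂ : Set F} {ι₁ ι₂ : Type} {L₁ : ι₁ → ℝ} {L₂ : ι₂ → ℝ}
    {u₁ : ι₁ → L2Pair Ω₁} {u₂ : ι₂ → L2Pair Ω₂} {n : ℕ} {Λ : Fin n → ℝ} (hmono : Monotone Λ)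
    (e : Fin n ≃ ι₁ ⊕ ι₂) (hL : ∀ q, Λ q = Sum.elim L₁ L₂ (e q)) (p : Fin n) (hp : 0 ≤ Λ p)
    (h₁ : ∀ U ∈ sobolev Ω₁ S₁, (∀ i, L₁ i < Λ p → ⟪(u₁ i).fst, U.fst⟫ = 0) →
      Λ p * ‖U.fst‖ ^ 2 ≤ ‖U.snd‖ ^ 2)
    (h₂ : ∀ U ∈ sobolev Ω₂ S₂, (∀ i, L₂ i < Λ p → ⟪(u₂ i).fst, U.fst⟫ = 0) →
      Λ p * ‖U.fst‖ ^ 2 ≤ ‖U.snd‖ ^ 2)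
    {v₁ : Fin (p + 1) → L2Pair Ω₁} {v₂ : Fin (p + 1) → L2Pair Ω₂}
    (hv₁ : ∀ i, v₁ i ∈ sobolev Ω₁ S₁) (hv₂ : ∀ i, v₂ i ∈ sobolev Ω₂ S₂) {d : Fin (p + 1) → ℝ}
    {X ε : ℝ} (hd : ∀ i, d i ≤ X) (hε : 0 ≤ ε)
    (hB : ∀ i j, |(⟪(v₁ i).fst, (v₁ j).fst⟫ + ⟪(v₂ i).fst, (v₂ j).fst⟫) -
      if i = j then 1 else 0| ≤ ε)
    (hA : ∀ i j, |(⟪(v₁ i).snd, (v₁ j).snd⟫ + ⟪(v₂ i).snd, (v₂ j).snd⟫) -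
      if i = j then d i else 0| ≤ ε) :
    Λ p * (1 - ((p : ℕ) + 1 : ℝ) * ε) ≤ X + ((p : ℕ) + 1 : ℝ) * ε := by
  -- at most `p` members of the joint list are below `Λ p`, so some combination of the `p + 1` pairs
  -- is orthogonal to their eigenvectors
  let g : Fin (p + 1) → ι₁ ⊕ ι₂ → ℝ := fun i => Sum.elim
    (fun a => ⟪(u₁ a).fst, (v₁ i).fst⟫) fun b => ⟪(u₂ b).fst, (v₂ i).fst⟫
  obtain ⟨c, hc0, hc⟩ := exists_ne_zero_sum_mul_eq_zero (κ := Fin (p + 1)) (κ' := Iio p) (by simp)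
    fun i q => g i (e q)
  have hlt : ∀ s, Sum.elim L₁ L₂ s < Λ p → ∑ i, c i * g i s = 0 := by
    intro s hs
    have h1 : e.symm s < p := by
      by_contra h
      have := hmono (not_lt.1 h)
      rw [hL (e.symm s), e.apply_symm_apply] at this
      exact hs.not_ge this
    have := hc ⟨e.symm s, h1⟩
    simpa using this
  have k₁ := h₁ (∑ i, c i • v₁ i) (Submodule.sum_mem _ fun i _ => Submodule.smul_mem _ _ (hv₁ i))
    fun a ha => by
      rw [fst_sum_smul, inner_sum]
      simp only [real_inner_smul_right]
      exact hlt (Sum.inl a) ha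
  have k₂ := h₂ (∑ i, c i • v₂ i) (Submodule.sum_mem _ fun i _ => Submodule.smul_mem _ _ (hv₂ i))
    fun a ha => by
      rw [fst_sum_smul, inner_sum]
      simp only [real_inner_smul_right]
      exact hlt (Sum.inr a) ha
  rw [norm_sq_fst_sum, norm_sq_snd_sum] at k₁ k₂
  have key := rayleigh_le hc0 hε hp hB hA hd (by
    simp only [mul_add, Finset.sum_add_distrib]
    linarith)
  simpa using key

end Bounds

/-! ### The asymptotics of the eigenvalues -/

section Main

variable {E : Type} [NormedAddCommGroup E] [InnerProductSpace ℝ E] [FiniteDimensional ℝ E]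
  [MeasurableSpace E] [BorelSpace E] {ω : Set E} {Hp Hm : E → ℝ}

lemma exists_isEigenvalueSequence_thin (hω : IsOpen ω) (hne : ω.Nonempty)
    (hb : Bornology.IsBounded ω) {Kp Km : ℝ≥0} (hHp : LipschitzWith Kp Hp)
    (hHm : LipschitzWith Km Hm) {a : ℝ} (hap : ∀ η, |Hp η| ≤ a) (ham : ∀ η, |Hm η| ≤ a) {h : ℝ}
    (hh : 0 < h) (hha : h * a < 1 / 4) :
    ∃ lam, IsEigenvalueSequence (thin ω Hp Hm h) (thinSide ω Hp Hm h) lam := by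
  have hΩ := isOpen_thin hω hHp.continuous hHm.continuous h
  have : Nontrivial (WithLp 2 (E × ℝ)) := (WithLp.equiv 2 (E × ℝ)).nontrivial
  obtain ⟨η, hη⟩ := hne
  have hx : (WithLp.toLp 2 (h • η, 0) : WithLp 2 (E × ℝ)) ∈ thin ω Hp Hm h := by
    have h1 : h⁻¹ • h • η = η := by rw [smul_smul, inv_mul_cancel₀ hh.ne', one_smul]
    refine ⟨by change h⁻¹ • h • η ∈ ω; rwa [h1], ?_, ?_⟩
    · change 0 < 1 + h * Hp (h⁻¹ • h • η)
      exact gap_of_mul_lt hap hh hha _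
    · change -0 < 1 + h * Hm (h⁻¹ • h • η)
      rw [neg_zero]
      exact gap_of_mul_lt ham hh hha _
  obtain ⟨φ, hφ, hφo⟩ := exists_orthonormal_mem_sobolev (S := thinSide ω Hp Hm h) hΩ ⟨_, hx⟩
    (Set.disjoint_left.2 fun x hx hx' => by
      have h1 := closure_minimal sdiff_subset isClosed_frontier hx'
      rw [hΩ.frontier_eq] at h1
      exact h1.2 hx)
  exact exists_isEigenvalueSequence
    (coerciveModFinite_thin hω hb hHp hHm hap ham hh hha.le) φ hφ hφo

set_option maxHeartbeats 2000000 in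
/-- The asymptotics of the eigenvalues when the ends are graphs of bounded Lipschitz functions on the
whole space. -/
theorem abs_eigenvalue_sub_le [Nontrivial E] (hω : IsOpen ω) (hne : ω.Nonempty)
    (hb : Bornology.IsBounded ω) {Kp Km : ℝ≥0} (hHp : LipschitzWith Kp Hp)
    (hHm : LipschitzWith Km Hm) {a : ℝ} (hap : ∀ η, |Hp η| ≤ a) (ham : ∀ η, |Hm η| ≤ a)
    {μ₁ δ₁ : ℝ} (hμ₁ : IsLeast {t | IsEigenvalue ω (frontier ω) t} μ₁) (hδ₁ : 0 < δ₁)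
    {Np Nm : ℕ} {Λp : Fin Np → ℝ} {Λm : Fin Nm → ℝ}
    (hLp : ListsEigenvalues (semi ω Hp) (semiSide ω Hp) (Ioc 0 (μ₁ - δ₁)) Λp)
    (hLm : ListsEigenvalues (semi ω Hm) (semiSide ω Hm) (Ioc 0 (μ₁ - δ₁)) Λm)
    {Λ : Fin (Np + Nm) → ℝ} (hmono : Monotone Λ) (e : Fin (Np + Nm) ≃ Fin Np ⊕ Fin Nm)
    (hL : ∀ p, Λ p = Sum.elim Λp Λm (e p)) (p : Fin (Np + Nm)) :
    ∃ c > 0, ∃ τ > 0, ∃ h₀ > 0, ∀ h : ℝ, 0 < h → h ≤ h₀ →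
      (∃ lam : ℕ → ℝ, IsEigenvalueSequence (thin ω Hp Hm h) (thinSide ω Hp Hm h) lam) ∧
      ∀ lam : ℕ → ℝ, IsEigenvalueSequence (thin ω Hp Hm h) (thinSide ω Hp Hm h) lam →
        |lam p - h⁻¹ ^ 2 * Λ p| ≤ c * Real.exp (-τ / h) := by
  have ha0 : 0 ≤ a := (abs_nonneg _).trans (hap 0)
  have hΛp : Λ p ∈ Ioc 0 (μ₁ - δ₁) := by
    rw [hL]
    rcases e p with i | i
    · exact hLp.1 i
    · exact hLm.1 i
  have hμ0 : 0 < μ₁ := by linarith [hΛp.1, hΛp.2]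
  obtain ⟨C, hC1, hC⟩ := exists_abs_deriv_smoothTransition_le
  obtain ⟨τ₁, hτ₁, D₁, hD₁, hdec₁⟩ := exists_decay_semi hω hb hμ₁ hμ0.le hδ₁ (a := a)
  obtain ⟨τ₂, hτ₂, D₂, hD₂, hdec₂⟩ := exists_decay_thin hω hb hμ₁ hμ0.le (half_pos hδ₁) (a := a)
  obtain ⟨up, hup, hspanp⟩ := hLp.exists_isEigenbasis fun t => inferInstance
  obtain ⟨um, hum, hspanm⟩ := hLm.exists_isEigenbasis fun t => inferInstance
  obtain ⟨cp, hcp⟩ := exists_poincare_semi hω hb hHp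
  obtain ⟨cm, hcm⟩ := exists_poincare_semi hω hb hHm
  have hcop := coerciveModFinite_semi hω hb hμ₁ hHp hap (t := μ₁ - δ₁ / 2)
    (by linarith [hΛp.1, hΛp.2]) (by linarith)
  have hcom := coerciveModFinite_semi hω hb hμ₁ hHm ham (t := μ₁ - δ₁ / 2)
    (by linarith [hΛp.1, hΛp.2]) (by linarith)
  set τ : ℝ := min (τ₁ / 2) τ₂ with hτ
  have hτ0 : 0 < τ := lt_min (half_pos hτ₁) hτ₂
  set G : ℝ := (μ₁ + 1 + 32 * C ^ 2) * (D₁ + D₂) with hG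
  have hG0 : 0 < G := by positivity
  set N : ℝ := (p : ℕ) + 1 with hN
  have hN0 : 0 < N := by positivity
  -- `κ` bounds `1 + Λ p` and, by the upper bound, `1 + h² lam p`; `s₀` keeps `h² lam p` below the
  -- threshold by `δ₁ / 2`
  set κ : ℝ := 2 * μ₁ + 2 with hκ
  have hκ0 : 0 < κ := by positivity
  set s₀ : ℝ := min (1 / 2) (δ₁ / (2 * κ)) with hs₀
  have hs₀0 : 0 < s₀ := lt_min (by norm_num) (by positivity)
  refine ⟨N * G * κ * (8 / τ ^ 2), by positivity, τ / 2, half_pos hτ0,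
    min 1 (min (1 / (4 * (a + 1))) (τ * s₀ / (N * G))), by positivity, fun h hh hh₀ => ?_⟩
  have hh1 : h ≤ 1 := hh₀.trans (min_le_left _ _)
  have hha : h * a < 1 / 4 := by
    have h1 : h ≤ 1 / (4 * (a + 1)) := hh₀.trans ((min_le_right _ _).trans (min_le_left _ _))
    rw [le_div_iff₀ (by positivity)] at h1
    nlinarith
  have hhs : N * G * (h / τ) ≤ s₀ := by
    have h1 : h ≤ τ * s₀ / (N * G) := hh₀.trans ((min_le_right _ _).trans (min_le_right _ _))
    rw [le_div_iff₀ (by positivity)] at h1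
    rw [mul_div_assoc', div_le_iff₀ hτ0]
    linarith
  refine ⟨exists_isEigenvalueSequence_thin hω hne hb hHp hHm hap ham hh hha, fun lam hlam => ?_⟩
  have hco := coerciveModFinite_thin hω hb hHp hHm hap ham hh hha.le
  set M : ℝ := (D₁ + D₂) * Real.exp (-τ / h) with hM
  have hM0 : 0 ≤ M := by positivity
  set ε : ℝ := (μ₁ + 1 + 32 * C ^ 2) * M with hε
  have hε0 : 0 ≤ ε := by positivity
  have hεG : ε = G * Real.exp (-τ / h) := by rw [hε, hM, hG]; ring
  set s : ℝ := N * ε with hs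
  have hs0 : 0 ≤ s := by positivity
  have hss : s ≤ s₀ := by
    refine le_trans ?_ hhs
    rw [hs, hεG, ← mul_assoc]
    exact mul_le_mul_of_nonneg_left (exp_neg_div_le hτ0 hh) (by positivity)
  have hs2 : s ≤ 1 / 2 := hss.trans (min_le_left _ _)
  have hsκ : s * κ ≤ δ₁ / 2 := by
    have := mul_le_mul_of_nonneg_right (hss.trans (min_le_right _ _)) hκ0.le
    refine this.trans (le_of_eq ?_)
    field_simp
  -- the masses of the eigenvectors of the limit problems in the cut-off region
  have hexp₁ : D₁ * Real.exp (-τ₁ * (2 * h)⁻¹) ≤ M := by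
    refine mul_le_mul (by linarith) (Real.exp_le_exp.2 ?_) (Real.exp_nonneg _) (by positivity)
    have h1 : -τ₁ * (2 * h)⁻¹ = -(τ₁ / 2) / h := by field_simp
    rw [h1]
    exact div_le_div_of_nonneg_right (neg_le_neg (min_le_left _ _)) hh.le
  have hexp₂ : D₂ * Real.exp (-τ₂ / h) ≤ M := by
    refine mul_le_mul (by linarith) (Real.exp_le_exp.2 ?_) (Real.exp_nonneg _) (by positivity)
    exact div_le_div_of_nonneg_right (neg_le_neg (min_le_right _ _)) hh.le
  have hmp : ∀ i, mass (up i) (Ici (2 * h)⁻¹) ≤ M := fun i => by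
    have := hdec₁ hHp.continuous hap _ (hLp.1 i).2 _ (hup.mem i) (2 * h)⁻¹
    rw [hup.norm_fst_sq, mul_one] at this
    exact this.trans hexp₁
  have hmm : ∀ i, mass (um i) (Ici (2 * h)⁻¹) ≤ M := fun i => by
    have := hdec₁ hHm.continuous ham _ (hLm.1 i).2 _ (hum.mem i) (2 * h)⁻¹
    rw [hum.norm_fst_sq, mul_one] at this
    exact this.trans hexp₁
  have hε16 : (μ₁ + 1 + 16 * C ^ 2) * M ≤ ε :=
    mul_le_mul_of_nonneg_right (by nlinarith [sq_nonneg C]) hM0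
  set X : ℝ := h ^ 2 * lam p with hX
  -- the upper bound
  have hupper : X * (1 - s) ≤ Λ p + s := by
    obtain ⟨φ, hφ, hφ1, hφ2⟩ := exists_trial_functions hω hHp.continuous hHm.continuous hap ham hh
      hh1 hha hC hup hum hμ0.le hM0 (fun i => (hLp.1 i).2.trans (by linarith))
      (fun i => (hLm.1 i).2.trans (by linarith)) hmp hmm
    exact eigenvalue_le_of_trial hlam hco hφ (sq_nonneg h) hε0 (fun r s => (hφ1 r s).trans hε16)
      (fun r s => (hφ2 r s).trans hε16) hmono e hL p
  obtain ⟨w, hw, -⟩ := hlam.exists_isEigenbasis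
  have hX0 : 0 ≤ X := mul_nonneg (sq_nonneg h) (hw.nonneg p)
  have hX1 : X ≤ Λ p + s * κ := by
    have h1 : X * (1 / 2) ≤ X * (1 - s) := mul_le_mul_of_nonneg_left (by linarith) hX0
    have h2 : 1 + X ≤ κ := by
      rw [hκ]
      linarith [hΛp.2]
    have h3 := mul_le_mul_of_nonneg_left h2 hs0
    linarith
  -- the lower bound, which uses the decay in the thin cylinder that the upper bound has made available
  have hlower : Λ p * (1 - s) ≤ X + s := by
    obtain ⟨A, B, hAB, hgram⟩ := exists_halves hω hHp.continuous hHm.continuous hap ham hh hh1 hha hC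
    have hlamX : ∀ i : Fin (p + 1), h ^ 2 * lam i ≤ X := fun i =>
      mul_le_mul_of_nonneg_left (hlam.1 (Nat.lt_succ_iff.1 i.2)) (sq_nonneg h)
    have hXμ : X ≤ μ₁ - δ₁ / 2 := by linarith [hΛp.2]
    have hmw : ∀ i : Fin (p + 1), mass (w i) (Icc (-(1 / 2)) (1 / 2)) ≤ M := fun i => by
      have := hdec₂ hHp.continuous hHm.continuous hap ham h hh hha _ ((hlamX i).trans hXμ) _ (hw.mem i)
      rw [hw.norm_fst_sq, mul_one] at this
      exact this.trans hexp₂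
    have hg := fun i j : Fin (p + 1) => hgram hw hμ0.le hM0 (i : ℕ) (j : ℕ)
      ((hlamX i).trans (by linarith)) ((hlamX j).trans (by linarith)) (hmw i) (hmw j)
    refine le_of_halves (S₁ := semiSide ω Hp) (S₂ := semiSide ω Hm) hmono e hL p hΛp.1.le
      (fun U hU horth => ListsEigenvalues.le_of_orthogonal hspanp hcp hΛp.1.le hΛp.2
        (by linarith [hΛp.2]) hcop hU horth)
      (fun U hU horth => ListsEigenvalues.le_of_orthogonal hspanm hcm hΛp.1.le hΛp.2
        (by linarith [hΛp.2]) hcom hU horth)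
      (v₁ := fun i => A (w i)) (v₂ := fun i => B (w i)) (d := fun i => h ^ 2 * lam i)
      (fun i => (hAB _ (hw.mem i).1).1) (fun i => (hAB _ (hw.mem i).1).2) hlamX hε0
      (fun i j => ?_) (fun i j => ?_)
    · simpa [Fin.ext_iff] using (hg i j).1
    · simpa [Fin.ext_iff] using (hg i j).2
  have hX2 : Λ p ≤ X + s * κ := by
    have h2 : 1 + Λ p ≤ κ := by
      rw [hκ]
      linarith [hΛp.2]
    have h3 := mul_le_mul_of_nonneg_left h2 hs0
    linarith
  have hfin : lam p - h⁻¹ ^ 2 * Λ p = h⁻¹ ^ 2 * (X - Λ p) := by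
    rw [hX]
    field_simp
  rw [hfin, abs_mul, abs_of_nonneg (by positivity : 0 ≤ h⁻¹ ^ 2)]
  have h1 : |X - Λ p| ≤ s * κ := abs_le.2 ⟨by linarith, by linarith⟩
  calc h⁻¹ ^ 2 * |X - Λ p| ≤ h⁻¹ ^ 2 * (s * κ) := by gcongr
    _ = N * G * κ * (h⁻¹ ^ 2 * Real.exp (-τ / h)) := by
      rw [hs, hεG]
      ring
    _ ≤ N * G * κ * (8 / τ ^ 2 * Real.exp (-(τ / 2) / h)) := by
      exact mul_le_mul_of_nonneg_left (inv_sq_mul_exp_le hτ0 hh) (by positivity)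
    _ = _ := by ring

/-- A Lipschitz function on a bounded set extends to a bounded Lipschitz function. -/
lemma exists_bounded_extension {s : Set E} (hs : Bornology.IsBounded s) {H : E → ℝ} {K : ℝ≥0}
    (hH : LipschitzOnWith K H s) :
    ∃ (a : ℝ) (H' : E → ℝ), LipschitzWith K H' ∧ (∀ η, |H' η| ≤ a) ∧ EqOn H H' s := by
  obtain ⟨H₁, hH₁, heq⟩ := hH.extend_real
  obtain ⟨R, hR⟩ := isBounded_iff_forall_norm_le.1 hs
  set a : ℝ := |H₁ 0| + K * |R| with ha
  have ha0 : 0 ≤ a := by positivity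
  have hb : ∀ η ∈ s, |H₁ η| ≤ a := fun η hη => by
    have h1 := hH₁.dist_le_mul η 0
    rw [Real.dist_eq, dist_zero_right] at h1
    have h2 : |H₁ η| ≤ |H₁ η - H₁ 0| + |H₁ 0| := by
      simpa using abs_add_le (H₁ η - H₁ 0) (H₁ 0)
    have h3 : (K : ℝ) * ‖η‖ ≤ K * |R| :=
      mul_le_mul_of_nonneg_left ((hR η hη).trans (le_abs_self R)) K.coe_nonneg
    linarith
  refine ⟨a, fun η => max (-a) (min (H₁ η) a), (hH₁.min_const a).const_max (-a), fun η => ?_,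
    fun η hη => ?_⟩
  · exact abs_le.2 ⟨le_max_left _ _, max_le (by linarith) (min_le_right _ _)⟩
  · have h1 := abs_le.1 (hb η hη)
    simp only
    rw [heq hη, min_eq_left h1.2, max_eq_right h1.1]

lemma semi_congr {H H' : E → ℝ} (h : EqOn H H' ω) :
    semi ω H = semi ω H' ∧ semiSide ω H = semiSide ω H' := by
  have h1 : semi ω H = semi ω H' := by
    ext x
    exact and_congr_right fun hx => by rw [h hx]
  have h2 : semiEnd ω H = semiEnd ω H' := by
    ext x
    exact and_congr_right fun hx => by rw [h hx]
  exact ⟨h1, by rw [semiSide, semiSide, h1, h2]⟩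

lemma thin_congr {Hp' Hm' : E → ℝ} (hp : EqOn Hp Hp' ω) (hm : EqOn Hm Hm' ω) (h : ℝ) :
    thin ω Hp Hm h = thin ω Hp' Hm' h ∧ thinSide ω Hp Hm h = thinSide ω Hp' Hm' h := by
  have h1 : thin ω Hp Hm h = thin ω Hp' Hm' h := by
    ext x
    exact and_congr_right fun hx => by rw [hp hx, hm hx]
  have h2 : thinEnds ω Hp Hm h = thinEnds ω Hp' Hm' h := by
    ext x
    exact or_congr (and_congr_right fun hx => by rw [hp hx]) (and_congr_right fun hx => by rw [hm hx])
  exact ⟨h1, by rw [thinSide, thinSide, h1, h2]⟩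

end Main

end ThinCylinder

theorem theorem4p1 {n : ℕ} (hn : 2 ≤ n) {ω : Set (EuclideanSpace ℝ (Fin (n - 1)))}
    (hω_open : IsOpen ω) (hω_conn : IsConnected ω) (hω_bdd : Bornology.IsBounded ω)
    (hω_lip : ThinCylinder.HasLipschitzBoundary ω)
    {Hp Hm : EuclideanSpace ℝ (Fin (n - 1)) → ℝ}
    (hHp : ∃ K : ℝ≥0, LipschitzOnWith K Hp (closure ω))
    (hHm : ∃ K : ℝ≥0, LipschitzOnWith K Hm (closure ω))
    {μ₁ δ₁ : ℝ} (hμ₁ : IsLeast {t | ThinCylinder.IsEigenvalue ω (frontier ω) t} μ₁)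
    (hδ₁ : 0 < δ₁)
    {Np Nm : ℕ} {Λp : Fin Np → ℝ} {Λm : Fin Nm → ℝ}
    (hLp : ThinCylinder.ListsEigenvalues (ThinCylinder.semi ω Hp) (ThinCylinder.semiSide ω Hp)
      (Set.Ioc 0 (μ₁ - δ₁)) Λp)
    (hLm : ThinCylinder.ListsEigenvalues (ThinCylinder.semi ω Hm) (ThinCylinder.semiSide ω Hm)
      (Set.Ioc 0 (μ₁ - δ₁)) Λm)
    {Λ : Fin (Np + Nm) → ℝ} (hL_mono : Monotone Λ)
    (e : Fin (Np + Nm) ≃ Fin Np ⊕ Fin Nm) (hL : ∀ p, Λ p = Sum.elim Λp Λm (e p)) :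
    ∀ p : Fin (Np + Nm), ∃ c > 0, ∃ τ > 0, ∃ h₀ > 0, ∀ h : ℝ, 0 < h → h ≤ h₀ →
      (∃ lam : ℕ → ℝ, ThinCylinder.IsEigenvalueSequence
        (ThinCylinder.thin ω Hp Hm h) (ThinCylinder.thinSide ω Hp Hm h) lam) ∧
      ∀ lam : ℕ → ℝ, ThinCylinder.IsEigenvalueSequence
        (ThinCylinder.thin ω Hp Hm h) (ThinCylinder.thinSide ω Hp Hm h) lam →
        |lam p - h⁻¹ ^ 2 * Λ p| ≤ c * Real.exp (-τ / h) := by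
  obtain ⟨Kp, hKp⟩ := hHp
  obtain ⟨Km, hKm⟩ := hHm
  obtain ⟨ap, Hp', hp1, hp2, hp3⟩ := ThinCylinder.exists_bounded_extension hω_bdd.closure hKp
  obtain ⟨am, Hm', hm1, hm2, hm3⟩ := ThinCylinder.exists_bounded_extension hω_bdd.closure hKm
  have hp := hp3.mono subset_closure
  have hm := hm3.mono subset_closure
  rw [(ThinCylinder.semi_congr hp).1, (ThinCylinder.semi_congr hp).2] at hLp
  rw [(ThinCylinder.semi_congr hm).1, (ThinCylinder.semi_congr hm).2] at hLm
  have : Nonempty (Fin (n - 1)) := ⟨⟨0, by omega⟩⟩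
  intro p
  have key := ThinCylinder.abs_eigenvalue_sub_le hω_open hω_conn.nonempty hω_bdd hp1 hm1
    (a := max ap am) (fun η => (hp2 η).trans (le_max_left _ _))
    (fun η => (hm2 η).trans (le_max_right _ _)) hμ₁ hδ₁ hLp hLm hL_mono e hL p
  simp only [(ThinCylinder.thin_congr hp hm _).1, (ThinCylinder.thin_congr hp hm _).2]
  exact key
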